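/- Let $a, a^\dagger$ be the annihilation and creation operators of a single bosonic mode on $\ell^2(\mathbb N)$, with $a|n\rangle=\sqrt n\,|n-1\rangle$. Let $\beta>0$, and let $\sigma=(1-e^{-\beta})\sum_{n\ge 0}e^{-\beta n}|n\rangle\langle n|$ be the fixed point of the quantum Ornstein–Uhlenbeck (attenuator) semigroup, whose generator in the Heisenberg picture is $$\mathcal L^*(X)=e^{-\beta/2}\Big(\tfrac12\{aa^\dagger,X\}-aXa^\dagger\Big)+e^{\beta/2}\Big(\tfrac12\{a^\dagger a,X\}-a^\dagger Xa\Big).$$ Put $\Gamma_\sigma^r(X)=\sigma^{r/2}X\sigma^{r/2}$ and $\langle X,Y\rangle_\sigma=\mathrm{tr}(\sigma^{1/2}X^\dagger\sigma^{1/2}Y)$. A state is a density operator $\rho$ with finite mean photon number, $\mathrm{tr}(\rho a^\dagger a)<\infty$. For $p>1$ with $\frac1p+\frac1{\hat p}=1$ let $$\mathcal E_p(\rho)=\frac{p\hat p}{4}\Big\langle\Gamma_\sigma^{-1/\hat p}\big(\rho^{1/\hat p}\big),\ \mathcal L^*\circ\Gamma_\sigma^{-1/p}\big(\rho^{1/p}\big)\Big\rangle_\sigma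 ,$$ the pairing being evaluated term by term along the spectral resolution of the left-hand factor $\rho^{1/\hat p}$, and let $\mathcal E_1(\rho)=\lim_{p\to1^+}\mathcal E_p(\rho)\in[0,+\infty]$. Let $D(\rho\|\sigma)=\mathrm{tr}(\rho\log\rho)-\mathrm{tr}(\rho\log\sigma)$. The $p$-log-Sobolev constant $\alpha_p=\inf_\rho \mathcal E_p(\rho)/D(\rho\|\sigma)$ (infimum over states with $D(\rho\|\sigma)\neq0$) is the largest $c\ge 0$ such that $c\,D(\rho\|\sigma)\le\mathcal E_p(\rho)$ for all states $\rho$. Theorem. The limit defining $\mathcal E_1(\rho)$ exists in $[0,+\infty]$ for every state $\rho$, and it equals $\frac14\langle\log\rho-\log\sigma,\ \mathcal L^*\circ\Gamma_\sigma^{-1}(\rho)\rangle_\sigma$ whenever $\rho$ is injective and the series for $\langle\log\rho,\cdot\rangle_\sigma$ (along the spectral resolution of $\rho$) and for $\langle\log\sigma,\cdot\rangle_\sigma$ (in the Fock basis) in this expression converge absolutely. For every $1<p\le2$, $$\alpha_p=\frac{p\hat p}{4\beta}\,e^{\beta/2}\big(1-e^{-\beta/p}\big)\big(1-e^{-\beta/\hat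 p}\big),$$ and $\alpha_1=\lim_{p\to1^+}\alpha_p=\frac12\sinh(\beta/2)$. In all these cases $\alpha_p$ is both the infimum and the largest constant above. -/

import Mathlib

open Filter Topology
open scoped InnerProductSpace

namespace QOU

noncomputable section

/-! ### The single-mode Fock space and operators on it -/

/-- The Hilbert space `ℓ²(ℕ, ℂ)` of a single bosonic mode; its standard basis is the Fock basis. -/
abbrev Fock : Type := lp (fun _ : ℕ => ℂ) 2

/-- The number state `|n⟩`. -/
def ket (n : ℕ) : Fock := lp.single 2 n (1 : ℂ)

/-- Operators in the Fock basis: infinite matrices `X m n = ⟨m|X|n⟩`. Unbounded operators such as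
`a`, `a†`, `σ⁻¹ᐟ² ρ σ⁻¹ᐟ²` are handled as such matrices. -/
abbrev FockMatrix : Type := ℕ → ℕ → ℂ

/-- The matrix of a bounded operator in the Fock basis. -/
def toMatrix (T : Fock →L[ℂ] Fock) : FockMatrix := fun m n => ⟪ket m, T (ket n)⟫_ℂ

/-- A physical state: a positive operator with `tr ρ = 1` and finite mean photon number
`tr (ρ a†a) = ∑ n ⟨n|ρ|n⟩ < ∞`. -/
structure IsState (ρ : Fock →L[ℂ] Fock) : Prop where
  isPositive : ρ.IsPositive
  trace_eq_one : HasSum (fun n => (toMatrix ρ n n).re) 1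
  finite_energy : Summable (fun n : ℕ => (n : ℝ) * (toMatrix ρ n n).re)

/-! ### Ladder operators: `a |n⟩ = √n |n-1⟩` and `a† |n⟩ = √(n+1) |n+1⟩` -/

/-- `a X`. -/
def aL (X : FockMatrix) : FockMatrix := fun m n => (Real.sqrt (m + 1) : ℂ) * X (m + 1) n

/-- `a† X`. -/
def adL (X : FockMatrix) : FockMatrix := fun m n => (Real.sqrt m : ℂ) * X (m - 1) n

/-- `X a`. -/
def aR (X : FockMatrix) : FockMatrix := fun m n => X m (n - 1) * (Real.sqrt n : ℂ)

/-- `X a†`. -/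
def adR (X : FockMatrix) : FockMatrix := fun m n => X m (n + 1) * (Real.sqrt (n + 1) : ℂ)

/-- The generator in the Heisenberg picture,
`ℒ*(X) = e^{-β/2} (½ {a a†, X} - a X a†) + e^{β/2} (½ {a† a, X} - a† X a)`. -/
def Lstar (β : ℝ) (X : FockMatrix) : FockMatrix :=
  (Real.exp (-β / 2) : ℂ) • ((1 / 2 : ℂ) • (aL (adL X) + adR (aR X)) - aL (adR X)) +
    (Real.exp (β / 2) : ℂ) • ((1 / 2 : ℂ) • (adL (aL X) + aR (adR X)) - adL (aR X))

/-! ### The fixed point and the weighted inner product -/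

/-- The eigenvalue `(1 - e^{-β}) e^{-β n}` of the thermal state `σ_β` at `|n⟩`. -/
def thermal (β : ℝ) (n : ℕ) : ℝ := (1 - Real.exp (-β)) * Real.exp (-β * n)

/-- The matrix of `log σ_β`. -/
def logThermal (β : ℝ) : FockMatrix := fun m n =>
  if m = n then (Real.log (thermal β n) : ℂ) else 0

/-- `Γ_σ^r (X) = σ^{r/2} X σ^{r/2}`. -/
def Gam (β r : ℝ) (X : FockMatrix) : FockMatrix := fun m n =>
  ((thermal β m ^ (r / 2) : ℝ) : ℂ) * X m n * ((thermal β n ^ (r / 2) : ℝ) : ℂ)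

/-- The terms of the double series
`⟨X, Y⟩_σ = tr (σ^{1/2} X† σ^{1/2} Y) = ∑_{m,n} σ_n^{1/2} conj (X m n) σ_m^{1/2} Y m n`. -/
def wTerm (β : ℝ) (X Y : FockMatrix) (k : ℕ × ℕ) : ℂ :=
  ((thermal β k.2 ^ (1 / 2 : ℝ) : ℝ) : ℂ) * star (X k.1 k.2) *
    ((thermal β k.1 ^ (1 / 2 : ℝ) : ℝ) : ℂ) * Y k.1 k.2

/-- The weighted inner product `⟨X, Y⟩_σ`. -/
def wInner (β : ℝ) (X Y : FockMatrix) : ℂ := ∑' k : ℕ × ℕ, wTerm β X Y k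

/-! ### Spectral resolution and powers of a state -/

/-- The eigenspace of `T` for the real number `x`. -/
def eigSpace {H : Type*} [NormedAddCommGroup H] [InnerProductSpace ℂ H]
    (T : H →L[ℂ] H) (x : ℝ) : Submodule ℂ H :=
  Module.End.eigenspace (T : H →ₗ[ℂ] H) (x : ℂ)

instance eigSpace_completeSpace {H : Type*} [NormedAddCommGroup H] [InnerProductSpace ℂ H]
    [CompleteSpace H] (T : H →L[ℂ] H) (x : ℝ) : CompleteSpace (eigSpace T x) := by
  have h : IsClosed (eigSpace T x : Set H) := by
    have : (eigSpace T x : Set H) = {v | T v = (x : ℂ) • v} := by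
      ext v
      exact Module.End.mem_eigenspace_iff
    rw [this]
    exact isClosed_eq T.continuous (continuous_const_smul _)
  exact h.completeSpace_coe

/-- The matrix of the spectral projection `P_x` of `ρ`; for a state, `f(ρ) = ∑_x f(x) P_x`. -/
def specProj (ρ : Fock →L[ℂ] Fock) (x : ℝ) : FockMatrix := toMatrix (eigSpace ρ x).starProjection

/-- `f(T)` for a self-adjoint operator `T` and `f` continuous on its spectrum, by the continuous
functional calculus. -/
def opFun {H : Type*} [NormedAddCommGroup H] [InnerProductSpace ℂ H] [CompleteSpace H]
    (f : ℝ → ℝ) (T : H →L[ℂ] H) : H →L[ℂ] H := cfc f T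

/-- The power `ρ^s` for `s > 0`. -/
def power (ρ : Fock →L[ℂ] Fock) (s : ℝ) : Fock →L[ℂ] Fock := opFun (fun x => x ^ s) ρ

/-! ### Dirichlet forms, relative entropy, log-Sobolev constants -/

/-- For `1 < p`, with Hölder conjugate `q`, the Dirichlet form
`ℰ_p(ρ) = (p q / 4) ⟨Γ_σ^{-1/q}(ρ^{1/q}), ℒ* Γ_σ^{-1/p}(ρ^{1/p})⟩_σ`.
The left factor is expanded along the spectral resolution `ρ^{1/q} = ∑_x x^{1/q} P_x`: in this order
all series converge absolutely for every state of finite mean photon number. -/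
def dirichletGtOne (β p : ℝ) (ρ : Fock →L[ℂ] Fock) : ℝ :=
  p * p.conjExponent / 4 *
    ∑' x : ℝ, (wInner β
      (Gam β (-(1 / p.conjExponent)) (((x ^ (1 / p.conjExponent) : ℝ) : ℂ) • specProj ρ x))
      (Lstar β (Gam β (-(1 / p)) (toMatrix (power ρ (1 / p)))))).re

/-- The Dirichlet form `ℰ_p(ρ)` for `1 ≤ p`, where `ℰ_1(ρ) = lim_{p → 1⁺} ℰ_p(ρ)`. The limit is
`+∞` for some states (pure states for example), hence extended real values. -/
def dirichlet (β p : ℝ) (ρ : Fock →L[ℂ] Fock) : EReal :=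
  if p = 1 then limUnder (𝓝[>] (1 : ℝ)) (fun q => ((dirichletGtOne β q ρ : ℝ) : EReal))
  else ((dirichletGtOne β p ρ : ℝ) : EReal)

/-- The terms, indexed by the eigenvalues `x` of `ρ`, of the expansion of
`⟨log ρ, ℒ* Γ_σ^{-1}(ρ)⟩_σ` along `log ρ = ∑_x (log x) P_x`. -/
def logTerm (β : ℝ) (ρ : Fock →L[ℂ] Fock) (x : ℝ) : ℝ :=
  (wInner β ((Real.log x : ℂ) • specProj ρ x) (Lstar β (Gam β (-1) (toMatrix ρ)))).re

/-- The relative entropy `D(ρ‖σ_β) = tr (ρ log ρ) - tr (ρ log σ_β)`. -/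
def relEntropy (β : ℝ) (ρ : Fock →L[ℂ] Fock) : ℝ :=
  (∑' n, (toMatrix (opFun (fun x => x * Real.log x) ρ) n n).re) -
    (∑' n, (toMatrix ρ n n).re * Real.log (thermal β n))

/-- The `p`-log-Sobolev inequality with parameter `c`: `c D(ρ‖σ_β) ≤ ℰ_p(ρ)` for all states. -/
def LogSobolev (β p c : ℝ) : Prop :=
  ∀ ρ : Fock →L[ℂ] Fock, IsState ρ → ((c * relEntropy β ρ : ℝ) : EReal) ≤ dirichlet β p ρ

/-- The optimal constant `α_p = inf_ρ ℰ_p(ρ) / D(ρ‖σ_β)`, over all states for which the quotient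
makes sense, that is, with `D(ρ‖σ_β) ≠ 0`. -/
def logSobolevConst (β p : ℝ) : EReal :=
  ⨅ (ρ : Fock →L[ℂ] Fock) (_ : IsState ρ ∧ relEntropy β ρ ≠ 0),
    dirichlet β p ρ / ((relEntropy β ρ : ℝ) : EReal)

/-- The value `(p q / (4 β)) e^{β/2} (1 - e^{-β/p}) (1 - e^{-β/q})`, `q` the conjugate of `p`. -/
def alphaValue (β p : ℝ) : ℝ :=
  p * p.conjExponent / (4 * β) * Real.exp (β / 2) * (1 - Real.exp (-β / p)) *
    (1 - Real.exp (-β / p.conjExponent))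

end

end QOU

/-! Expand everything in eigenvectors `v i` of `ρ`, with the eigenvalues `lam i` in decreasing
order. For `s = 1/p ≥ 1/2` the Dirichlet form depends only on the eigenvalues, the mean photon
numbers `E i` of the eigenvectors and the weights `M i j = |⟨v i|a|v j⟩|²` (`dirichletGtOne_eq`). Up
to a prefactor it is `e^{-β}(N+1) + N` minus two weighted overlaps `∑ M i j (lam i)^{1-s} (lam
j)^s`, one for `s` and one for `1-s`. Bessel's inequality for `a v j` and `a† v i` bounds the column
sums of `M` by `E j` and the row sums by `E i + 1`. Together with the entropy and energy sums, this
trace of the commutation relation is all that the lower bound needs.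

The `gain` of a transition is subadditive along monotone triples of eigenvalues. It is therefore at
most `ψ i - ψ j`, where the potential `ψ` adds up gains over consecutive eigenvalues
(`gain_le_potential_sub`). Inserting the row and column bounds, the terms `ψ i * E i` cancel and
only `∑ ψ` survives, as if `ρ` were diagonal in the Fock basis with decreasing weights
(`overlap_le`). Hölder's inequality passes from the eigenvalues to their tails
(`potential_le_gain_tail`). A one-variable inequality, tight at the ratio `e^{-β}` of `σ`
(`deficit_nonneg`), compares each tail step with the entropy of splitting that tail. These entropies
telescope to the entropy of `ρ`, and the coefficient of `N` fits, so a multiple of `D(ρ‖σ)` appears.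
The constant is optimal because thermal states of inverse temperature `θ → 0⁺` saturate it in the
limit (`optimal_of_tendsto`).

For `p → 1⁺`, write the form as a sum over transitions of `edge s`, plus a term for transitions into
the kernel of `ρ`. Each `edge` is a chord slope of a convex function of `(s - 1/2)²`, hence
increasing in `s` on `[1/2, 1)`. So the limit `ℰ_1` exists in the extended reals, and the
inequalities pass to it. If `ρ` is injective nothing is lost to the kernel, `edge` converges
dominatedly to `(u - w)(log u - log w)`, and truncating the logarithm identifies the limit with the
entropy production formula. -/

namespace QOU

noncomputable section

/-! ### Spectral resolution of compact positive operators. -/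

section Hilbert

variable {H : Type*} [NormedAddCommGroup H] [InnerProductSpace ℂ H] [CompleteSpace H]

/-- A spectral resolution `T = ∑ i, lam i • |v i⟩⟨v i|` with decreasing eigenvalues, padded with
zeros when `T` has finite rank. -/
structure IsSpec (T : H →L[ℂ] H) (lam : ℕ → ℝ) (v : ℕ → H) : Prop where
  nonneg : ∀ i, 0 ≤ lam i
  antitone : Antitone lam
  orth : ∀ i j, i ≠ j → ⟪v i, v j⟫_ℂ = 0
  norm_one : ∀ i, lam i ≠ 0 → ‖v i‖ = 1
  zero : ∀ i, lam i = 0 → v i = 0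
  eig : ∀ i, T (v i) = (lam i : ℂ) • v i
  ker : ∀ w, (∀ i, ⟪v i, w⟫_ℂ = 0) → T w = 0

/-- Complete the nonzero `v i` to a Hilbert basis: the added vectors lie in the kernel of `T` and
contribute nothing to the Parseval sum. No sign or order is asked of `g`, so the lemma serves for
`f(T)` and for the identity as well as for `T`. -/
theorem hasSum_inner_apply {v : ℕ → H} (orth : ∀ i j, i ≠ j → ⟪v i, v j⟫_ℂ = 0)
    (norm_one : ∀ i, v i ≠ 0 → ‖v i‖ = 1) {T : H →L[ℂ] H}
    (hT : IsSelfAdjoint T) {g : ℕ → ℝ} (hg : ∀ i, T (v i) = (g i : ℂ) • v i)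
    (hker : ∀ w, (∀ i, ⟪v i, w⟫_ℂ = 0) → T w = 0) (x y : H) :
    HasSum (fun j => (g j : ℂ) * (⟪x, v j⟫_ℂ * ⟪v j, y⟫_ℂ)) ⟪x, T y⟫_ℂ := by
  have hsym : ∀ x y, ⟪T x, y⟫_ℂ = ⟪x, T y⟫_ℂ := fun x y => hT.isSymmetric x y
  let I := {j : ℕ // v j ≠ 0}
  let u : I → H := fun j => v j
  have hu : Orthonormal ℂ u := by
    refine ⟨fun i => norm_one i i.2, fun i j hij => orth i j fun h => hij (Subtype.ext h)⟩
  obtain ⟨W, b, hsub, hb⟩ := hu.toSubtypeRange.exists_hilbertBasis_extension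
  let e : I → W := fun j => ⟨u j, hsub ⟨j, rfl⟩⟩
  have he : Function.Injective e := by
    intro i j hij
    have : u i = u j := congrArg Subtype.val hij
    exact hu.linearIndependent.injective this
  have h1 := b.hasSum_inner_mul_inner x (T y)
  have h2 : ∀ w ∉ Set.range e, ⟪x, b w⟫_ℂ * ⟪b w, T y⟫_ℂ = 0 := by
    intro w hw
    have : T (b w) = 0 := by
      apply hker
      intro i
      by_cases hi : v i = 0
      · simp [hi]
      · have : b (e ⟨i, hi⟩) = v i := by rw [hb]
        rw [← this, b.orthonormal.2]
        intro h
        exact hw ⟨_, h⟩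
    rw [← hsym, this, inner_zero_left, mul_zero]
  rw [← he.hasSum_iff h2] at h1
  have h3 : ∀ j : ℕ, j ∉ Set.range (Subtype.val : I → ℕ) →
      (g j : ℂ) * (⟪x, v j⟫_ℂ * ⟪v j, y⟫_ℂ) = 0 := by
    intro j hj
    have : v j = 0 := by
      by_contra h
      exact hj ⟨⟨j, h⟩, rfl⟩
    simp [this]
  rw [← Subtype.val_injective.hasSum_iff h3]
  convert h1 using 1
  funext j
  have : b (e j) = v j := by rw [hb]
  simp only [Function.comp_apply, this]
  rw [← hsym, hg, inner_smul_left, Complex.conj_ofReal]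
  ring

theorem aeval_apply_eigenvector {T : H →L[ℂ] H} {x : ℝ} {v : H} (hv : T v = (x : ℂ) • v)
    (p : Polynomial ℝ) : (Polynomial.aeval T p) v = ((p.eval x : ℝ) : ℂ) • v := by
  induction p using Polynomial.induction_on' with
  | add p q hp hq => simp [hp, hq, add_smul]
  | monomial n a =>
    have : ∀ n : ℕ, (T ^ n) v = ((x : ℂ) ^ n) • v := by
      intro n
      induction n with
      | zero => simp
      | succ k ih => rw [pow_succ, mul_apply_eq_comp, hv, map_smul, ih, smul_smul,
          pow_succ, mul_comm]
    rw [Polynomial.aeval_monomial, mul_apply_eq_comp, this, Algebra.algebraMap_eq_smul_one]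
    simp only [smul_apply, one_apply_eq_self, Polynomial.eval_monomial]
    rw [Complex.ofReal_mul, mul_smul, Complex.ofReal_pow]
    exact (Complex.coe_smul _ _).symm

theorem cfc_apply_eigenvector {T : H →L[ℂ] H} (hT : IsSelfAdjoint T) {f : ℝ → ℝ}
    (hf : Continuous f) {x : ℝ} {v : H} (hv : T v = (x : ℂ) • v) :
    cfc f T v = (f x : ℂ) • v := by
  rw [← sub_eq_zero, ← norm_eq_zero]
  refine le_antisymm (le_of_forall_pos_le_add fun ε hε => ?_) (norm_nonneg _)
  -- The interval must contain `x` besides the spectrum, because `v = 0` is allowed and `x` may then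
  -- lie outside the spectrum.
  set R := max |x| ‖T‖ with hR
  set δ := ε / (2 * (‖v‖ + 1)) with hδ
  have hδ0 : 0 < δ := by positivity
  obtain ⟨p, hp⟩ := exists_polynomial_near_of_continuousOn (-R) R f hf.continuousOn δ hδ0
  have hx : x ∈ Set.Icc (-R) R := abs_le.mp (le_max_left _ _)
  have h1 : ‖cfc f T - Polynomial.aeval T p‖ ≤ δ := by
    rw [← cfc_polynomial p T hT, ← cfc_sub f _ T hf.continuousOn p.continuous.continuousOn]
    refine norm_cfc_le hδ0.le fun t ht => ?_
    have : ‖t‖ ≤ ‖T‖ := by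
      calc ‖t‖ ≤ ‖T‖ * ‖(1 : H →L[ℂ] H)‖ := spectrum.norm_le_norm_mul_of_mem ht
        _ ≤ ‖T‖ * 1 := by gcongr; exact ContinuousLinearMap.norm_id_le
        _ = ‖T‖ := mul_one _
    have := hp t (abs_le.mp (this.trans (le_max_right _ _)))
    rw [Real.norm_eq_abs, abs_sub_comm]
    exact this.le
  have h2 : cfc f T v - (f x : ℂ) • v =
      (cfc f T - Polynomial.aeval T p) v + ((p.eval x - f x : ℝ) : ℂ) • v := by
    rw [sub_apply, aeval_apply_eigenvector hv]
    push_cast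
    module
  rw [h2]
  have h3 := (cfc f T - Polynomial.aeval T p).le_of_opNorm_le h1 v
  have h4 : ‖((p.eval x - f x : ℝ) : ℂ) • v‖ ≤ δ * ‖v‖ := by
    rw [norm_smul, Complex.norm_real]
    exact mul_le_mul_of_nonneg_right (hp x hx).le (norm_nonneg _)
  have h5 : δ * ‖v‖ + δ * ‖v‖ ≤ ε := by
    rw [hδ]
    have : ε / (2 * (‖v‖ + 1)) * ‖v‖ + ε / (2 * (‖v‖ + 1)) * ‖v‖ = ε * (‖v‖ / (‖v‖ + 1)) := by
      field_simp
      ring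
    rw [this]
    have : ‖v‖ / (‖v‖ + 1) ≤ 1 := by
      rw [div_le_one (by positivity)]
      linarith
    nlinarith
  linarith [norm_add_le ((cfc f T - Polynomial.aeval T p) v) (((p.eval x - f x : ℝ) : ℂ) • v)]

/-- The norm of a positive element of a C*-algebra lies in its spectrum, and a nonzero spectral
value of a compact operator is an eigenvalue. -/
theorem exists_norm_eigenvector {T : H →L[ℂ] H} (hT : T.IsPositive) (hc : IsCompactOperator T)
    (h0 : T ≠ 0) : ∃ v, ‖v‖ = 1 ∧ T v = (‖T‖ : ℂ) • v := by
  have : Nontrivial H := by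
    by_contra h
    rw [not_nontrivial_iff_subsingleton] at h
    exact h0 (Subsingleton.elim _ _)
  have h1 : (‖T‖ : ℂ) ∈ spectrum ℂ T :=
    spectrum.algebraMap_mem ℂ (CStarAlgebra.norm_mem_spectrum_of_nonneg
      ((ContinuousLinearMap.nonneg_iff_isPositive T).2 hT))
  rw [← hc.hasEigenvalue_iff_mem_spectrum (by simpa using h0)] at h1
  obtain ⟨v, hv, hv0⟩ := h1.exists_hasEigenvector
  rw [Module.End.mem_eigenspace_iff] at hv
  refine ⟨((‖v‖⁻¹ : ℝ) : ℂ) • v, ?_, ?_⟩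
  · rw [norm_smul, Complex.norm_real, norm_inv, norm_norm, inv_mul_cancel₀ (norm_ne_zero_iff.2 hv0)]
  · rw [map_smul, smul_comm]
    congr 1

open Classical in
/-- A unit eigenvector for the eigenvalue `‖T‖` if there is one and `T ≠ 0`, else `0`. -/
def topVec (T : H →L[ℂ] H) : H :=
  if h : T ≠ 0 ∧ ∃ v, ‖v‖ = 1 ∧ T v = (‖T‖ : ℂ) • v then h.2.choose else 0

/-- Compression of `T` to the orthogonal complement of its top eigenvector. -/
def deflate (T : H →L[ℂ] H) : H →L[ℂ] H :=
  (1 - InnerProductSpace.rankOne ℂ (topVec T) (topVec T)) ∘L T ∘L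
    (1 - InnerProductSpace.rankOne ℂ (topVec T) (topVec T))

theorem topVec_eig (T : H →L[ℂ] H) : T (topVec T) = (‖T‖ : ℂ) • topVec T := by
  unfold topVec
  split_ifs with h
  · exact h.2.choose_spec.2
  · simp

theorem topVec_norm {T : H →L[ℂ] H} (hT : T.IsPositive) (hc : IsCompactOperator T)
    (h0 : T ≠ 0) : ‖topVec T‖ = 1 := by
  unfold topVec
  have h : T ≠ 0 ∧ ∃ v, ‖v‖ = 1 ∧ T v = (‖T‖ : ℂ) • v := ⟨h0, exists_norm_eigenvector hT hc h0⟩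
  rw [dif_pos h]
  exact h.2.choose_spec.1

theorem topVec_zero : topVec (0 : H →L[ℂ] H) = 0 := by
  unfold topVec
  simp

theorem topVec_inner {T : H →L[ℂ] H} (hT : T.IsPositive) {w : H} (hw : T w = 0) :
    ⟪topVec T, w⟫_ℂ = 0 := by
  by_cases h0 : T = 0
  · simp [h0, topVec_zero]
  · have h1 : ⟪T (topVec T), w⟫_ℂ = ⟪topVec T, T w⟫_ℂ := hT.isSymmetric _ _
    rw [hw, inner_zero_right, topVec_eig, inner_smul_left, Complex.conj_ofReal] at h1
    exact (mul_eq_zero.1 h1).resolve_left (by simpa using h0)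

/-- Since `topVec T` is an eigenvector, compressing on both sides only subtracts its rank-one part.
-/
theorem deflate_apply {T : H →L[ℂ] H} (hT : T.IsPositive) (hc : IsCompactOperator T) (x : H) :
    deflate T x = T x - ((‖T‖ : ℂ) * ⟪topVec T, x⟫_ℂ) • topVec T := by
  by_cases h0 : T = 0
  · simp [h0, deflate]
  have hs : ∀ x, ⟪topVec T, T x⟫_ℂ = (‖T‖ : ℂ) * ⟪topVec T, x⟫_ℂ := fun x => by
    have h1 : ⟪T (topVec T), x⟫_ℂ = ⟪topVec T, T x⟫_ℂ := hT.isSymmetric _ _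
    rw [← h1, topVec_eig, inner_smul_left, Complex.conj_ofReal]
  have hn : ⟪topVec T, topVec T⟫_ℂ = 1 := by
    rw [inner_self_eq_norm_sq_to_K, topVec_norm hT hc h0]
    simp
  simp only [deflate, ContinuousLinearMap.comp_apply, sub_apply, one_apply_eq_self,
    InnerProductSpace.rankOne_apply, map_sub, map_smul, topVec_eig, hs,
    hn]
  module

theorem deflate_isPositive {T : H →L[ℂ] H} (hT : T.IsPositive) : (deflate T).IsPositive := by
  have h : ContinuousLinearMap.adjoint (1 - InnerProductSpace.rankOne ℂ (topVec T) (topVec T)) =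
      1 - InnerProductSpace.rankOne ℂ (topVec T) (topVec T) := by
    rw [map_sub, InnerProductSpace.adjoint_rankOne]
    congr 1
    exact (IsSelfAdjoint.one _)
  have := hT.conj_adjoint (1 - InnerProductSpace.rankOne ℂ (topVec T) (topVec T))
  rwa [h] at this

theorem deflate_isCompact {T : H →L[ℂ] H} (hc : IsCompactOperator T) :
    IsCompactOperator (deflate T) := by
  unfold deflate
  exact (hc.comp_clm (1 - InnerProductSpace.rankOne ℂ (topVec T) (topVec T))).clm_comp
    (1 - InnerProductSpace.rankOne ℂ (topVec T) (topVec T))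

theorem deflate_norm_le {T : H →L[ℂ] H} (hT : T.IsPositive) (hc : IsCompactOperator T) :
    ‖deflate T‖ ≤ ‖T‖ := by
  by_cases h0 : T = 0
  · simp [h0, deflate]
  have hn : ⟪topVec T, topVec T⟫_ℂ = 1 := by
    rw [inner_self_eq_norm_sq_to_K, topVec_norm hT hc h0]
    simp
  refine ContinuousLinearMap.opNorm_le_bound _ (norm_nonneg _) fun x => ?_
  have h1 : deflate T x = T (x - ⟪topVec T, x⟫_ℂ • topVec T) := by
    rw [deflate_apply hT hc, map_sub, map_smul, topVec_eig, smul_smul, mul_comm]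
  have h2 : ‖x - ⟪topVec T, x⟫_ℂ • topVec T‖ ≤ ‖x‖ := by
    have horth : ⟪x - ⟪topVec T, x⟫_ℂ • topVec T, ⟪topVec T, x⟫_ℂ • topVec T⟫_ℂ = 0 := by
      rw [inner_smul_right, inner_sub_left, inner_smul_left, hn, inner_conj_symm]
      simp
    have := norm_add_sq_eq_norm_sq_add_norm_sq_of_inner_eq_zero _ _ horth
    rw [sub_add_cancel] at this
    nlinarith [norm_nonneg (x - ⟪topVec T, x⟫_ℂ • topVec T), norm_nonneg x,
      norm_nonneg (⟪topVec T, x⟫_ℂ • topVec T)]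
  rw [h1]
  exact (T.le_opNorm _).trans (mul_le_mul_of_nonneg_left h2 (norm_nonneg _))

/-- Deflate repeatedly; the eigenvalues are the successive norms. A vector orthogonal to every `v i`
is never affected by a deflation, so `‖T w‖ ≤ lam n * ‖w‖` for all `n`, and `lam n` becomes
arbitrarily small. -/
theorem IsSpec.exists_of_isCompact {T : H →L[ℂ] H} (hT : T.IsPositive)
    (hc : IsCompactOperator T) : ∃ lam v, IsSpec T lam v := by
  set S : ℕ → H →L[ℂ] H := fun n => deflate^[n] T with hS
  have hSs : ∀ n, S (n + 1) = deflate (S n) := fun n => Function.iterate_succ_apply' _ _ _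
  have hpos : ∀ n, (S n).IsPositive := by
    intro n
    induction n with
    | zero => exact hT
    | succ k ih => rw [hSs]; exact deflate_isPositive ih
  have hcomp : ∀ n, IsCompactOperator (S n) := by
    intro n
    induction n with
    | zero => exact hc
    | succ k ih => rw [hSs]; exact deflate_isCompact ih
  set lam : ℕ → ℝ := fun n => ‖S n‖ with hlam
  set v : ℕ → H := fun n => topVec (S n) with hv
  have hanti : Antitone lam := antitone_nat_of_succ_le fun n => by
    simp only [hlam, hSs]
    exact deflate_norm_le (hpos n) (hcomp n)
  have hnorm : ∀ i, lam i ≠ 0 → ‖v i‖ = 1 := fun i hi =>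
    topVec_norm (hpos i) (hcomp i) (by simpa [hlam] using hi)
  have hzero : ∀ i, lam i = 0 → v i = 0 := by
    intro i hi
    have : S i = 0 := by simpa [hlam] using hi
    simp only [hv, this, topVec_zero]
  have hself : ∀ n, S (n + 1) (v n) = 0 := by
    intro n
    by_cases h0 : lam n = 0
    · rw [hzero n h0, map_zero]
    rw [hSs, deflate_apply (hpos n) (hcomp n), topVec_eig]
    have : ⟪v n, v n⟫_ℂ = 1 := by
      rw [inner_self_eq_norm_sq_to_K, hnorm n h0]
      simp
    simp only [hv] at this
    rw [this, mul_one, sub_self]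
  have hkill : ∀ i n, i < n → S n (v i) = 0 := by
    intro i n hin
    induction n, hin using Nat.le_induction with
    | base => exact hself i
    | succ k hk ih =>
      rw [hSs, deflate_apply (hpos k) (hcomp k), ih, topVec_inner (hpos k) ih]
      simp
  have horth' : ∀ i j, i < j → ⟪v j, v i⟫_ℂ = 0 := fun i j hij =>
    topVec_inner (hpos j) (hkill i j hij)
  have horth : ∀ i j, i ≠ j → ⟪v i, v j⟫_ℂ = 0 := by
    intro i j hij
    rcases lt_or_gt_of_ne hij with h | h
    · rw [← inner_conj_symm, horth' i j h, map_zero]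
    · exact horth' j i h
  have hstep : ∀ n w, ⟪v n, w⟫_ℂ = 0 → S (n + 1) w = S n w := by
    intro n w hw
    rw [hSs, deflate_apply (hpos n) (hcomp n)]
    simp only [hv] at hw
    rw [hw]
    simp
  have heig : ∀ i, T (v i) = (lam i : ℂ) • v i := by
    intro i
    have : ∀ n ≤ i, S n (v i) = T (v i) := by
      intro n hn
      induction n with
      | zero => rfl
      | succ k ih => rw [hstep k _ (horth k i (by omega)), ih (by omega)]
    rw [← this i le_rfl, topVec_eig]
  -- Otherwise the vectors `T (v n)` would be orthogonal of norm at least `L`, and compactness would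
  -- give them a convergent subsequence.
  have hlim : ∀ L, 0 < L → ∃ n, lam n < L := by
    intro L hL
    by_contra! hcon
    have hne : ∀ i, lam i ≠ 0 := fun i => (hL.trans_le (hcon i)).ne'
    obtain ⟨K, hK, hsub⟩ := hc.image_closedBall_subset_compact 1
    obtain ⟨y, _, φ, hφ, hlimy⟩ := hK.tendsto_subseq (x := fun n => T (v n))
      (fun n => hsub ⟨v n, by simp [hnorm n (hne n)], rfl⟩)
    have hcau := hlimy.cauchySeq
    rw [Metric.cauchySeq_iff'] at hcau
    obtain ⟨N, hN⟩ := hcau L hL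
    have h1 := hN (N + 1) (by omega)
    have hneq : φ (N + 1) ≠ φ N := fun h => by have := hφ.injective h; omega
    simp only [Function.comp_apply, dist_eq_norm, heig] at h1
    have h2 : ⟪(lam (φ (N + 1)) : ℂ) • v (φ (N + 1)), (lam (φ N) : ℂ) • v (φ N)⟫_ℂ = 0 := by
      rw [inner_smul_left, inner_smul_right, horth _ _ hneq]
      simp
    have h3 := norm_sub_sq (𝕜 := ℂ) ((lam (φ (N + 1)) : ℂ) • v (φ (N + 1))) ((lam (φ N) : ℂ) • v (φ N))
    rw [h2, map_zero, mul_zero, sub_zero] at h3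
    have h4 : ‖(lam (φ (N + 1)) : ℂ) • v (φ (N + 1))‖ = lam (φ (N + 1)) := by
      rw [norm_smul, hnorm _ (hne _), mul_one, Complex.norm_real, Real.norm_eq_abs,
        abs_of_nonneg (norm_nonneg _)]
    rw [h4] at h3
    have := hcon (φ (N + 1))
    nlinarith [norm_nonneg ((lam (φ N) : ℂ) • v (φ N)),
      norm_nonneg ((lam (φ (N + 1)) : ℂ) • v (φ (N + 1)) - (lam (φ N) : ℂ) • v (φ N))]
  refine ⟨lam, v, fun i => norm_nonneg _, hanti, horth, hnorm, hzero, heig, fun w hw => ?_⟩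
  have hSw : ∀ n, S n w = T w := by
    intro n
    induction n with
    | zero => rfl
    | succ k ih => rw [hstep k w (hw k), ih]
  rw [← norm_eq_zero]
  refine le_antisymm (le_of_forall_pos_le_add fun ε hε => ?_) (norm_nonneg _)
  obtain ⟨n, hn⟩ := hlim (ε / (‖w‖ + 1)) (by positivity)
  have h1 := (S n).le_opNorm w
  rw [hSw] at h1
  have h2 : lam n * (‖w‖ + 1) < ε := (lt_div_iff₀ (by positivity)).1 hn
  have : ‖S n‖ * ‖w‖ = lam n * ‖w‖ := rfl
  nlinarith [norm_nonneg (S n), norm_nonneg w, show lam n = ‖S n‖ from rfl]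

end Hilbert

/-! ### The Fock basis and compactness of states. -/

theorem inner_ket (n : ℕ) (x : Fock) : ⟪ket n, x⟫_ℂ = x n := by
  simp [ket, lp.inner_single_left]

theorem inner_ket_right (n : ℕ) (x : Fock) : ⟪x, ket n⟫_ℂ = star (x n) := by
  rw [← inner_conj_symm, inner_ket]
  rfl

theorem norm_ket (n : ℕ) : ‖ket n‖ = 1 := by
  simp [ket]

theorem hasSum_norm_sq (x : Fock) : HasSum (fun n => ‖x n‖ ^ 2) (‖x‖ ^ 2) := by
  have := lp.hasSum_norm (p := 2) (by norm_num) x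
  simpa using this

theorem memlp_two_iff {f : ℕ → ℂ} :
    Memℓp (E := fun _ : ℕ => ℂ) f 2 ↔ Summable fun n => ‖f n‖ ^ 2 := by
  rw [memℓp_gen_iff (by norm_num)]
  simp

/-- Hilbert–Schmidt operators are norm limits of their finite-rank truncations `F n`; the
Cauchy–Schwarz inequality bounds the remainder. -/
theorem isCompactOperator_of_summable {T : Fock →L[ℂ] Fock}
    (h : Summable fun n => ‖T (ket n)‖ ^ 2) : IsCompactOperator T := by
  let F : ℕ → Fock →L[ℂ] Fock := fun n =>
    ∑ k ∈ Finset.range n, InnerProductSpace.rankOne ℂ (T (ket k)) (ket k)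
  have hF : ∀ n, IsCompactOperator (F n) := by
    intro n
    simp only [F]
    induction n with
    | zero => simpa using isCompactOperator_zero
    | succ m ih =>
      rw [Finset.sum_range_succ]
      refine IsCompactOperator.add ih ?_
      have : IsCompactOperator (innerSL ℂ (ket m)) :=
        (isCompactOperator_id (E := ℂ)).comp_clm (innerSL ℂ (ket m))
      rw [InnerProductSpace.rankOne_def']
      exact this.clm_comp (ContinuousLinearMap.toSpanSingleton ℂ (T (ket m)))
  have hlim := tendsto_sum_nat_add (fun n => ‖T (ket n)‖ ^ 2)
  refine isCompactOperator_of_tendsto (l := atTop) (F := F) ?_ (Eventually.of_forall hF)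
  rw [tendsto_iff_norm_sub_tendsto_zero]
  have hbound : ∀ n, ‖F n - T‖ ≤ Real.sqrt (∑' k, ‖T (ket (k + n))‖ ^ 2) := by
    intro n
    refine ContinuousLinearMap.opNorm_le_bound _ (Real.sqrt_nonneg _) fun x => ?_
    have h1 : HasSum (fun k => x k • T (ket k)) (T x) := by
      have := (lp.hasSum_single (by norm_num) x).mapL T
      refine this.congr_fun fun k => ?_
      rw [← map_smul]
      congr 1
      simp [ket, ← lp.single_smul]
    have h2 : HasSum (fun k => x (k + n) • T (ket (k + n))) (T x - F n x) := by
      have := (hasSum_nat_add_iff' n).2 h1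
      convert this using 2
      simp [F, inner_ket]
    have h3 : ‖T x - F n x‖ ≤ Real.sqrt (∑' k, ‖T (ket (k + n))‖ ^ 2) * ‖x‖ := by
      refine le_of_tendsto h2.norm (Eventually.of_forall fun s => ?_)
      rw [← Real.sqrt_sq (norm_nonneg x), ← Real.sqrt_mul (tsum_nonneg fun _ => by positivity)]
      refine Real.le_sqrt_of_sq_le ?_
      calc ‖∑ k ∈ s, x (k + n) • T (ket (k + n))‖ ^ 2
          ≤ (∑ k ∈ s, ‖T (ket (k + n))‖ * ‖x (k + n)‖) ^ 2 := by
            gcongr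
            refine (norm_sum_le _ _).trans (Finset.sum_le_sum fun k _ => ?_)
            rw [norm_smul, mul_comm]
        _ ≤ (∑ k ∈ s, ‖T (ket (k + n))‖ ^ 2) * ∑ k ∈ s, ‖x (k + n)‖ ^ 2 :=
            Finset.sum_mul_sq_le_sq_mul_sq _ _ _
        _ ≤ _ := by
            gcongr
            · exact ((summable_nat_add_iff n).2 h).sum_le_tsum _ fun _ _ => by positivity
            · rw [← (hasSum_norm_sq x).tsum_eq]
              have hs := (hasSum_norm_sq x).summable
              refine (((summable_nat_add_iff n).2 hs).sum_le_tsum s fun _ _ => by positivity).trans ?_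
              rw [← hs.sum_add_tsum_nat_add n]
              have : 0 ≤ ∑ i ∈ Finset.range n, ‖x i‖ ^ 2 := by positivity
              linarith
    rw [sub_apply, norm_sub_rev]
    exact h3
  refine squeeze_zero (fun _ => norm_nonneg _) hbound ?_
  have := (Real.continuous_sqrt.tendsto 0).comp hlim
  rwa [Real.sqrt_zero] at this

/-- With `S = √T` one has `‖T x‖ = ‖S (S x)‖ ≤ ‖S‖ * ‖S x‖` and `‖S x‖² = ⟪x, T x⟫`. Summed over the
Fock basis, finite trace gives the Hilbert–Schmidt property. -/
theorem exists_norm_sq_le {H : Type*} [NormedAddCommGroup H] [InnerProductSpace ℂ H]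
    [CompleteSpace H] {T : H →L[ℂ] H} (hT : T.IsPositive) :
    ∃ C, 0 ≤ C ∧ ∀ x, ‖T x‖ ^ 2 ≤ C * (⟪x, T x⟫_ℂ).re := by
  have h0 : 0 ≤ T := (ContinuousLinearMap.nonneg_iff_isPositive T).2 hT
  set S := CFC.sqrt T with hS
  have hSS : S * S = T := CFC.sqrt_mul_sqrt_self T
  have hSa : IsSelfAdjoint S := (CFC.sqrt_nonneg T).isSelfAdjoint
  have hsym : ∀ x y, ⟪S x, y⟫_ℂ = ⟪x, S y⟫_ℂ := fun x y => hSa.isSymmetric x y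
  refine ⟨‖S‖ ^ 2, by positivity, fun x => ?_⟩
  have h1 : T x = S (S x) := by rw [← hSS]; rfl
  have h2 : (⟪x, T x⟫_ℂ).re = ‖S x‖ ^ 2 := by
    rw [h1, ← hsym, ← inner_self_eq_norm_sq (𝕜 := ℂ)]
    rfl
  rw [h2, h1, ← mul_pow]
  gcongr
  exact S.le_opNorm _

theorem IsState.isCompactOperator {ρ : Fock →L[ℂ] Fock} (h : IsState ρ) : IsCompactOperator ρ := by
  obtain ⟨C, hC, hle⟩ := exists_norm_sq_le h.isPositive
  exact isCompactOperator_of_summable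
    ((h.trace_eq_one.summable.mul_left C).of_nonneg_of_le (fun _ => by positivity)
      fun n => hle (ket n))

theorem IsState.exists_isSpec {ρ : Fock →L[ℂ] Fock} (h : IsState ρ) : ∃ lam v, IsSpec ρ lam v :=
  IsSpec.exists_of_isCompact h.isPositive h.isCompactOperator

/-! ### Functions of an operator in its eigenbasis. -/

namespace IsSpec

section General

variable {H : Type*} [NormedAddCommGroup H] [InnerProductSpace ℂ H] [CompleteSpace H]
  {T : H →L[ℂ] H} {lam : ℕ → ℝ} {v : ℕ → H}

theorem norm_of_ne (h : IsSpec T lam v) (i : ℕ) (hi : v i ≠ 0) : ‖v i‖ = 1 :=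
  h.norm_one i fun h0 => hi (h.zero i h0)

theorem norm_le_one (h : IsSpec T lam v) (i : ℕ) : ‖v i‖ ≤ 1 := by
  by_cases hi : v i = 0
  · simp [hi]
  · exact (h.norm_of_ne i hi).le

/-- Matrix elements of `f(T)` for `f 0 = 0`. -/
theorem hasSum_cfc (h : IsSpec T lam v) (hT : IsSelfAdjoint T) {f : ℝ → ℝ} (hf : Continuous f)
    (h0 : f 0 = 0) (x y : H) :
    HasSum (fun j => (f (lam j) : ℂ) * (⟪x, v j⟫_ℂ * ⟪v j, y⟫_ℂ)) ⟪x, cfc f T y⟫_ℂ := by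
  refine hasSum_inner_apply h.orth h.norm_of_ne (cfc_predicate f T)
    (fun i => cfc_apply_eigenvector hT hf (h.eig i)) (fun w hw => ?_) x y
  have := cfc_apply_eigenvector hT hf (x := 0) (v := w) (by rw [h.ker w hw]; simp)
  rw [this, h0]
  simp

theorem hasSum_inner (h : IsSpec T lam v) (hT : IsSelfAdjoint T) (x y : H) :
    HasSum (fun j => (lam j : ℂ) * (⟪x, v j⟫_ℂ * ⟪v j, y⟫_ℂ)) ⟪x, T y⟫_ℂ :=
  hasSum_inner_apply h.orth h.norm_of_ne hT h.eig h.ker x y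

theorem hasSum_quad (h : IsSpec T lam v) (hT : IsSelfAdjoint T) {f : ℝ → ℝ} (hf : Continuous f)
    (h0 : f 0 = 0) (x : H) :
    HasSum (fun j => f (lam j) * ‖⟪v j, x⟫_ℂ‖ ^ 2) (⟪x, cfc f T x⟫_ℂ).re := by
  have := Complex.hasSum_re (h.hasSum_cfc hT hf h0 x x)
  refine this.congr_fun fun j => ?_
  rw [← inner_conj_symm x, Complex.conj_mul', ← Complex.ofReal_pow, ← Complex.ofReal_mul,
    Complex.ofReal_re]

theorem hasSum_norm_sq_cfc (h : IsSpec T lam v) (hT : IsSelfAdjoint T) {f : ℝ → ℝ}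
    (hf : Continuous f) (h0 : f 0 = 0) (x : H) :
    HasSum (fun j => f (lam j) ^ 2 * ‖⟪v j, x⟫_ℂ‖ ^ 2) (‖cfc f T x‖ ^ 2) := by
  have h1 := h.hasSum_quad hT (f := fun t => f t * f t) (hf.mul hf) (by simp [h0]) x
  have h2 : (⟪x, cfc (fun t => f t * f t) T x⟫_ℂ).re = ‖cfc f T x‖ ^ 2 := by
    rw [cfc_mul f f T hf.continuousOn hf.continuousOn, mul_apply_eq_comp]
    have : ⟪cfc f T x, cfc f T x⟫_ℂ = ⟪x, cfc f T (cfc f T x)⟫_ℂ :=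
      (cfc_predicate f T : IsSelfAdjoint (cfc f T)).isSymmetric x _
    rw [← this, ← inner_self_eq_norm_sq (𝕜 := ℂ)]
    rfl
  rw [h2] at h1
  simpa only [sq] using h1

/-- Bessel's inequality. -/
theorem bessel (h : IsSpec T lam v) (x : H) :
    Summable (fun j => ‖⟪v j, x⟫_ℂ‖ ^ 2) ∧ ∑' j, ‖⟪v j, x⟫_ℂ‖ ^ 2 ≤ ‖x‖ ^ 2 := by
  have key : ∀ s : Finset ℕ, ∑ j ∈ s, ‖⟪v j, x⟫_ℂ‖ ^ 2 ≤ ‖x‖ ^ 2 := by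
    classical
    intro s
    let u : {j : ℕ // v j ≠ 0} → H := fun j => v j
    have hu : Orthonormal ℂ u :=
      ⟨fun i => h.norm_of_ne i i.2, fun i j hij => h.orth i j fun h' => hij (Subtype.ext h')⟩
    have h1 := hu.sum_inner_products_le (x := x) (s := s.subtype (fun j => v j ≠ 0))
    have h2 : ∑ j ∈ s.subtype (fun j => v j ≠ 0), ‖⟪u j, x⟫_ℂ‖ ^ 2 =
        ∑ j ∈ s, ‖⟪v j, x⟫_ℂ‖ ^ 2 := by
      rw [Finset.sum_subtype_eq_sum_filter (f := fun j => ‖⟪v j, x⟫_ℂ‖ ^ 2), Finset.sum_filter]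
      refine Finset.sum_congr rfl fun j _ => ?_
      split_ifs with hj
      · rfl
      · simp only [ne_eq, not_not] at hj
        simp [hj]
    rwa [h2] at h1
  have hs := summable_of_sum_le (fun _ => by positivity) key
  exact ⟨hs, hs.tsum_le_of_sum_le key⟩

/-- Parseval's identity for an injective operator. -/
theorem parseval (h : IsSpec T lam v) (hinj : Function.Injective T) (x : H) :
    HasSum (fun j => ‖⟪v j, x⟫_ℂ‖ ^ 2) (‖x‖ ^ 2) := by
  -- The identity operator satisfies the kernel condition: a vector orthogonal to all `v j` is
  -- annihilated by `T`, hence zero by injectivity.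
  have := hasSum_inner_apply h.orth h.norm_of_ne (T := (1 : H →L[ℂ] H)) (IsSelfAdjoint.one _)
    (g := fun _ => 1) (fun i => by simp)
    (fun w hw => hinj (by simpa using h.ker w hw)) x x
  have := Complex.hasSum_re this
  rw [one_apply_eq_self, ← RCLike.re_eq_complex_re, inner_self_eq_norm_sq] at this
  refine this.congr_fun fun j => ?_
  rw [← inner_conj_symm x, Complex.conj_mul', Complex.ofReal_one, one_mul, ← Complex.ofReal_pow,
    RCLike.re_eq_complex_re, Complex.ofReal_re]

end General

variable {ρ : Fock →L[ℂ] Fock} {lam : ℕ → ℝ} {v : ℕ → Fock}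

theorem hasSum_diag (h : IsSpec ρ lam v) (hT : IsSelfAdjoint ρ) {f : ℝ → ℝ} (hf : Continuous f)
    (h0 : f 0 = 0) (n : ℕ) :
    HasSum (fun j => f (lam j) * ‖v j n‖ ^ 2) (toMatrix (opFun f ρ) n n).re := by
  have := h.hasSum_quad hT hf h0 (ket n)
  refine this.congr_fun fun j => ?_
  rw [inner_ket_right, norm_star]

end IsSpec

/-! ### Ladder operators on vectors of finite energy, and the classical data of a state. -/

/-- Vectors of finite mean photon number. -/
def HasEnergy (x : Fock) : Prop := Summable fun n : ℕ => (n : ℝ) * ‖x n‖ ^ 2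

/-- The mean photon number `∑ n, n |x n|²`. -/
def energy (x : Fock) : ℝ := ∑' n : ℕ, (n : ℝ) * ‖x n‖ ^ 2

open Classical in
/-- `a x`, for `x` of finite mean photon number. -/
def lower (x : Fock) : Fock :=
  if h : Memℓp (E := fun _ : ℕ => ℂ) (fun n : ℕ => (Real.sqrt (n + 1) : ℂ) * x (n + 1)) 2
  then ⟨_, h⟩ else 0

open Classical in
/-- `a† x`, for `x` of finite mean photon number. -/
def raise (x : Fock) : Fock :=
  if h : Memℓp (E := fun _ : ℕ => ℂ) (fun n : ℕ => (Real.sqrt n : ℂ) * x (n - 1)) 2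
  then ⟨_, h⟩ else 0

theorem norm_sq_sqrt_mul {t : ℝ} (ht : 0 ≤ t) (z : ℂ) :
    ‖(Real.sqrt t : ℂ) * z‖ ^ 2 = t * ‖z‖ ^ 2 := by
  rw [norm_mul, mul_pow, Complex.norm_real, Real.norm_eq_abs, sq_abs, Real.sq_sqrt ht]

namespace HasEnergy

variable {x y : Fock}

theorem hasSum_lower (hx : HasEnergy x) :
    HasSum (fun n : ℕ => ‖(Real.sqrt (n + 1) : ℂ) * x (n + 1)‖ ^ 2) (energy x) := by
  have h1 : HasSum (fun n : ℕ => (n : ℝ) * ‖x n‖ ^ 2) (energy x) := hx.hasSum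
  rw [← hasSum_nat_add_iff' 1] at h1
  simp only [Finset.range_one, Finset.sum_singleton, Nat.cast_zero, zero_mul, sub_zero] at h1
  refine h1.congr_fun fun n => ?_
  rw [norm_sq_sqrt_mul (by positivity)]
  push_cast
  rfl

theorem hasSum_raise (hx : HasEnergy x) :
    HasSum (fun n : ℕ => ‖(Real.sqrt n : ℂ) * x (n - 1)‖ ^ 2) (energy x + ‖x‖ ^ 2) := by
  rw [← hasSum_nat_add_iff' 1]
  have h1 : HasSum (fun n : ℕ => (n : ℝ) * ‖x n‖ ^ 2) (energy x) := hx.hasSum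
  simp only [Finset.range_one, Finset.sum_singleton, Nat.cast_zero, Real.sqrt_zero,
    Complex.ofReal_zero, zero_mul, norm_zero, add_tsub_cancel_right]
  have := h1.add (hasSum_norm_sq x)
  simp only [ne_eq, OfNat.ofNat_ne_zero, not_false_eq_true, zero_pow, sub_zero]
  refine this.congr_fun fun n => ?_
  rw [norm_sq_sqrt_mul (by positivity)]
  push_cast
  ring

theorem lower_apply (hx : HasEnergy x) (n : ℕ) :
    lower x n = (Real.sqrt (n + 1) : ℂ) * x (n + 1) := by
  unfold lower
  rw [dif_pos (memlp_two_iff.2 hx.hasSum_lower.summable)]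

theorem raise_apply (hx : HasEnergy x) (n : ℕ) :
    raise x n = (Real.sqrt n : ℂ) * x (n - 1) := by
  unfold raise
  rw [dif_pos (memlp_two_iff.2 hx.hasSum_raise.summable)]

theorem norm_lower (hx : HasEnergy x) : ‖lower x‖ ^ 2 = energy x := by
  refine (hasSum_norm_sq _).unique ?_
  simp only [hx.lower_apply]
  exact hx.hasSum_lower

theorem norm_raise (hx : HasEnergy x) : ‖raise x‖ ^ 2 = energy x + ‖x‖ ^ 2 := by
  refine (hasSum_norm_sq _).unique ?_
  simp only [hx.raise_apply]
  exact hx.hasSum_raise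

theorem inner_lower (hx : HasEnergy x) (hy : HasEnergy y) :
    ⟪y, lower x⟫_ℂ = ⟪raise y, x⟫_ℂ := by
  have h1 := lp.hasSum_inner (𝕜 := ℂ) y (lower x)
  have h2 := lp.hasSum_inner (𝕜 := ℂ) (raise y) x
  rw [← hasSum_nat_add_iff' 1] at h2
  simp only [hy.raise_apply, hx.lower_apply] at h1 h2
  simp only [Finset.range_one, Finset.sum_singleton, Nat.cast_zero, Real.sqrt_zero,
    Complex.ofReal_zero, zero_mul, inner_zero_left, sub_zero, add_tsub_cancel_right] at h2
  refine h1.unique (h2.congr_fun fun n => ?_)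
  simp only [RCLike.inner_apply, map_mul, Complex.conj_ofReal]
  push_cast
  ring

end HasEnergy

theorem hasEnergy_zero : HasEnergy 0 := by
  simp [HasEnergy, summable_zero]

theorem opFun_id {H : Type*} [NormedAddCommGroup H] [InnerProductSpace ℂ H] [CompleteSpace H]
    {T : H →L[ℂ] H} (hT : IsSelfAdjoint T) : opFun id T = T := cfc_id ℝ T hT

/-- The classical data of a state: eigenvalues `lam i`, mean photon numbers `E i` and transition
weights `M i j = |⟨v i|a|v j⟩|²` of its eigenvectors. -/
structure RateData (lam E : ℕ → ℝ) (M : ℕ → ℕ → ℝ) : Prop where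
  lam_nonneg : ∀ i, 0 ≤ lam i
  antitone : Antitone lam
  M_nonneg : ∀ i j, 0 ≤ M i j
  hasSum_lam : HasSum lam 1
  summable_energy : Summable fun i => lam i * E i
  summable_col : ∀ j, Summable fun i => M i j
  col_le : ∀ j, ∑' i, M i j ≤ E j
  summable_row : ∀ i, Summable fun j => M i j
  row_le : ∀ i, ∑' j, M i j ≤ E i + 1

/-- The transition weights of the family `v`. -/
def weight (v : ℕ → Fock) (i j : ℕ) : ℝ := ‖⟪v i, lower (v j)⟫_ℂ‖ ^ 2

namespace IsSpec

variable {ρ : Fock →L[ℂ] Fock} {lam : ℕ → ℝ} {v : ℕ → Fock}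

theorem hasSum_toMatrix_diag (h : IsSpec ρ lam v) (hρ : IsState ρ) (n : ℕ) :
    HasSum (fun j => lam j * ‖v j n‖ ^ 2) (toMatrix ρ n n).re := by
  have := h.hasSum_diag hρ.isPositive.isSelfAdjoint continuous_id rfl n
  rwa [opFun_id hρ.isPositive.isSelfAdjoint] at this

/-- A single term of the spectral sum gives `lam i * ‖v i n‖ ^ 2 ≤ ⟨n|ρ|n⟩`, so an eigenvector with
nonzero eigenvalue inherits the finite energy of `ρ`. -/
theorem hasEnergy (h : IsSpec ρ lam v) (hρ : IsState ρ) (i : ℕ) : HasEnergy (v i) := by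
  by_cases h0 : lam i = 0
  · rw [h.zero i h0]
    exact hasEnergy_zero
  have hpos : 0 < lam i := lt_of_le_of_ne (h.nonneg i) (Ne.symm h0)
  refine (hρ.finite_energy.mul_left (lam i)⁻¹).of_nonneg_of_le (fun n => by positivity) fun n => ?_
  have h1 : lam i * ‖v i n‖ ^ 2 ≤ (toMatrix ρ n n).re :=
    (h.hasSum_toMatrix_diag hρ n).summable.le_tsum i (fun j _ => mul_nonneg (h.nonneg j)
      (by positivity)) |>.trans_eq (h.hasSum_toMatrix_diag hρ n).tsum_eq
  rw [inv_mul_eq_div, le_div_iff₀ hpos]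
  calc (n : ℝ) * ‖v i n‖ ^ 2 * lam i = n * (lam i * ‖v i n‖ ^ 2) := by ring
    _ ≤ _ := by gcongr

/-- Weighted traces, computed in the eigenbasis. -/
theorem hasSum_weighted_trace (h : IsSpec ρ lam v) (hρ : IsState ρ) {g : ℕ → ℝ} (hg : ∀ n, 0 ≤ g n)
    (hs : Summable fun n => g n * (toMatrix ρ n n).re) :
    HasSum (fun j => lam j * ∑' n, g n * ‖v j n‖ ^ 2) (∑' n, g n * (toMatrix ρ n n).re) := by
  have hn : ∀ n, HasSum (fun j => g n * (lam j * ‖v j n‖ ^ 2)) (g n * (toMatrix ρ n n).re) :=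
    fun n => (h.hasSum_toMatrix_diag hρ n).mul_left _
  have h1 : Summable fun k : ℕ × ℕ => g k.1 * (lam k.2 * ‖v k.2 k.1‖ ^ 2) := by
    rw [summable_prod_of_nonneg (fun k => mul_nonneg (hg _) (mul_nonneg (h.nonneg _)
      (by positivity)))]
    exact ⟨fun n => (hn n).summable, hs.congr fun n => (hn n).tsum_eq.symm⟩
  have h2 : HasSum (fun k : ℕ × ℕ => g k.1 * (lam k.2 * ‖v k.2 k.1‖ ^ 2))
      (∑' n, g n * (toMatrix ρ n n).re) := by
    rw [h1.hasSum_iff, h1.tsum_prod' fun n => (hn n).summable]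
    exact tsum_congr fun n => (hn n).tsum_eq
  have h3 : HasSum (fun k : ℕ × ℕ => g k.2 * (lam k.1 * ‖v k.1 k.2‖ ^ 2))
      (∑' n, g n * (toMatrix ρ n n).re) := (Equiv.prodComm ℕ ℕ).hasSum_iff.2 h2
  refine (h3.prod_fiberwise fun j => (h3.summable.prod_factor j).hasSum).congr_fun fun j => ?_
  rw [← tsum_mul_left]
  exact tsum_congr fun n => by ring

theorem hasSum_lam (h : IsSpec ρ lam v) (hρ : IsState ρ) : HasSum lam 1 := by
  have := h.hasSum_weighted_trace hρ (g := fun _ => 1) (fun _ => zero_le_one)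
    (by simpa using hρ.trace_eq_one.summable)
  simp only [one_mul, hρ.trace_eq_one.tsum_eq] at this
  refine this.congr_fun fun j => ?_
  rw [(hasSum_norm_sq _).tsum_eq]
  by_cases h0 : lam j = 0
  · simp [h0]
  · simp [h.norm_one j h0]

theorem hasSum_energy (h : IsSpec ρ lam v) (hρ : IsState ρ) :
    HasSum (fun j => lam j * energy (v j)) (∑' n : ℕ, (n : ℝ) * (toMatrix ρ n n).re) :=
  h.hasSum_weighted_trace hρ (fun _ => by positivity) hρ.finite_energy

theorem weight_eq (h : IsSpec ρ lam v) (hρ : IsState ρ) (i j : ℕ) :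
    weight v i j = ‖⟪v j, raise (v i)⟫_ℂ‖ ^ 2 := by
  rw [weight, (h.hasEnergy hρ j).inner_lower (h.hasEnergy hρ i), ← inner_conj_symm, RCLike.norm_conj]

/-- Columns are Bessel's inequality for `a v j`, rows for `a† v i`; the extra `1` is `‖a† v‖² - ‖a
v‖² = ‖v‖²`. These are inequalities because the `v i` need not span the kernel of `ρ`. -/
theorem rateData (h : IsSpec ρ lam v) (hρ : IsState ρ) :
    RateData lam (fun i => energy (v i)) (weight v) where
  lam_nonneg := h.nonneg
  antitone := h.antitone
  M_nonneg i j := by unfold weight; positivity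
  hasSum_lam := h.hasSum_lam hρ
  summable_energy := (h.hasSum_energy hρ).summable
  summable_col j := (h.bessel (lower (v j))).1
  col_le j := by
    rw [← (h.hasEnergy hρ j).norm_lower]
    exact (h.bessel (lower (v j))).2
  summable_row i := by
    simp only [h.weight_eq hρ]
    exact (h.bessel (raise (v i))).1
  row_le i := by
    simp only [h.weight_eq hρ]
    refine (h.bessel (raise (v i))).2.trans ?_
    rw [(h.hasEnergy hρ i).norm_raise]
    gcongr
    have := h.norm_le_one i
    nlinarith [norm_nonneg (v i)]

end IsSpec

/-! ### The generator conjugated by powers of the fixed point. -/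

/-- `σ^{s/2} ℒ*(σ^{-s/2} X σ^{-s/2}) σ^{s/2}`. -/
def conjGen (β s : ℝ) (X : FockMatrix) : FockMatrix := fun m n =>
  (Real.exp (-β / 2) : ℂ) * (((m : ℂ) + 1 + (n + 1)) / 2 * X m n -
      Real.exp (β * s) * ((Real.sqrt (m + 1) : ℂ) * X (m + 1) (n + 1) * Real.sqrt (n + 1))) +
    (Real.exp (β / 2) : ℂ) * (((m : ℂ) + n) / 2 * X m n -
      Real.exp (-(β * s)) * ((Real.sqrt m : ℂ) * X (m - 1) (n - 1) * Real.sqrt n))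

theorem thermal_pos {β : ℝ} (hβ : 0 < β) (n : ℕ) : 0 < thermal β n := by
  have : Real.exp (-β) < 1 := by simpa using hβ
  exact mul_pos (by linarith) (Real.exp_pos _)

theorem thermal_succ_rpow {β : ℝ} (hβ : 0 < β) (r : ℝ) (n : ℕ) :
    thermal β (n + 1) ^ r = Real.exp (-(β * r)) * thermal β n ^ r := by
  have h1 : thermal β (n + 1) = Real.exp (-β) * thermal β n := by
    unfold thermal
    rw [mul_left_comm, ← Real.exp_add]
    congr 2
    push_cast
    ring
  rw [h1, Real.mul_rpow (Real.exp_pos _).le (thermal_pos hβ n).le, ← Real.exp_mul]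
  congr 2
  ring

theorem ofReal_sqrt_mul_self {t : ℝ} (ht : 0 ≤ t) :
    (Real.sqrt t : ℂ) * (Real.sqrt t : ℂ) = (t : ℂ) := by
  rw [← Complex.ofReal_mul, Real.mul_self_sqrt ht]

/-- At `m = 0` or `n = 0` the truncated subtractions are harmless, since they come with the factor
`√0`. -/
theorem Lstar_apply (β : ℝ) (X : FockMatrix) (m n : ℕ) :
    Lstar β X m n = (Real.exp (-β / 2) : ℂ) * (((m : ℂ) + 1 + (n + 1)) / 2 * X m n -
        ((Real.sqrt (m + 1) : ℂ) * X (m + 1) (n + 1) * Real.sqrt (n + 1))) +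
      (Real.exp (β / 2) : ℂ) * (((m : ℂ) + n) / 2 * X m n -
        ((Real.sqrt m : ℂ) * X (m - 1) (n - 1) * Real.sqrt n)) := by
  have h1 : aL (adL X) m n = ((m : ℂ) + 1) * X m n := by
    simp only [aL, adL, add_tsub_cancel_right]
    push_cast
    rw [← mul_assoc, ofReal_sqrt_mul_self (by positivity)]
    push_cast
    ring
  have h2 : adR (aR X) m n = ((n : ℂ) + 1) * X m n := by
    simp only [adR, aR, add_tsub_cancel_right]
    push_cast
    rw [mul_assoc, ofReal_sqrt_mul_self (by positivity)]
    push_cast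
    ring
  have h3 : adL (aL X) m n = (m : ℂ) * X m n := by
    rcases m with _ | m
    · simp [adL]
    · simp only [aL, adL, add_tsub_cancel_right]
      push_cast
      rw [← mul_assoc, ofReal_sqrt_mul_self (by positivity)]
      push_cast
      ring
  have h4 : aR (adR X) m n = (n : ℂ) * X m n := by
    rcases n with _ | n
    · simp [aR]
    · simp only [aR, adR, add_tsub_cancel_right]
      push_cast
      rw [mul_assoc, ofReal_sqrt_mul_self (by positivity)]
      push_cast
      ring
  simp only [Lstar, Pi.add_apply, Pi.smul_apply, Pi.sub_apply, h1, h2, h3, h4, smul_eq_mul]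
  simp only [aL, adL, aR, adR]
  ring

/-- The number terms are diagonal, so the weights cancel. The jump terms shift both indices by one,
and the geometric weights then leave only the constants `e^{±βs}`. -/
theorem conj_Lstar_Gam {β : ℝ} (hβ : 0 < β) (s : ℝ) (X : FockMatrix) (m n : ℕ) :
    ((thermal β m ^ (s / 2) : ℝ) : ℂ) * ((thermal β n ^ (s / 2) : ℝ) : ℂ) *
      Lstar β (Gam β (-s) X) m n = conjGen β s X m n := by
  obtain ⟨w, hw⟩ : ∃ w : ℕ → ℝ, ∀ n, thermal β n ^ (s / 2) = w n := ⟨_, fun n => rfl⟩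
  have hw0 : ∀ n, w n ≠ 0 := fun n => by
    rw [← hw]
    exact (Real.rpow_pos_of_pos (thermal_pos hβ n) _).ne'
  have hwinv : ∀ n, thermal β n ^ (-s / 2) = (w n)⁻¹ := fun n => by
    rw [neg_div, Real.rpow_neg (thermal_pos hβ n).le, hw]
  have hws : ∀ n, w (n + 1) = Real.exp (-(β * (s / 2))) * w n := fun n => by
    rw [← hw, ← hw]
    exact thermal_succ_rpow hβ _ n
  have hwc : ∀ n, (w n : ℂ) ≠ 0 := fun n => Complex.ofReal_ne_zero.2 (hw0 n)
  have e1 : Real.exp (β * s) = (Real.exp (-(β * (s / 2))))⁻¹ * (Real.exp (-(β * (s / 2))))⁻¹ := by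
    rw [← Real.exp_neg, ← Real.exp_add]
    congr 1
    ring
  have e2 : Real.exp (-(β * s)) = Real.exp (-(β * (s / 2))) * Real.exp (-(β * (s / 2))) := by
    rw [← Real.exp_add]
    congr 1
    ring
  have he : (Real.exp (-(β * (s / 2))) : ℂ) ≠ 0 := Complex.ofReal_ne_zero.2 (Real.exp_ne_zero _)
  -- For `n = 0` the weight at `n - 1` does not shift, but both sides vanish with `√0`.
  have hdown : ∀ n : ℕ, (w n : ℂ) * (Real.sqrt n : ℂ) * ((w (n - 1) : ℝ) : ℂ)⁻¹ =
      Real.exp (-(β * (s / 2))) * (Real.sqrt n : ℂ) := by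
    intro n
    rcases n with _ | n
    · simp
    · rw [hws, add_tsub_cancel_right]
      push_cast
      have := hwc n
      field_simp
  rw [Lstar_apply]
  simp only [Gam, conjGen, hwinv, hw, e1, e2]
  have h1 : ∀ X : ℂ, (w m : ℂ) * (w n : ℂ) * (((w m)⁻¹ : ℝ) * X * ((w n)⁻¹ : ℝ)) = X := by
    intro X
    push_cast
    have := hwc m
    have := hwc n
    field_simp
  have h2 : ∀ X : ℂ, (w m : ℂ) * (w n : ℂ) *
      ((Real.sqrt (m + 1) : ℂ) * (((w (m + 1))⁻¹ : ℝ) * X * ((w (n + 1))⁻¹ : ℝ)) *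
        Real.sqrt (n + 1)) = (Real.exp (-(β * (s / 2))) : ℂ)⁻¹ * (Real.exp (-(β * (s / 2))) : ℂ)⁻¹ *
        ((Real.sqrt (m + 1) : ℂ) * X * Real.sqrt (n + 1)) := by
    intro X
    rw [hws, hws]
    push_cast [-Complex.ofReal_exp]
    have := hwc m
    have := hwc n
    field_simp
  have h3 : ∀ X : ℂ, (w m : ℂ) * (w n : ℂ) *
      ((Real.sqrt m : ℂ) * (((w (m - 1))⁻¹ : ℝ) * X * ((w (n - 1))⁻¹ : ℝ)) *
        Real.sqrt n) = (Real.exp (-(β * (s / 2))) : ℂ) * (Real.exp (-(β * (s / 2))) : ℂ) *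
        ((Real.sqrt m : ℂ) * X * Real.sqrt n) := by
    intro X
    calc _ = ((w m : ℂ) * (Real.sqrt m : ℂ) * ((w (m - 1) : ℝ) : ℂ)⁻¹) *
          ((w n : ℂ) * (Real.sqrt n : ℂ) * ((w (n - 1) : ℝ) : ℂ)⁻¹) * X := by
            push_cast
            ring
      _ = _ := by
        rw [hdown, hdown]
        ring
  simp only [Complex.ofReal_mul (Real.exp _), Complex.ofReal_mul (Real.exp _)⁻¹,
    Complex.ofReal_inv (Real.exp _)]
  linear_combination ((Real.exp (-β / 2) : ℂ) * (((m : ℂ) + 1 + (n + 1)) / 2) +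
    (Real.exp (β / 2) : ℂ) * (((m : ℂ) + n) / 2)) * h1 (X m n) -
    (Real.exp (-β / 2) : ℂ) * h2 (X (m + 1) (n + 1)) - (Real.exp (β / 2) : ℂ) * h3 (X (m - 1) (n - 1))

/-- The weights combine as `σ^{1/2} σ^{-(1-s)/2} = σ^{s/2}`, which is what `conjGen` absorbs. Thus
no growing power of `σ⁻¹` is left in the double series. -/
theorem wTerm_Gam {β : ℝ} (hβ : 0 < β) (s c : ℝ) (P X : FockMatrix) (k : ℕ × ℕ) :
    wTerm β (Gam β (-(1 - s)) ((c : ℂ) • P)) (Lstar β (Gam β (-s) X)) k =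
      c * (star (P k.1 k.2) * conjGen β s X k.1 k.2) := by
  rw [← conj_Lstar_Gam hβ]
  have h : ∀ n, thermal β n ^ (s / 2) = thermal β n ^ (1 / 2 : ℝ) * thermal β n ^ (-(1 - s) / 2) :=
    fun n => by
      rw [← Real.rpow_add (thermal_pos hβ n)]
      congr 1
      ring
  simp only [wTerm, Gam, h, Pi.smul_apply, smul_eq_mul, star_mul', Complex.star_def,
    Complex.conj_ofReal, Complex.ofReal_mul]
  ring

/-! ### Spectral projections -/

namespace IsSpec

variable {ρ : Fock →L[ℂ] Fock} {lam : ℕ → ℝ} {v : ℕ → Fock}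

theorem finite_fiber (h : IsSpec ρ lam v) (hρ : IsState ρ) {x : ℝ} (hx : x ≠ 0) :
    (lam ⁻¹' {x}).Finite := by
  have h1 := (h.hasSum_lam hρ).summable.tendsto_cofinite_zero
  have h2 := h1.eventually_ne hx.symm
  rw [eventually_cofinite] at h2
  exact h2.subset fun i hi => by simpa using hi

theorem specProj_eq (h : IsSpec ρ lam v) (hρ : IsState ρ) {x : ℝ} (hx : x ≠ 0) (m n : ℕ) :
    specProj ρ x m n = ∑ i ∈ (h.finite_fiber hρ hx).toFinset, v i m * star (v i n) := by
  set G := (h.finite_fiber hρ hx).toFinset with hG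
  have hmem : ∀ i, i ∈ G ↔ lam i = x := fun i => by simp [hG]
  have hsym : ∀ x y, ⟪ρ x, y⟫_ℂ = ⟪x, ρ y⟫_ℂ := fun x y => hρ.isPositive.isSymmetric x y
  have key : (eigSpace ρ x).starProjection (ket n) = ∑ i ∈ G, ⟪v i, ket n⟫_ℂ • v i := by
    refine Submodule.eq_starProjection_of_mem_of_inner_eq_zero ?_ ?_
    · refine Submodule.sum_mem _ fun i hi => Submodule.smul_mem _ _ ?_
      rw [eigSpace, Module.End.mem_eigenspace_iff]
      have := h.eig i
      rw [(hmem i).1 hi] at this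
      exact this
    · intro w hw
      rw [eigSpace, Module.End.mem_eigenspace_iff] at hw
      have hw' : ρ w = (x : ℂ) • w := hw
      have h1 := h.hasSum_inner hρ.isPositive.isSelfAdjoint (ket n) w
      have h2 : ∀ i ∉ G, (lam i : ℂ) * (⟪ket n, v i⟫_ℂ * ⟪v i, w⟫_ℂ) = 0 := by
        intro i hi
        have h3 := hsym (v i) w
        rw [h.eig, hw', inner_smul_left, inner_smul_right, Complex.conj_ofReal, ← sub_eq_zero,
          ← sub_mul, mul_eq_zero, sub_eq_zero, Complex.ofReal_inj, ← hmem] at h3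
        rw [h3.resolve_left hi]
        simp
      have h4 := h1.unique (hasSum_sum_of_ne_finset_zero h2)
      rw [hw', inner_smul_right] at h4
      -- For an eigenvector `w` both expressions for `⟪ket n, ρ w⟫` carry the factor `x`, which is
      -- nonzero and can be cancelled.
      have h5 : (x : ℂ) * (⟪ket n, w⟫_ℂ - ∑ i ∈ G, ⟪ket n, v i⟫_ℂ * ⟪v i, w⟫_ℂ) = 0 := by
        rw [mul_sub, h4, Finset.mul_sum, sub_eq_zero]
        exact Finset.sum_congr rfl fun i hi => by rw [(hmem i).1 hi]
      have h6 := (mul_eq_zero.1 h5).resolve_left (Complex.ofReal_ne_zero.2 hx)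
      rw [inner_sub_left, sum_inner, ← h6]
      congr 1
      refine Finset.sum_congr rfl fun i _ => ?_
      rw [inner_smul_left, inner_conj_symm]
  rw [specProj, toMatrix, key, inner_sum]
  refine Finset.sum_congr rfl fun i _ => ?_
  rw [inner_smul_right, inner_ket, inner_ket_right, mul_comm]

end IsSpec

/-! ### Powers of a state and absolutely convergent double series. -/

section Opfun

variable {H : Type*} [NormedAddCommGroup H] [InnerProductSpace ℂ H] [CompleteSpace H]

theorem opFun_isSelfAdjoint (f : ℝ → ℝ) (T : H →L[ℂ] H) : IsSelfAdjoint (opFun f T) :=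
  cfc_predicate f T

theorem opFun_apply_eigenvector {T : H →L[ℂ] H} (hT : IsSelfAdjoint T) {f : ℝ → ℝ}
    (hf : Continuous f) {x : ℝ} {v : H} (hv : T v = (x : ℂ) • v) :
    opFun f T v = (f x : ℂ) • v := cfc_apply_eigenvector hT hf hv

theorem IsSpec.hasSum_quad_opFun {T : H →L[ℂ] H} {lam : ℕ → ℝ} {v : ℕ → H} (h : IsSpec T lam v)
    (hT : IsSelfAdjoint T) {f : ℝ → ℝ} (hf : Continuous f) (h0 : f 0 = 0) (x : H) :
    HasSum (fun j => f (lam j) * ‖⟪v j, x⟫_ℂ‖ ^ 2) (⟪x, opFun f T x⟫_ℂ).re :=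
  h.hasSum_quad hT hf h0 x

theorem IsSpec.hasSum_norm_sq_opFun {T : H →L[ℂ] H} {lam : ℕ → ℝ} {v : ℕ → H} (h : IsSpec T lam v)
    (hT : IsSelfAdjoint T) {f : ℝ → ℝ} (hf : Continuous f) (h0 : f 0 = 0) (x : H) :
    HasSum (fun j => f (lam j) ^ 2 * ‖⟪v j, x⟫_ℂ‖ ^ 2) (‖opFun f T x‖ ^ 2) :=
  h.hasSum_norm_sq_cfc hT hf h0 x

end Opfun

theorem power_one {ρ : Fock →L[ℂ] Fock} (hρ : IsSelfAdjoint ρ) : power ρ 1 = ρ := by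
  have : (fun x : ℝ => x ^ (1 : ℝ)) = id := by
    funext x
    simp
  rw [power, this, opFun_id hρ]

theorem power_isSelfAdjoint (ρ : Fock →L[ℂ] Fock) (s : ℝ) : IsSelfAdjoint (power ρ s) :=
  opFun_isSelfAdjoint _ _

theorem continuous_rpow {s : ℝ} (hs : 0 < s) : Continuous fun x : ℝ => x ^ s :=
  Real.continuous_rpow_const hs.le

/-- Absolute convergence of the double series of a sesquilinear form of Hilbert–Schmidt type. -/
theorem summable_sesq {C : ℕ × ℕ → ℂ} (hC : Summable fun k => ‖C k‖ ^ 2) {f g : ℕ → ℂ}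
    (hf : Summable fun n => ‖f n‖ ^ 2) (hg : Summable fun n => ‖g n‖ ^ 2) :
    Summable fun k : ℕ × ℕ => star (f k.1) * C k * g k.2 := by
  have h1 : Summable fun k : ℕ × ℕ => ‖f k.1‖ ^ 2 * ‖g k.2‖ ^ 2 :=
    hf.mul_of_nonneg hg (fun _ => by positivity) fun _ => by positivity
  refine Summable.of_norm_bounded (hC.add h1) fun k => ?_
  rw [norm_mul, norm_mul, norm_star]
  nlinarith [sq_nonneg (‖C k‖ - ‖f k.1‖ * ‖g k.2‖), sq_nonneg (‖C k‖ + ‖f k.1‖ * ‖g k.2‖),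
    norm_nonneg (C k), norm_nonneg (f k.1), norm_nonneg (g k.2)]

theorem toMatrix_conj {T : Fock →L[ℂ] Fock} (hT : IsSelfAdjoint T) (m n : ℕ) :
    toMatrix T m n = star (T (ket m) n) := by
  have : ⟪T (ket m), ket n⟫_ℂ = ⟪ket m, T (ket n)⟫_ℂ := hT.isSymmetric _ _
  rw [toMatrix, ← this, inner_ket_right]

theorem hasSum_row_norm_sq {T : Fock →L[ℂ] Fock} (hT : IsSelfAdjoint T) (m : ℕ) :
    HasSum (fun n => ‖toMatrix T m n‖ ^ 2) (‖T (ket m)‖ ^ 2) := by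
  simp only [toMatrix_conj hT, norm_star]
  exact hasSum_norm_sq _

theorem hasSum_row_mul {T : Fock →L[ℂ] Fock} (hT : IsSelfAdjoint T) (m : ℕ) (y : Fock) :
    HasSum (fun n => toMatrix T m n * y n) (T y m) := by
  have h1 := lp.hasSum_inner (𝕜 := ℂ) (T (ket m)) y
  have h2 : ⟪T (ket m), y⟫_ℂ = T y m := by
    rw [← inner_ket]
    exact hT.isSymmetric _ _
  rw [h2] at h1
  refine h1.congr_fun fun n => ?_
  rw [toMatrix_conj hT, RCLike.inner_apply, mul_comm]
  rfl

theorem hasSum_sesq {T : Fock →L[ℂ] Fock} (hT : IsSelfAdjoint T)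
    (hC : Summable fun k : ℕ × ℕ => ‖toMatrix T k.1 k.2‖ ^ 2) (x y : Fock) :
    HasSum (fun k : ℕ × ℕ => star (x k.1) * toMatrix T k.1 k.2 * y k.2) ⟪x, T y⟫_ℂ := by
  have hs := summable_sesq hC (hasSum_norm_sq x).summable (hasSum_norm_sq y).summable
  have h1 : HasSum (fun m => star (x m) * (T y m)) ⟪x, T y⟫_ℂ := by
    refine (lp.hasSum_inner (𝕜 := ℂ) x (T y)).congr_fun fun n => ?_
    rw [RCLike.inner_apply, mul_comm]
    rfl
  have h2 := hs.hasSum.prod_fiberwise fun m => by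
    simpa only [mul_assoc] using (hasSum_row_mul hT m y).mul_left (star (x m))
  rw [h1.unique h2]
  exact hs.hasSum

namespace IsSpec

variable {ρ : Fock →L[ℂ] Fock} {lam : ℕ → ℝ} {v : ℕ → Fock}

theorem lam_le_one (h : IsSpec ρ lam v) (hρ : IsState ρ) (i : ℕ) : lam i ≤ 1 :=
  (h.hasSum_lam hρ).tsum_eq ▸ (h.hasSum_lam hρ).summable.le_tsum i fun j _ => h.nonneg j

/-- Since `0 ≤ lam j ≤ 1` and `2s ≥ 1`, one has `lam j ^ (2s) ≤ lam j`. This is where `p ≤ 2`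
secures convergence: the number operator times `|ρ^s|²` is controlled by the energy of `ρ`. -/
theorem norm_sq_power_ket_le (h : IsSpec ρ lam v) (hρ : IsState ρ) {s : ℝ} (hs : 1 / 2 ≤ s)
    (m : ℕ) : ‖power ρ s (ket m)‖ ^ 2 ≤ (toMatrix ρ m m).re := by
  have hsa := hρ.isPositive.isSelfAdjoint
  have h1 := h.hasSum_norm_sq_opFun hsa (continuous_rpow (s := s) (by linarith))
    (Real.zero_rpow (by linarith)) (ket m)
  refine hasSum_le (fun j => ?_) h1 (h.hasSum_toMatrix_diag hρ m)
  rw [inner_ket_right, norm_star]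
  gcongr
  rw [← Real.rpow_natCast, ← Real.rpow_mul (h.nonneg j)]
  push_cast
  exact Real.rpow_le_self_of_le_one (h.nonneg j) (h.lam_le_one hρ j) (by linarith)

theorem summable_weighted_norm_sq (h : IsSpec ρ lam v) (hρ : IsState ρ) {s : ℝ} (hs : 1 / 2 ≤ s)
    {g : ℕ → ℝ} (hg : ∀ n, 0 ≤ g n) (hgs : Summable fun n => g n * (toMatrix ρ n n).re) :
    Summable fun k : ℕ × ℕ => g k.1 * ‖toMatrix (power ρ s) k.1 k.2‖ ^ 2 := by
  rw [summable_prod_of_nonneg fun k => mul_nonneg (hg _) (by positivity)]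
  have h1 : ∀ m, HasSum (fun n => g m * ‖toMatrix (power ρ s) m n‖ ^ 2)
      (g m * ‖power ρ s (ket m)‖ ^ 2) := fun m =>
    (hasSum_row_norm_sq (power_isSelfAdjoint _ _) m).mul_left _
  refine ⟨fun m => (h1 m).summable, ?_⟩
  simp only [(h1 _).tsum_eq]
  exact hgs.of_nonneg_of_le (fun m => mul_nonneg (hg m) (by positivity))
    fun m => mul_le_mul_of_nonneg_left (h.norm_sq_power_ket_le hρ hs m) (hg m)

theorem power_apply (h : IsSpec ρ lam v) (hρ : IsState ρ) {s : ℝ} (hs : 0 < s) (i : ℕ) :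
    power ρ s (v i) = ((lam i ^ s : ℝ) : ℂ) • v i :=
  opFun_apply_eigenvector hρ.isPositive.isSelfAdjoint (continuous_rpow hs) (h.eig i)

/-- `tr (|v i⟩⟨v i| a†a ρ^s)` as an absolutely convergent double series. -/
theorem hasSum_number_left (h : IsSpec ρ lam v) (hρ : IsState ρ) {s : ℝ} (hs : 1 / 2 ≤ s)
    (i : ℕ) :
    HasSum (fun k : ℕ × ℕ => (k.1 : ℂ) *
      (star (v i k.1) * toMatrix (power ρ s) k.1 k.2 * v i k.2))
      ((lam i ^ s * energy (v i) : ℝ) : ℂ) := by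
  have hE : Summable fun n : ℕ => (n : ℝ) * ‖v i n‖ ^ 2 := h.hasEnergy hρ i
  -- Split `m = √m * √m`: one root makes the matrix Hilbert–Schmidt by the energy of `ρ`, the other
  -- is absorbed by the energy of `v i`.
  have h1 : Summable fun k : ℕ × ℕ => ‖(Real.sqrt k.1 : ℂ) * toMatrix (power ρ s) k.1 k.2‖ ^ 2 := by
    simp only [norm_sq_sqrt_mul (Nat.cast_nonneg _)]
    exact h.summable_weighted_norm_sq hρ hs (g := fun n => n) (fun _ => by positivity)
      hρ.finite_energy
  have h2 := summable_sesq h1 (f := fun n => (Real.sqrt n : ℂ) * v i n) (g := fun n => v i n)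
    (by simpa only [norm_sq_sqrt_mul (Nat.cast_nonneg _)] using hE) (hasSum_norm_sq _).summable
  have h3 : Summable (fun k : ℕ × ℕ => (k.1 : ℂ) *
      (star (v i k.1) * toMatrix (power ρ s) k.1 k.2 * v i k.2)) := by
    refine h2.congr fun k => ?_
    have : (Real.sqrt k.1 : ℂ) * (Real.sqrt k.1 : ℂ) = (k.1 : ℂ) := by
      rw [ofReal_sqrt_mul_self (by positivity)]
      simp
    rw [← this, star_mul', Complex.star_def, Complex.conj_ofReal]
    ring
  have h4 : HasSum (fun m : ℕ => (((lam i ^ s) * (m * ‖v i m‖ ^ 2) : ℝ) : ℂ))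
      ((lam i ^ s * energy (v i) : ℝ) : ℂ) :=
    Complex.hasSum_ofReal.2 (hE.hasSum.mul_left _)
  have h5 := h3.hasSum.prod_fiberwise fun m => by
    simpa only [mul_assoc] using (hasSum_row_mul (power_isSelfAdjoint _ _) m (v i)).mul_left
      ((m : ℂ) * star (v i m))
  -- Summing over `n` first applies `ρ^s` to its eigenvector and leaves the energy series of `v i`.
  have h6 := h4.unique (h5.congr_fun fun m => by
    rw [h.power_apply hρ (by linarith) i, lp.coeFn_smul, Pi.smul_apply, smul_eq_mul]
    have : star (v i m) * v i m = ((‖v i m‖ ^ 2 : ℝ) : ℂ) := by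
      rw [Complex.star_def, Complex.conj_mul']
      push_cast
      rfl
    push_cast at this ⊢
    linear_combination (-(m : ℂ) * ((lam i ^ s : ℝ) : ℂ)) * this)
  rw [h6]
  exact h3.hasSum

theorem hasSum_number_right (h : IsSpec ρ lam v) (hρ : IsState ρ) {s : ℝ} (hs : 1 / 2 ≤ s)
    (i : ℕ) :
    HasSum (fun k : ℕ × ℕ => (k.2 : ℂ) *
      (star (v i k.1) * toMatrix (power ρ s) k.1 k.2 * v i k.2))
      ((lam i ^ s * energy (v i) : ℝ) : ℂ) := by
  have h1 := (h.hasSum_number_left hρ hs i).star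
  rw [show star ((lam i ^ s * energy (v i) : ℝ) : ℂ) = ((lam i ^ s * energy (v i) : ℝ) : ℂ) from
    Complex.conj_ofReal _] at h1
  refine ((Equiv.prodComm ℕ ℕ).hasSum_iff.2 h1).congr_fun fun k => ?_
  have : star (toMatrix (power ρ s) k.2 k.1) = toMatrix (power ρ s) k.1 k.2 := by
    rw [toMatrix_conj (power_isSelfAdjoint _ _), star_star, toMatrix, inner_ket]
  simp only [Function.comp_apply, Equiv.prodComm_apply, Prod.fst_swap, Prod.snd_swap, star_mul',
    this, star_star, star_natCast]
  ring

end IsSpec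

/-! ### The Dirichlet form in terms of eigenvalues, energies and weights. -/

theorem hasSum_shift {α : Type*} [AddCommMonoid α] [TopologicalSpace α] {f g : ℕ × ℕ → α} {a : α}
    (hfg : ∀ m n, f (m + 1, n + 1) = g (m, n)) (hl : ∀ n, f (0, n) = 0) (hr : ∀ m, f (m, 0) = 0) :
    HasSum f a ↔ HasSum g a := by
  let e : ℕ × ℕ → ℕ × ℕ := fun k => (k.1 + 1, k.2 + 1)
  have he : Function.Injective e := fun k l hkl => by
    simp only [e, Prod.mk.injEq, add_left_inj] at hkl
    exact Prod.ext hkl.1 hkl.2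
  have hz : ∀ k ∉ Set.range e, f k = 0 := by
    rintro ⟨m, n⟩ hk
    rcases m with _ | m
    · exact hl n
    · rcases n with _ | n
      · exact hr _
      · exact absurd ⟨(m, n), rfl⟩ hk
  rw [← he.hasSum_iff hz]
  have : f ∘ e = g := funext fun k => hfg k.1 k.2
  rw [this]

/-- The summand of eigenvector `i` in the expansion of the Dirichlet form of order `s`. -/
def rateTerm (β s : ℝ) (lam E : ℕ → ℝ) (M : ℕ → ℕ → ℝ) (i : ℕ) : ℝ :=
  Real.exp (-β / 2) * (lam i ^ s * (E i + 1) - Real.exp (β * s) * ∑' j, lam j ^ s * M i j) +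
    Real.exp (β / 2) * (lam i ^ s * E i - Real.exp (-(β * s)) * ∑' j, lam j ^ s * M j i)

namespace IsSpec

variable {ρ : Fock →L[ℂ] Fock} {lam : ℕ → ℝ} {v : ℕ → Fock}

/-- Number terms give the energy of `v i`; the two jump terms are the quadratic form of `ρ^s` at `a†
v i` and at `a v i`, expanded again in the eigenbasis. The hypothesis `lam i ≠ 0` ensures `‖v i‖ =
1`. -/
theorem hasSum_conjGen (h : IsSpec ρ lam v) (hρ : IsState ρ) (β : ℝ) {s : ℝ} (hs : 1 / 2 ≤ s)
    (i : ℕ) (hi : lam i ≠ 0) :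
    ∃ z : ℂ, z.re = rateTerm β s lam (fun i => energy (v i)) (weight v) i ∧
    HasSum (fun k : ℕ × ℕ => star (v i k.1 * star (v i k.2)) *
      conjGen β s (toMatrix (power ρ s)) k.1 k.2) z := by
  set B := toMatrix (power ρ s) with hB
  have hsa : IsSelfAdjoint (power ρ s) := opFun_isSelfAdjoint _ _
  have hE := h.hasEnergy hρ i
  have hHS : Summable fun k : ℕ × ℕ => ‖B k.1 k.2‖ ^ 2 := by
    simpa only [one_mul] using h.summable_weighted_norm_sq hρ hs (g := fun _ => 1)
      (fun _ => zero_le_one) (by simpa only [one_mul] using hρ.trace_eq_one.summable)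
  have hL := h.hasSum_number_left hρ hs i
  have hR := h.hasSum_number_right hρ hs i
  have hO := hasSum_sesq hsa hHS (v i) (v i)
  have hv1 : ⟪v i, power ρ s (v i)⟫_ℂ = ((lam i ^ s : ℝ) : ℂ) := by
    rw [h.power_apply hρ (by linarith), inner_smul_right, inner_self_eq_norm_sq_to_K,
      h.norm_one i hi]
    simp
  have hup : HasSum (fun k : ℕ × ℕ => star (v i k.1) * ((Real.sqrt (k.1 + 1) : ℂ) *
      B (k.1 + 1) (k.2 + 1) * Real.sqrt (k.2 + 1)) * v i k.2)
      ⟪raise (v i), power ρ s (raise (v i))⟫_ℂ := by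
    refine (hasSum_shift (fun m n => ?_) (fun n => ?_) fun m => ?_).1
      (hasSum_sesq hsa hHS (raise (v i)) (raise (v i)))
    · simp only [hE.raise_apply, add_tsub_cancel_right, star_mul', Complex.star_def,
        Complex.conj_ofReal]
      push_cast
      ring
    · simp [hE.raise_apply]
    · simp [hE.raise_apply]
  have hdn : HasSum (fun k : ℕ × ℕ => star (v i k.1) * ((Real.sqrt k.1 : ℂ) *
      B (k.1 - 1) (k.2 - 1) * Real.sqrt k.2) * v i k.2)
      ⟪lower (v i), power ρ s (lower (v i))⟫_ℂ := by
    refine (hasSum_shift (fun m n => ?_) (fun n => ?_) fun m => ?_).2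
      (hasSum_sesq hsa hHS (lower (v i)) (lower (v i)))
    · simp only [hE.lower_apply, add_tsub_cancel_right, star_mul', Complex.star_def,
        Complex.conj_ofReal]
      push_cast
      ring
    · simp
    · simp
  have hq : ∀ x : Fock, (⟪x, power ρ s x⟫_ℂ).re = ∑' j, lam j ^ s * ‖⟪v j, x⟫_ℂ‖ ^ 2 := fun x =>
    (h.hasSum_quad_opFun hρ.isPositive.isSelfAdjoint (continuous_rpow (s := s) (by linarith))
      (Real.zero_rpow (by linarith)) x).tsum_eq.symm
  have hall := ((((((hL.add hR).mul_left (1 / 2 : ℂ)).add hO).sub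
    (hup.mul_left (Real.exp (β * s) : ℂ))).mul_left (Real.exp (-β / 2) : ℂ))).add
    ((((hL.add hR).mul_left (1 / 2 : ℂ)).sub
    (hdn.mul_left (Real.exp (-(β * s)) : ℂ))).mul_left (Real.exp (β / 2) : ℂ))
  refine ⟨_, ?_, hall.congr_fun fun k => ?_⟩
  · rw [hv1]
    simp only [Complex.add_re, Complex.sub_re, Complex.re_ofReal_mul, Complex.ofReal_re, hq]
    have : ((1 / 2 : ℂ) * (((lam i ^ s * energy (v i) : ℝ) : ℂ) +
        ((lam i ^ s * energy (v i) : ℝ) : ℂ))).re = lam i ^ s * energy (v i) := by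
      rw [show (1 / 2 : ℂ) * (((lam i ^ s * energy (v i) : ℝ) : ℂ) +
        ((lam i ^ s * energy (v i) : ℝ) : ℂ)) = ((lam i ^ s * energy (v i) : ℝ) : ℂ) by ring]
      exact Complex.ofReal_re _
    rw [this, rateTerm]
    simp only [h.weight_eq hρ i]
    simp only [weight]
    ring
  · simp only [conjGen, star_mul', star_star]
    ring

/-- A nonzero eigenvalue has a finite fiber, so the projection is a finite sum of rank-one terms.
The coefficient `c` is free in order to serve both `x^{1-s}` and, at `s = 1`, `log x`. -/
theorem re_wInner_specProj (h : IsSpec ρ lam v) (hρ : IsState ρ) {β : ℝ} (hβ : 0 < β) {s : ℝ}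
    (hs : 1 / 2 ≤ s) (c : ℝ) {x : ℝ} (hx : x ≠ 0) :
    (wInner β (Gam β (-(1 - s)) ((c : ℂ) • specProj ρ x))
      (Lstar β (Gam β (-s) (toMatrix (power ρ s))))).re =
    ∑' i : ↑(lam ⁻¹' {x}), c * rateTerm β s lam (fun i => energy (v i)) (weight v) i := by
  set G := (h.finite_fiber hρ hx).toFinset with hG
  have hmem : ∀ i, i ∈ G ↔ lam i = x := fun i => by simp [hG]
  have hex : ∀ i : ℕ, ∃ z : ℂ, i ∈ G →
      z.re = rateTerm β s lam (fun i => energy (v i)) (weight v) i ∧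
      HasSum (fun k : ℕ × ℕ => star (v i k.1 * star (v i k.2)) *
        conjGen β s (toMatrix (power ρ s)) k.1 k.2) z := by
    intro i
    by_cases hi : i ∈ G
    · obtain ⟨z, hz⟩ := h.hasSum_conjGen hρ β hs i (by rw [(hmem i).1 hi]; exact hx)
      exact ⟨z, fun _ => hz⟩
    · exact ⟨0, fun h => absurd h hi⟩
  choose z hz using hex
  have h1 := (hasSum_sum fun i hi => (hz i hi).2).mul_left (c : ℂ)
  have h2 : wInner β (Gam β (-(1 - s)) ((c : ℂ) • specProj ρ x))
      (Lstar β (Gam β (-s) (toMatrix (power ρ s)))) = c * ∑ i ∈ G, z i := by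
    refine (h1.congr_fun fun k => ?_).tsum_eq
    rw [wTerm_Gam hβ, h.specProj_eq hρ hx, star_sum, Finset.sum_mul]
  rw [h2, Complex.re_ofReal_mul, Complex.re_sum, Finset.mul_sum, tsum_subtype (lam ⁻¹' {x})
    (fun i => c * rateTerm β s lam (fun i => energy (v i)) (weight v) i), tsum_eq_sum (s := G)]
  · refine Finset.sum_congr rfl fun i hi => ?_
    rw [(hz i hi).1, Set.indicator_of_mem]
    exact (hmem i).1 hi
  · intro i hi
    refine Set.indicator_of_notMem ?_ _
    exact fun h' => hi ((hmem i).2 h')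

end IsSpec

/-- `∑ i j, M i j (lam i)^{1-s} (lam j)^s`. -/
def overlap (lam : ℕ → ℝ) (M : ℕ → ℕ → ℝ) (s : ℝ) : ℝ :=
  ∑' k : ℕ × ℕ, M k.1 k.2 * (lam k.1 ^ (1 - s) * lam k.2 ^ s)

/-- The mean photon number in terms of the classical data. -/
def meanNumber (lam E : ℕ → ℝ) : ℝ := ∑' i, lam i * E i

/-- The Dirichlet form of order `p = 1 / s` in terms of the classical data. -/
def rateForm (β s : ℝ) (lam E : ℕ → ℝ) (M : ℕ → ℕ → ℝ) : ℝ :=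
  Real.exp (β / 2) / (4 * (s * (1 - s))) *
    (Real.exp (-β) * (meanNumber lam E + 1) + meanNumber lam E -
      Real.exp (-(β * (1 - s))) * overlap lam M s - Real.exp (-(β * s)) * overlap lam M (1 - s))

theorem rpow_one_sub_mul_rpow {t s : ℝ} (ht : 0 ≤ t) (h0 : 0 < s) (h1 : s < 1) :
    t ^ (1 - s) * t ^ s = t := by
  rw [← Real.rpow_add_of_nonneg ht (by linarith) h0.le]
  simp

namespace RateData

variable {lam E : ℕ → ℝ} {M : ℕ → ℕ → ℝ}

theorem E_nonneg (h : RateData lam E M) (i : ℕ) : 0 ≤ E i :=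
  (tsum_nonneg fun j => h.M_nonneg j i).trans (h.col_le i)

theorem summable_lam_left (h : RateData lam E M) :
    Summable fun k : ℕ × ℕ => M k.1 k.2 * lam k.1 := by
  have h0 : 0 ≤ fun k : ℕ × ℕ => M k.1 k.2 * lam k.1 :=
    fun k => mul_nonneg (h.M_nonneg _ _) (h.lam_nonneg _)
  have h1 : ∀ i, Summable fun j => M i j * lam i := fun i => (h.summable_row i).mul_right (lam i)
  have h2 : ∀ i, ∑' j, M i j * lam i ≤ lam i * E i + lam i := fun i => by
    rw [tsum_mul_right]
    nlinarith [mul_le_mul_of_nonneg_right (h.row_le i) (h.lam_nonneg i)]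
  have h3 : Summable fun i => ∑' j, M i j * lam i :=
    (h.summable_energy.add h.hasSum_lam.summable).of_nonneg_of_le
      (fun i => tsum_nonneg fun j => mul_nonneg (h.M_nonneg _ _) (h.lam_nonneg _)) h2
  exact (summable_prod_of_nonneg h0).2 ⟨h1, h3⟩

theorem summable_lam_right (h : RateData lam E M) :
    Summable fun k : ℕ × ℕ => M k.1 k.2 * lam k.2 := by
  have h0 : 0 ≤ fun k : ℕ × ℕ => M k.2 k.1 * lam k.1 :=
    fun k => mul_nonneg (h.M_nonneg _ _) (h.lam_nonneg _)
  have h1 : ∀ i, Summable fun j => M j i * lam i := fun i => (h.summable_col i).mul_right (lam i)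
  have h2 : ∀ i, ∑' j, M j i * lam i ≤ lam i * E i := fun i => by
    rw [tsum_mul_right]
    nlinarith [mul_le_mul_of_nonneg_right (h.col_le i) (h.lam_nonneg i)]
  have h3 : Summable fun i => ∑' j, M j i * lam i :=
    h.summable_energy.of_nonneg_of_le
      (fun i => tsum_nonneg fun j => mul_nonneg (h.M_nonneg _ _) (h.lam_nonneg _)) h2
  exact (Equiv.prodComm ℕ ℕ).summable_iff.2 ((summable_prod_of_nonneg h0).2 ⟨h1, h3⟩)

theorem rpow_mul_rpow_le {x y s : ℝ} (hx : 0 ≤ x) (hy : 0 ≤ y) (h0 : 0 ≤ s) (h1 : s ≤ 1) :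
    x ^ (1 - s) * y ^ s ≤ x + y := by
  have := Real.geom_mean_le_arith_mean2_weighted (w₁ := 1 - s) (w₂ := s) (by linarith) h0 hx hy
    (by ring)
  nlinarith

theorem summable_overlap (h : RateData lam E M) {s : ℝ} (h0 : 0 ≤ s) (h1 : s ≤ 1) :
    Summable fun k : ℕ × ℕ => M k.1 k.2 * (lam k.1 ^ (1 - s) * lam k.2 ^ s) := by
  refine (h.summable_lam_left.add h.summable_lam_right).of_nonneg_of_le (fun k =>
    mul_nonneg (h.M_nonneg _ _) (mul_nonneg (Real.rpow_nonneg (h.lam_nonneg _) _)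
      (Real.rpow_nonneg (h.lam_nonneg _) _))) fun k => ?_
  rw [← mul_add]
  exact mul_le_mul_of_nonneg_left
    (rpow_mul_rpow_le (h.lam_nonneg _) (h.lam_nonneg _) h0 h1) (h.M_nonneg _ _)

/-- The factor `lam i ^ (1 - s)` turns `lam i ^ s` into `lam i` and the inner sums into overlaps.
The weighted arithmetic–geometric mean inequality makes the double series absolutely convergent. -/
theorem hasSum_rateTerm (h : RateData lam E M) (β : ℝ) {s : ℝ} (h0 : 0 < s) (h1 : s < 1) :
    HasSum (fun i => lam i ^ (1 - s) * rateTerm β s lam E M i)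
      (4 * (s * (1 - s)) * rateForm β s lam E M) := by
  have hN : HasSum (fun i => lam i * E i) (meanNumber lam E) := h.summable_energy.hasSum
  have hS := h.summable_overlap h0.le h1.le
  have hS' := h.summable_overlap (s := 1 - s) (by linarith) (by linarith)
  have e1 : HasSum (fun i => lam i ^ (1 - s) * ∑' j, lam j ^ s * M i j) (overlap lam M s) := by
    refine (hS.hasSum.prod_fiberwise fun i => (hS.prod_factor i).hasSum).congr_fun fun i => ?_
    rw [← tsum_mul_left]
    exact tsum_congr fun j => by ring
  have hS'' : HasSum (fun k : ℕ × ℕ => M k.2 k.1 * (lam k.2 ^ (1 - (1 - s)) * lam k.1 ^ (1 - s)))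
      (overlap lam M (1 - s)) := (Equiv.prodComm ℕ ℕ).hasSum_iff.2 hS'.hasSum
  have e2 : HasSum (fun i => lam i ^ (1 - s) * ∑' j, lam j ^ s * M j i)
      (overlap lam M (1 - s)) := by
    refine (hS''.prod_fiberwise fun i => (hS''.summable.prod_factor i).hasSum).congr_fun
      fun i => ?_
    rw [← tsum_mul_left]
    refine tsum_congr fun j => ?_
    rw [sub_sub_cancel]
    ring
  have hall := ((((hN.add h.hasSum_lam).sub (e1.mul_left (Real.exp (β * s)))).mul_left
    (Real.exp (-β / 2))).add ((hN.sub (e2.mul_left (Real.exp (-(β * s))))).mul_left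
    (Real.exp (β / 2))))
  have hc : 4 * (s * (1 - s)) * rateForm β s lam E M =
      Real.exp (-β / 2) * (meanNumber lam E + 1 - Real.exp (β * s) * overlap lam M s) +
      Real.exp (β / 2) * (meanNumber lam E - Real.exp (-(β * s)) * overlap lam M (1 - s)) := by
    have hne : 4 * (s * (1 - s)) ≠ 0 := by
      have : 0 < 1 - s := by linarith
      positivity
    rw [rateForm, ← mul_assoc, mul_div_cancel₀ _ hne]
    have x1 : Real.exp (-β / 2) = Real.exp (β / 2) * Real.exp (-β) := by
      rw [← Real.exp_add]
      ring_nf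
    have x2 : Real.exp (-(β * (1 - s))) = Real.exp (-β) * Real.exp (β * s) := by
      rw [← Real.exp_add]
      ring_nf
    rw [x1, x2]
    ring
  rw [hc]
  refine hall.congr_fun fun i => ?_
  have hl := rpow_one_sub_mul_rpow (h.lam_nonneg i) h0 h1
  rw [rateTerm]
  linear_combination (Real.exp (-β / 2) * (E i + 1) + Real.exp (β / 2) * E i) * hl

end RateData

theorem conjExponent_inv {p : ℝ} (hp : 1 < p) : 1 / p.conjExponent = 1 - 1 / p := by
  rw [Real.conjExponent, one_div_div]
  field_simp

theorem mul_conjExponent_div {p : ℝ} (hp : 1 < p) :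
    p * p.conjExponent / 4 = 1 / (4 * (1 / p * (1 - 1 / p))) := by
  rw [Real.conjExponent]
  have : p - 1 ≠ 0 := by linarith
  have : p ≠ 0 := by linarith
  have : (1 - 1 / p) = (p - 1) / p := by field_simp
  rw [this]
  field_simp

namespace IsSpec

variable {ρ : Fock →L[ℂ] Fock} {lam : ℕ → ℝ} {v : ℕ → Fock}

theorem dirichletGtOne_eq (h : IsSpec ρ lam v) (hρ : IsState ρ) {β : ℝ} (hβ : 0 < β) {p : ℝ}
    (hp : 1 < p) (hp2 : p ≤ 2) :
    dirichletGtOne β p ρ = rateForm β (1 / p) lam (fun i => energy (v i)) (weight v) := by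
  have hp0 : 0 < p := by linarith
  have hs : 1 / 2 ≤ 1 / p := one_div_le_one_div_of_le hp0 hp2
  have hs1 : 1 / p < 1 := by rw [div_lt_one hp0]; exact hp
  have hs0 : 0 < 1 / p := by positivity
  have hpq := mul_conjExponent_div hp
  rw [dirichletGtOne, conjExponent_inv hp, hpq]
  set s := 1 / p
  -- The sum over real `x` in the definition regroups the sum over indices along the fibers of
  -- `lam`.
  have hsum := ((h.rateData hρ).hasSum_rateTerm β hs0 hs1).tsum_fiberwise lam
  have hterm : ∀ x : ℝ, (wInner β (Gam β (-(1 - s)) (((x ^ (1 - s) : ℝ) : ℂ) • specProj ρ x))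
      (Lstar β (Gam β (-s) (toMatrix (power ρ s))))).re =
      ∑' i : ↑(lam ⁻¹' {x}), lam i ^ (1 - s) *
        rateTerm β s lam (fun i => energy (v i)) (weight v) i := by
    intro x
    have hfib : ∀ i : ↑(lam ⁻¹' {x}), lam i = x := fun i => i.2
    simp only [hfib]
    rcases eq_or_ne x 0 with rfl | hx
    -- The kernel of `ρ`, possibly infinite dimensional, drops out because `0^{1-s} = 0`.
    · rw [Real.zero_rpow (by linarith)]
      simp [wInner, wTerm, Gam]
    · exact h.re_wInner_specProj hρ hβ hs _ hx
  simp only [hterm]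
  rw [hsum.tsum_eq, ← mul_assoc, one_div_mul_cancel, one_mul]
  have : 0 < 1 - s := by linarith
  positivity

theorem logTerm_eq (h : IsSpec ρ lam v) (hρ : IsState ρ) {β : ℝ} (hβ : 0 < β) (x : ℝ) :
    logTerm β ρ x = ∑' i : ↑(lam ⁻¹' {x}), Real.log (lam i) *
      rateTerm β 1 lam (fun i => energy (v i)) (weight v) i := by
  have hfib : ∀ i : ↑(lam ⁻¹' {x}), lam i = x := fun i => i.2
  simp only [hfib]
  have hG : ∀ X, Gam β (-(1 - 1)) X = X := fun X => by
    funext m n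
    simp [Gam]
  rcases eq_or_ne x 0 with rfl | hx
  -- The eigenvalue zero contributes nothing, by the convention `Real.log 0 = 0`.
  · simp [logTerm, wInner, wTerm]
  · rw [← h.re_wInner_specProj hρ hβ (by norm_num) _ hx, hG,
      power_one hρ.isPositive.isSelfAdjoint, logTerm]

end IsSpec

/-! ### Entropy and relative entropy in the eigenbasis. -/

theorem one_sub_exp_neg_pos {β : ℝ} (hβ : 0 < β) : 0 < 1 - Real.exp (-β) := by
  have : Real.exp (-β) < 1 := by simpa using hβ
  linarith

theorem hasSum_thermal {β : ℝ} (hβ : 0 < β) : HasSum (thermal β) 1 := by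
  have h1 : Real.exp (-β) < 1 := by simpa using hβ
  have := (hasSum_geometric_of_lt_one (Real.exp_pos (-β)).le h1).mul_left (1 - Real.exp (-β))
  rw [mul_inv_cancel₀ (one_sub_exp_neg_pos hβ).ne'] at this
  refine this.congr_fun fun n => ?_
  rw [thermal, ← Real.exp_nat_mul]
  congr 2
  ring

theorem log_thermal {β : ℝ} (hβ : 0 < β) (n : ℕ) :
    Real.log (thermal β n) = Real.log (1 - Real.exp (-β)) - β * n := by
  rw [thermal, Real.log_mul (one_sub_exp_neg_pos hβ).ne' (Real.exp_ne_zero _), Real.log_exp]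
  ring

/-- Gibbs' inequality. -/
theorem negMulLog_le {x y : ℝ} (hx : 0 ≤ x) (hy : 0 < y) :
    Real.negMulLog x ≤ -(x * Real.log y) + y - x := by
  rcases hx.eq_or_lt with rfl | hx
  · simpa using hy.le
  have h1 := Real.log_le_sub_one_of_pos (div_pos hy hx)
  rw [Real.log_div hy.ne' hx.ne'] at h1
  have h2 := mul_le_mul_of_nonneg_left h1 hx.le
  rw [mul_sub, mul_sub, mul_div_cancel₀ _ hx.ne'] at h2
  rw [Real.negMulLog]
  linarith

namespace IsSpec

variable {ρ : Fock →L[ℂ] Fock} {lam : ℕ → ℝ} {v : ℕ → Fock}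

/-- The overlaps `⟨v j|σ|v j⟩` sum to at most `1`. -/
theorem tsum_overlap_thermal_le (h : IsSpec ρ lam v) {β : ℝ} (hβ : 0 < β) :
    (Summable fun j => ∑' n, ‖v j n‖ ^ 2 * thermal β n) ∧
      ∑' j, ∑' n, ‖v j n‖ ^ 2 * thermal β n ≤ 1 := by
  have hb : ∀ n, Summable (fun j => ‖v j n‖ ^ 2) ∧ ∑' j, ‖v j n‖ ^ 2 ≤ 1 := by
    intro n
    have := h.bessel (ket n)
    simpa only [inner_ket_right, norm_star, norm_ket, one_pow] using this
  have hr : ∀ n, Summable fun j => ‖v j n‖ ^ 2 * thermal β n := fun n =>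
    (hb n).1.mul_right (thermal β n)
  have hle : ∀ n, ∑' j, ‖v j n‖ ^ 2 * thermal β n ≤ thermal β n := fun n => by
    rw [tsum_mul_right]
    exact mul_le_of_le_one_left (thermal_pos hβ n).le (hb n).2
  have hs : Summable fun n => ∑' j, ‖v j n‖ ^ 2 * thermal β n :=
    (hasSum_thermal hβ).summable.of_nonneg_of_le
      (fun n => tsum_nonneg fun j => mul_nonneg (by positivity) (thermal_pos hβ n).le) hle
  have h0 : 0 ≤ fun k : ℕ × ℕ => ‖v k.2 k.1‖ ^ 2 * thermal β k.1 := fun k =>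
    mul_nonneg (by positivity) (thermal_pos hβ _).le
  have h1 : Summable fun k : ℕ × ℕ => ‖v k.2 k.1‖ ^ 2 * thermal β k.1 :=
    (summable_prod_of_nonneg h0).2 ⟨hr, hs⟩
  have h2 : Summable fun k : ℕ × ℕ => ‖v k.1 k.2‖ ^ 2 * thermal β k.2 :=
    (Equiv.prodComm ℕ ℕ).summable_iff.2 h1
  refine ⟨h2.prod, ?_⟩
  have h3 : ∑' j, ∑' n, ‖v j n‖ ^ 2 * thermal β n = ∑' n, ∑' j, ‖v j n‖ ^ 2 * thermal β n :=
    Summable.tsum_comm (f := fun n j => ‖v j n‖ ^ 2 * thermal β n) h1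
  rw [h3, ← (hasSum_thermal hβ).tsum_eq]
  exact hs.tsum_le_tsum hle (hasSum_thermal hβ).summable

/-- Gibbs' inequality with `x = lam j`, `y = thermal β n`, averaged over the probability weights `‖v
j n‖ ^ 2`. Summed over `j` it yields finiteness of the entropy and nonnegativity of the relative
entropy. -/
theorem negMulLog_lam_le (h : IsSpec ρ lam v) (hρ : IsState ρ) {β : ℝ} (hβ : 0 < β) (j : ℕ) :
    Real.negMulLog (lam j) ≤ β * (lam j * energy (v j)) +
      (-Real.log (1 - Real.exp (-β)) - 1) * lam j + ∑' n, ‖v j n‖ ^ 2 * thermal β n := by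
  by_cases h0 : lam j = 0
  · rw [h0]
    simpa using tsum_nonneg fun n => mul_nonneg (by positivity) (thermal_pos hβ n).le
  have hw : HasSum (fun n => ‖v j n‖ ^ 2) 1 := by
    have := hasSum_norm_sq (v j)
    rwa [h.norm_one j h0, one_pow] at this
  have hE : HasSum (fun n : ℕ => (n : ℝ) * ‖v j n‖ ^ 2) (energy (v j)) :=
    Summable.hasSum (h.hasEnergy hρ j)
  have hth : Summable fun n => ‖v j n‖ ^ 2 * thermal β n := by
    refine hw.summable.of_nonneg_of_le
      (fun n => mul_nonneg (by positivity) (thermal_pos hβ n).le) fun n => ?_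
    refine mul_le_of_le_one_right (by positivity) ?_
    rw [← (hasSum_thermal hβ).tsum_eq]
    exact (hasSum_thermal hβ).summable.le_tsum n fun m _ => (thermal_pos hβ m).le
  have h1 := ((hE.mul_left (β * lam j)).add
    (hw.mul_left (lam j * (-Real.log (1 - Real.exp (-β)) - 1)))).add hth.hasSum
  have h2 := hasSum_le (fun n => ?_) (hw.mul_left (Real.negMulLog (lam j))) h1
  · linarith
  · have := mul_le_mul_of_nonneg_right (negMulLog_le (h.nonneg j) (thermal_pos hβ n))
      (by positivity : 0 ≤ ‖v j n‖ ^ 2)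
    rw [log_thermal hβ] at this
    linarith

theorem negMulLog_lam_nonneg (h : IsSpec ρ lam v) (hρ : IsState ρ) (j : ℕ) :
    0 ≤ Real.negMulLog (lam j) := Real.negMulLog_nonneg (h.nonneg j) (h.lam_le_one hρ j)

/-- Finite energy forces finite entropy; comparison with any thermal state would do, and inverse
temperature `1` is taken. -/
theorem summable_negMulLog (h : IsSpec ρ lam v) (hρ : IsState ρ) :
    Summable fun j => Real.negMulLog (lam j) :=
  ((((h.hasSum_energy hρ).summable.mul_left 1).add ((h.hasSum_lam hρ).summable.mul_left _)).add
    (h.tsum_overlap_thermal_le one_pos).1).of_nonneg_of_le (h.negMulLog_lam_nonneg hρ)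
    fun j => h.negMulLog_lam_le hρ one_pos j

theorem tsum_negMulLog_le (h : IsSpec ρ lam v) (hρ : IsState ρ) {β : ℝ} (hβ : 0 < β) :
    ∑' j, Real.negMulLog (lam j) ≤ β * meanNumber lam (fun i => energy (v i)) -
      Real.log (1 - Real.exp (-β)) := by
  have hs := (((h.rateData hρ).summable_energy.hasSum.mul_left β).add ((h.hasSum_lam hρ).mul_left
    (-Real.log (1 - Real.exp (-β)) - 1))).add (h.tsum_overlap_thermal_le hβ).1.hasSum
  have := hasSum_le (h.negMulLog_lam_le hρ hβ) (h.summable_negMulLog hρ).hasSum hs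
  have h1 := (h.tsum_overlap_thermal_le hβ).2
  rw [meanNumber]
  linarith

theorem relEntropy_eq (h : IsSpec ρ lam v) (hρ : IsState ρ) {β : ℝ} (hβ : 0 < β) :
    relEntropy β ρ = β * meanNumber lam (fun i => energy (v i)) -
      Real.log (1 - Real.exp (-β)) - ∑' j, Real.negMulLog (lam j) := by
  have h1 : ∑' n, (toMatrix ρ n n).re * Real.log (thermal β n) =
      Real.log (1 - Real.exp (-β)) - β * meanNumber lam (fun i => energy (v i)) := by
    have := (hρ.trace_eq_one.mul_left (Real.log (1 - Real.exp (-β)))).sub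
      (hρ.finite_energy.hasSum.mul_left β)
    rw [← (h.hasSum_energy hρ).tsum_eq, mul_one] at this
    refine (this.congr_fun fun n => ?_).tsum_eq
    rw [log_thermal hβ]
    ring
  have h2 : ∑' n, (toMatrix (opFun (fun x => x * Real.log x) ρ) n n).re =
      -∑' j, Real.negMulLog (lam j) := by
    have hd : ∀ n, HasSum (fun j => Real.negMulLog (lam j) * ‖v j n‖ ^ 2)
        (-(toMatrix (opFun (fun x => x * Real.log x) ρ) n n).re) := by
      intro n
      refine (h.hasSum_diag hρ.isPositive.isSelfAdjoint Real.continuous_mul_log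
        (by simp) n).neg.congr_fun fun j => ?_
      rw [Real.negMulLog]
      ring
    have hc : ∀ j, HasSum (fun n => Real.negMulLog (lam j) * ‖v j n‖ ^ 2)
        (Real.negMulLog (lam j)) := by
      intro j
      by_cases h0 : lam j = 0
      · simp [h0, hasSum_zero]
      · simpa [h.norm_one j h0] using (hasSum_norm_sq (v j)).mul_left (Real.negMulLog (lam j))
    have hpos : 0 ≤ fun k : ℕ × ℕ => Real.negMulLog (lam k.1) * ‖v k.1 k.2‖ ^ 2 := fun k =>
      mul_nonneg (h.negMulLog_lam_nonneg hρ _) (by positivity)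
    have hs : Summable fun k : ℕ × ℕ => Real.negMulLog (lam k.1) * ‖v k.1 k.2‖ ^ 2 := by
      refine (summable_prod_of_nonneg hpos).2 ⟨fun j => (hc j).summable, ?_⟩
      simp only [(hc _).tsum_eq]
      exact h.summable_negMulLog hρ
    -- All terms are nonnegative because the eigenvalues lie in `[0, 1]`, so the trace may be
    -- computed in either basis.
    have hswap : ∑' n, ∑' j, Real.negMulLog (lam j) * ‖v j n‖ ^ 2 =
        ∑' j, ∑' n, Real.negMulLog (lam j) * ‖v j n‖ ^ 2 :=
      Summable.tsum_comm (f := fun j n => Real.negMulLog (lam j) * ‖v j n‖ ^ 2) hs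
    simp only [(hd _).tsum_eq, (hc _).tsum_eq] at hswap
    rw [← hswap, tsum_neg, neg_neg]
  rw [relEntropy, h1, h2]
  ring

theorem relEntropy_nonneg (h : IsSpec ρ lam v) (hρ : IsState ρ) {β : ℝ} (hβ : 0 < β) :
    0 ≤ relEntropy β ρ := by
  rw [h.relEntropy_eq hρ hβ]
  linarith [h.tsum_negMulLog_le hρ hβ]

end IsSpec

/-! ### The logarithmic Sobolev inequality for geometric distributions -/

section Scalar

variable {β a b : ℝ}

/-- The coefficient of the entropy. -/
def entCoeff (β a b : ℝ) : ℝ := (1 - Real.exp (-(β * a))) * (1 - Real.exp (-(β * b))) / β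

theorem exp_mul_lt_one (hβ : 0 < β) (ha : 0 < a) : Real.exp (-(β * a)) < 1 := by
  rw [Real.exp_lt_one_iff]
  have := mul_pos hβ ha
  linarith

theorem exp_split (hab : a + b = 1) :
    Real.exp (-β) = Real.exp (-(β * a)) * Real.exp (-(β * b)) := by
  rw [← Real.exp_add]
  congr 1
  linear_combination (-β) * hab.symm

/-- This says that the second derivative of `deficit` is nonnegative at `e^{-β}`. Apply `1 - e^{-x}
≤ x` to either factor, average with weights `b` and `a`, and use `(1 - A) + (1 - B) ≤ 2 * (1 - A *
B)`. -/
theorem entCoeff_le (hβ : 0 < β) (ha : 0 < a) (hb : 0 < b) (hab : a + b = 1) :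
    entCoeff β a b ≤ 2 * (a * b) * (1 - Real.exp (-β)) := by
  rw [entCoeff, div_le_iff₀ hβ, exp_split (β := β) hab]
  have hA := exp_mul_lt_one hβ ha
  have hB := exp_mul_lt_one hβ hb
  have hA0 := Real.exp_pos (-(β * a))
  have hB0 := Real.exp_pos (-(β * b))
  have hA1 := Real.add_one_le_exp (-(β * a))
  have hB1 := Real.add_one_le_exp (-(β * b))
  set A := Real.exp (-(β * a))
  set B := Real.exp (-(β * b))
  have h1 : (1 - A) * (1 - B) ≤ β * a * (1 - B) :=
    mul_le_mul_of_nonneg_right (by linarith) (by linarith)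
  have h2 : (1 - A) * (1 - B) ≤ β * b * (1 - A) := by
    rw [mul_comm]
    exact mul_le_mul_of_nonneg_right (by linarith) (by linarith)
  have h3 : (1 - A) + (1 - B) ≤ 2 * (1 - A * B) := by nlinarith
  calc (1 - A) * (1 - B) = b * ((1 - A) * (1 - B)) + a * ((1 - A) * (1 - B)) := by
        rw [← add_mul, add_comm b a, hab, one_mul]
    _ ≤ b * (β * a * (1 - B)) + a * (β * b * (1 - A)) := by gcongr
    _ = a * b * β * ((1 - A) + (1 - B)) := by ring
    _ ≤ a * b * β * (2 * (1 - A * B)) := by gcongr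
    _ = _ := by ring

/-- The deficit in the logarithmic Sobolev inequality at the geometric distribution with ratio
`t`, up to normalization. -/
def deficit (β a b t : ℝ) : ℝ :=
  Real.exp (-(β * b)) * (t - t ^ a) + Real.exp (-(β * a)) * (t - t ^ b) +
    entCoeff β a b * (Real.negMulLog t + Real.negMulLog (1 - t)) +
    (Real.exp (-β) + entCoeff β a b * Real.log (1 - Real.exp (-β))) * (1 - t)

/-- The derivative of `deficit`. -/
def deficit' (β a b t : ℝ) : ℝ :=
  Real.exp (-(β * b)) * (1 - a * t ^ (a - 1)) + Real.exp (-(β * a)) * (1 - b * t ^ (b - 1)) +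
    entCoeff β a b * (Real.log (1 - t) - Real.log t) -
    (Real.exp (-β) + entCoeff β a b * Real.log (1 - Real.exp (-β)))

/-- `t (1 - t)` times the second derivative of `deficit`. -/
def deficit'' (β a b t : ℝ) : ℝ :=
  a * b * (1 - t) * (Real.exp (-(β * b)) * t ^ (a - 1) + Real.exp (-(β * a)) * t ^ (b - 1)) -
    entCoeff β a b

theorem continuous_deficit (ha : 0 < a) (hb : 0 < b) : Continuous (deficit β a b) := by
  unfold deficit
  have h1 := continuous_rpow ha
  have h2 := continuous_rpow hb
  have h3 := Real.continuous_negMulLog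
  have h4 : Continuous fun t : ℝ => Real.negMulLog (1 - t) := h3.comp (by fun_prop)
  fun_prop

theorem hasDerivAt_deficit {t : ℝ} (h0 : 0 < t) (h1 : t < 1) :
    HasDerivAt (deficit β a b) (deficit' β a b t) t := by
  have e1 := Real.hasDerivAt_rpow_const (x := t) (p := a) (Or.inl h0.ne')
  have e2 := Real.hasDerivAt_rpow_const (x := t) (p := b) (Or.inl h0.ne')
  have e3 := Real.hasDerivAt_negMulLog h0.ne'
  have e4 : HasDerivAt (fun t : ℝ => Real.negMulLog (1 - t)) ((-Real.log (1 - t) - 1) * (0 - 1)) t :=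
    (Real.hasDerivAt_negMulLog (x := 1 - t) (by linarith)).comp t
      ((hasDerivAt_const t (1 : ℝ)).sub (hasDerivAt_id t))
  have e5 := (hasDerivAt_const t (1 : ℝ)).sub (hasDerivAt_id t)
  have := (((((hasDerivAt_id t).sub e1).const_mul (Real.exp (-(β * b)))).add
    (((hasDerivAt_id t).sub e2).const_mul (Real.exp (-(β * a))))).add
    ((e3.add e4).const_mul (entCoeff β a b))).add
    (e5.const_mul (Real.exp (-β) + entCoeff β a b * Real.log (1 - Real.exp (-β))))
  refine this.congr_deriv ?_
  rw [deficit']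
  ring

theorem hasDerivAt_deficit' (hab : a + b = 1) {t : ℝ} (h0 : 0 < t) (h1 : t < 1) :
    HasDerivAt (deficit' β a b) (deficit'' β a b t / (t * (1 - t))) t := by
  have e1 := Real.hasDerivAt_rpow_const (x := t) (p := a - 1) (Or.inl h0.ne')
  have e2 := Real.hasDerivAt_rpow_const (x := t) (p := b - 1) (Or.inl h0.ne')
  have e3 := Real.hasDerivAt_log h0.ne'
  have e5 := (hasDerivAt_const t (1 : ℝ)).sub (hasDerivAt_id t)
  have e4 := e5.log (by simp; linarith)
  have c1 := hasDerivAt_const t (1 : ℝ)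
  have := ((((c1.sub (e1.const_mul a)).const_mul (Real.exp (-(β * b)))).add
    ((c1.sub (e2.const_mul b)).const_mul (Real.exp (-(β * a))))).add
    ((e4.sub e3).const_mul (entCoeff β a b))).sub
    (hasDerivAt_const t (Real.exp (-β) + entCoeff β a b * Real.log (1 - Real.exp (-β))))
  refine this.congr_deriv ?_
  have h1' : 1 - t ≠ 0 := by linarith
  have hb : b = 1 - a := by linarith
  rw [deficit'', Real.rpow_sub_one h0.ne' (a - 1), Real.rpow_sub_one h0.ne' (b - 1)]
  simp only [Pi.sub_apply, id_eq]
  rw [hb]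
  field_simp
  ring

/-- The exponents `a - 1` and `b - 1` are negative. Hence the second derivative of `deficit` changes
sign at most once, from positive to negative. -/
theorem deficit''_antitone (ha : 0 < a) (hb : 0 < b) (hab : a + b = 1) {t u : ℝ} (h0 : 0 < t)
    (htu : t ≤ u) (h1 : u ≤ 1) : deficit'' β a b u ≤ deficit'' β a b t := by
  unfold deficit''
  have e1 : u ^ (a - 1) ≤ t ^ (a - 1) := Real.rpow_le_rpow_of_nonpos h0 htu (by linarith)
  have e2 : u ^ (b - 1) ≤ t ^ (b - 1) := Real.rpow_le_rpow_of_nonpos h0 htu (by linarith)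
  have : 0 ≤ 1 - u := by linarith
  have : 0 ≤ 1 - t := by linarith
  have hu : 0 < u := h0.trans_le htu
  gcongr

/-- At `z = e^{-β}` both `deficit` and its derivative vanish, and `deficit` is convex up to an
inflection point beyond `z`, hence nonnegative there. Past the inflection point it is concave, with
nonnegative values at both ends since it vanishes at `1`. -/
theorem deficit_nonneg (hβ : 0 < β) (ha : 0 < a) (hb : 0 < b) (hab : a + b = 1) {t : ℝ}
    (h0 : 0 ≤ t) (h1 : t ≤ 1) : 0 ≤ deficit β a b t := by
  set z := Real.exp (-β) with hz
  have hz0 : 0 < z := Real.exp_pos _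
  have hz1 : z < 1 := by simpa [hz] using hβ
  have hza : z ^ a = Real.exp (-(β * a)) := by rw [hz, ← Real.exp_mul, neg_mul]
  have hzb : z ^ b = Real.exp (-(β * b)) := by rw [hz, ← Real.exp_mul, neg_mul]
  have hprod : z ^ a * z ^ b = z := by rw [← Real.rpow_add hz0, hab, Real.rpow_one]
  have hlogz : Real.log z = -β := by rw [hz, Real.log_exp]
  have hμ : entCoeff β a b * β = (1 - z ^ a) * (1 - z ^ b) := by
    rw [entCoeff, hza, hzb, div_mul_cancel₀ _ hβ.ne']
  have ex1 : z ^ b * z ^ (a - 1) = 1 := by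
    rw [← Real.rpow_add hz0, show b + (a - 1) = 0 by linarith, Real.rpow_zero]
  have ex2 : z ^ a * z ^ (b - 1) = 1 := by
    rw [← Real.rpow_add hz0, show a + (b - 1) = 0 by linarith, Real.rpow_zero]
  have hFz : deficit β a b z = 0 := by
    rw [deficit, ← hz, ← hza, ← hzb, Real.negMulLog, Real.negMulLog, hlogz]
    linear_combination (z - 2) * hprod + z * hμ
  have hGz : deficit' β a b z = 0 := by
    rw [deficit', ← hz, ← hza, ← hzb, hlogz]
    linear_combination (-a) * ex1 - b * ex2 + hμ + hprod - hab
  have hF1 : deficit β a b 1 = 0 := by simp [deficit]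
  have hQz : 0 ≤ deficit'' β a b z := by
    rw [deficit'', ← hza, ← hzb, ex1, ex2]
    linarith [entCoeff_le hβ ha hb hab]
  have hcont := continuous_deficit (β := β) ha hb
  -- `deficit` is nonnegative as far as its second derivative is
  have hconv : ∀ u, z ≤ u → u < 1 → 0 ≤ deficit'' β a b u → ∀ x, 0 ≤ x → x ≤ u →
      0 ≤ deficit β a b x := by
    intro u hzu hu1 hQ x hx0 hxu
    have hmono : MonotoneOn (deficit' β a b) (Set.Ioc 0 u) := by
      refine monotoneOn_of_hasDerivWithinAt_nonneg (convex_Ioc 0 u)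
        (f' := fun t => deficit'' β a b t / (t * (1 - t))) (fun y hy =>
        (hasDerivAt_deficit' hab hy.1 (hy.2.trans_lt hu1)).continuousAt.continuousWithinAt)
        (fun y hy => ?_) fun y hy => ?_
      · rw [interior_Ioc] at hy
        exact (hasDerivAt_deficit' hab hy.1 (hy.2.trans hu1)).hasDerivWithinAt
      · rw [interior_Ioc] at hy
        have := deficit''_antitone (β := β) ha hb hab hy.1 hy.2.le hu1.le
        exact div_nonneg (hQ.trans this) (mul_nonneg hy.1.le (by linarith [hy.2]))
    rcases le_total x z with hxz | hzx
    · have hanti : AntitoneOn (deficit β a b) (Set.Icc 0 z) := by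
        refine antitoneOn_of_hasDerivWithinAt_nonpos (convex_Icc 0 z) (f' := deficit' β a b)
          hcont.continuousOn (fun y hy => ?_) fun y hy => ?_
        · rw [interior_Icc] at hy
          exact (hasDerivAt_deficit hy.1 (hy.2.trans hz1)).hasDerivWithinAt
        · rw [interior_Icc] at hy
          rw [← hGz]
          exact hmono ⟨hy.1, hy.2.le.trans hzu⟩ ⟨hz0, hzu⟩ hy.2.le
      rw [← hFz]
      exact hanti ⟨hx0, hxz⟩ ⟨hz0.le, le_rfl⟩ hxz
    · have hmon : MonotoneOn (deficit β a b) (Set.Icc z u) := by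
        refine monotoneOn_of_hasDerivWithinAt_nonneg (convex_Icc z u) (f' := deficit' β a b)
          hcont.continuousOn (fun y hy => ?_) fun y hy => ?_
        · rw [interior_Icc] at hy
          exact (hasDerivAt_deficit (hz0.trans hy.1) (hy.2.trans hu1)).hasDerivWithinAt
        · rw [interior_Icc] at hy
          rw [← hGz]
          exact hmono ⟨hz0, hzu⟩ ⟨hz0.trans hy.1, hy.2.le⟩ hy.1.le
      rw [← hFz]
      exact hmon ⟨le_rfl, hzu⟩ ⟨hzx, hxu⟩ hzx
  rcases le_total t z with htz | hzt
  · exact hconv z le_rfl hz1 hQz t h0 htz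
  rcases h1.eq_or_lt with rfl | ht1
  · exact hF1.ge
  rcases le_or_gt 0 (deficit'' β a b t) with hQ | hQ
  · exact hconv t hzt ht1 hQ t h0 le_rfl
  have hQc : ContinuousOn (deficit'' β a b) (Set.Icc z t) := by
    unfold deficit''
    have e : ∀ r : ℝ, ContinuousOn (fun t : ℝ => t ^ r) (Set.Icc z t) := fun r y hy =>
      (Real.continuousAt_rpow_const y r (Or.inl (hz0.trans_le hy.1).ne')).continuousWithinAt
    have e1 := e (a - 1)
    have e2 := e (b - 1)
    fun_prop
  -- `u` is the inflection point: the second derivative is nonnegative at `z` and negative at `t`.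
  obtain ⟨u, hu, hQu⟩ := intermediate_value_Icc' hzt hQc ⟨hQ.le, hQz⟩
  have hFu := hconv u hu.1 (hu.2.trans_lt ht1) hQu.ge u (hz0.le.trans hu.1) le_rfl
  have hu0 : 0 < u := hz0.trans_le hu.1
  have hanti : AntitoneOn (deficit' β a b) (Set.Ico u 1) := by
    refine antitoneOn_of_hasDerivWithinAt_nonpos (convex_Ico u 1)
      (f' := fun t => deficit'' β a b t / (t * (1 - t))) (fun y hy =>
      (hasDerivAt_deficit' hab (hu0.trans_le hy.1) hy.2).continuousAt.continuousWithinAt)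
      (fun y hy => ?_) fun y hy => ?_
    · rw [interior_Ico] at hy
      exact (hasDerivAt_deficit' hab (hu0.trans hy.1) hy.2).hasDerivWithinAt
    · rw [interior_Ico] at hy
      have := deficit''_antitone (β := β) ha hb hab hu0 hy.1.le hy.2.le
      exact div_nonpos_of_nonpos_of_nonneg (this.trans hQu.le)
        (mul_nonneg (hu0.trans hy.1).le (by linarith [hy.2]))
  have hconc : ConcaveOn ℝ (Set.Icc u 1) (deficit β a b) := by
    have hderiv : ∀ y ∈ Set.Ioo u 1, deriv (deficit β a b) y = deficit' β a b y := fun y hy =>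
      (hasDerivAt_deficit (hu0.trans hy.1) hy.2).deriv
    refine AntitoneOn.concaveOn_of_deriv (convex_Icc u 1) hcont.continuousOn ?_ ?_
    · rw [interior_Icc]
      exact fun y hy => (hasDerivAt_deficit (hu0.trans hy.1) hy.2).differentiableAt.differentiableWithinAt
    · rw [interior_Icc]
      intro x hx y hy hxy
      rw [hderiv x hx, hderiv y hy]
      exact hanti ⟨hx.1.le, hx.2⟩ ⟨hy.1.le, hy.2⟩ hxy
  have hu1 : u ≤ 1 := hu.2.trans h1
  have hmin := hconc.min_le_of_mem_Icc ⟨le_rfl, hu1⟩ ⟨hu1, le_rfl⟩ ⟨hu.2, h1⟩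
  rw [hF1] at hmin
  exact (le_min hFu le_rfl).trans hmin

end Scalar

/-! ### Subadditivity of the gain along chains of eigenvalues. -/

/-- The gain of a transition between eigenvalues `x` and `y`. -/
def gain (β a b x y : ℝ) : ℝ :=
  Real.exp (-(β * b)) * (x ^ b * y ^ a - y) + Real.exp (-(β * a)) * (x ^ a * y ^ b - y)

section Gain

variable {β a b x y w : ℝ}

theorem rpow_mul_rpow_self (ha : 0 < a) (hb : 0 < b) (hab : a + b = 1) (hy : 0 ≤ y) :
    y ^ b * y ^ a = y := by
  rw [← Real.rpow_add_of_nonneg hy hb.le ha.le, add_comm b a, hab, Real.rpow_one]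

/-- The defect from additivity factors into products of differences of powers; their signs are clear
as soon as `y` lies between `x` and `w`. -/
theorem gain_add_gain (ha : 0 < a) (hb : 0 < b) (hab : a + b = 1) (hy : 0 ≤ y) :
    gain β a b x y + gain β a b y w - gain β a b x w =
      Real.exp (-(β * b)) * ((x ^ b - y ^ b) * (y ^ a - w ^ a)) +
      Real.exp (-(β * a)) * ((x ^ a - y ^ a) * (y ^ b - w ^ b)) := by
  have h := rpow_mul_rpow_self ha hb hab hy
  unfold gain
  linear_combination (Real.exp (-(β * b)) + Real.exp (-(β * a))) * h

theorem gain_self (ha : 0 < a) (hb : 0 < b) (hab : a + b = 1) (hy : 0 ≤ y) :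
    gain β a b y y = 0 := by
  have h := rpow_mul_rpow_self ha hb hab hy
  unfold gain
  linear_combination (Real.exp (-(β * b)) + Real.exp (-(β * a))) * h

theorem gain_le_of_ge (ha : 0 < a) (hb : 0 < b) (hab : a + b = 1) (hw : 0 ≤ w) (hwy : w ≤ y)
    (hyx : y ≤ x) : gain β a b x w ≤ gain β a b x y + gain β a b y w := by
  have hy := hw.trans hwy
  have h := gain_add_gain (β := β) (x := x) (w := w) ha hb hab hy
  have e1 := Real.rpow_le_rpow hy hyx hb.le
  have e2 := Real.rpow_le_rpow hy hyx ha.le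
  have e3 := Real.rpow_le_rpow hw hwy hb.le
  have e4 := Real.rpow_le_rpow hw hwy ha.le
  have : 0 ≤ Real.exp (-(β * b)) * ((x ^ b - y ^ b) * (y ^ a - w ^ a)) +
      Real.exp (-(β * a)) * ((x ^ a - y ^ a) * (y ^ b - w ^ b)) := by
    have := sub_nonneg.2 e1
    have := sub_nonneg.2 e2
    have := sub_nonneg.2 e3
    have := sub_nonneg.2 e4
    positivity
  linarith

theorem gain_le_of_le (ha : 0 < a) (hb : 0 < b) (hab : a + b = 1) (hx : 0 ≤ x) (hxy : x ≤ y)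
    (hyw : y ≤ w) : gain β a b x w ≤ gain β a b x y + gain β a b y w := by
  have hy := hx.trans hxy
  have h := gain_add_gain (β := β) (x := x) (w := w) ha hb hab hy
  have e1 := Real.rpow_le_rpow hx hxy hb.le
  have e2 := Real.rpow_le_rpow hx hxy ha.le
  have e3 := Real.rpow_le_rpow hy hyw hb.le
  have e4 := Real.rpow_le_rpow hy hyw ha.le
  have : 0 ≤ Real.exp (-(β * b)) * ((y ^ b - x ^ b) * (w ^ a - y ^ a)) +
      Real.exp (-(β * a)) * ((y ^ a - x ^ a) * (w ^ b - y ^ b)) := by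
    have := sub_nonneg.2 e1
    have := sub_nonneg.2 e2
    have := sub_nonneg.2 e3
    have := sub_nonneg.2 e4
    positivity
  linarith

/-- Take `w = x` in the additivity defect: both products pair opposite differences. This bounds a
reversed step by minus the forward one. -/
theorem gain_antisymm_le (ha : 0 < a) (hb : 0 < b) (hab : a + b = 1) (hx : 0 ≤ x) (hy : 0 ≤ y) :
    gain β a b x y + gain β a b y x ≤ 0 := by
  have h := gain_add_gain (β := β) (x := x) (w := x) ha hb hab hy
  rw [gain_self ha hb hab hx, sub_zero] at h
  have key : ∀ {c d : ℝ}, 0 < c → 0 < d → (x ^ c - y ^ c) * (y ^ d - x ^ d) ≤ 0 := by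
    intro c d hc hd
    rcases le_total x y with hxy | hxy
    · exact mul_nonpos_of_nonpos_of_nonneg (sub_nonpos.2 (Real.rpow_le_rpow hx hxy hc.le))
        (sub_nonneg.2 (Real.rpow_le_rpow hx hxy hd.le))
    · exact mul_nonpos_of_nonneg_of_nonpos (sub_nonneg.2 (Real.rpow_le_rpow hy hxy hc.le))
        (sub_nonpos.2 (Real.rpow_le_rpow hy hxy hd.le))
  have k1 := mul_nonpos_of_nonneg_of_nonpos (Real.exp_pos (-(β * b))).le (key hb ha)
  have k2 := mul_nonpos_of_nonneg_of_nonpos (Real.exp_pos (-(β * a))).le (key ha hb)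
  linarith

theorem gain_nonneg (ha : 0 < a) (hb : 0 < b) (hab : a + b = 1) (hy : 0 ≤ y) (hyx : y ≤ x) :
    0 ≤ gain β a b x y := by
  have h := rpow_mul_rpow_self ha hb hab hy
  have h' := rpow_mul_rpow_self hb ha (by linarith) hy
  have e1 : y ≤ x ^ b * y ^ a := by
    nth_rewrite 1 [← h]
    gcongr
  have e2 : y ≤ x ^ a * y ^ b := by
    nth_rewrite 1 [← h']
    gcongr
  unfold gain
  have := sub_nonneg.2 e1
  have := sub_nonneg.2 e2
  positivity

theorem gain_le_sub (ha : 0 < a) (hb : 0 < b) (hab : a + b = 1) (hy : 0 ≤ y) (hyx : y ≤ x) :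
    gain β a b x y ≤ (Real.exp (-(β * b)) + Real.exp (-(β * a))) * (x - y) := by
  have hx := hy.trans hyx
  have h := rpow_mul_rpow_self ha hb hab hx
  have h' := rpow_mul_rpow_self hb ha (by linarith) hx
  have e1 : x ^ b * y ^ a ≤ x := by
    nth_rewrite 2 [← h]
    gcongr
  have e2 : x ^ a * y ^ b ≤ x := by
    nth_rewrite 2 [← h']
    gcongr
  unfold gain
  rw [add_mul]
  gcongr

/-- Both sides are homogeneous of degree one in `(T, T')`, so division by `T` reduces the claim to
`deficit` at `t = T'/T`. The bracket is the entropy of splitting mass `T` into `T - T'` and `T'`. -/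
theorem gain_tail_le (hβ : 0 < β) (ha : 0 < a) (hb : 0 < b) (hab : a + b = 1) {T T' : ℝ}
    (hT' : 0 ≤ T') (hle : T' ≤ T) :
    gain β a b T T' ≤ entCoeff β a b *
        (Real.negMulLog (T - T') + Real.negMulLog T' - Real.negMulLog T) +
      (Real.exp (-β) + entCoeff β a b * Real.log (1 - Real.exp (-β))) * (T - T') := by
  rcases (hT'.trans hle).eq_or_lt with rfl | hT
  · have : T' = 0 := le_antisymm hle hT'
    subst this
    rw [gain_self ha hb hab le_rfl]
    simp
  obtain ⟨t, rfl⟩ : ∃ t, T' = T * t := ⟨T' / T, by field_simp⟩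
  have ht0 : 0 ≤ t := by
    by_contra! h
    exact absurd hT' (not_le.2 (mul_neg_of_pos_of_neg hT h))
  have ht1 : t ≤ 1 := by nlinarith
  have hd := mul_nonneg hT.le (deficit_nonneg hβ ha hb hab ht0 ht1)
  have h := rpow_mul_rpow_self ha hb hab hT.le
  rw [gain, Real.mul_rpow hT.le ht0, Real.mul_rpow hT.le ht0, Real.negMulLog_mul,
    show T - T * t = T * (1 - t) by ring, Real.negMulLog_mul]
  unfold deficit at hd
  have hs : t * Real.negMulLog T + (1 - t) * Real.negMulLog T - Real.negMulLog T = 0 := by ring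
  have e1 : T ^ b * (T ^ a * t ^ a) = T * t ^ a := by rw [← mul_assoc, h]
  have e2 : T ^ a * (T ^ b * t ^ b) = T * t ^ b := by rw [← mul_assoc, mul_comm (T ^ a), h]
  rw [e1, e2]
  linarith

end Gain

/-! ### The logarithmic Sobolev inequality for rate data. -/

namespace RateData

variable {lam E : ℕ → ℝ} {M : ℕ → ℕ → ℝ} {β s : ℝ}

/-- The potential `∑ m ≥ n` of the gains along the chain of decreasing eigenvalues. -/
def potential (β s : ℝ) (lam : ℕ → ℝ) (n : ℕ) : ℝ :=
  ∑' m, gain β s (1 - s) (lam (m + n)) (lam (m + 1 + n))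

theorem hasSum_sub_succ (h : RateData lam E M) (n : ℕ) :
    HasSum (fun m => lam (m + n) - lam (m + 1 + n)) (lam n) := by
  have hs := (summable_nat_add_iff n).2 h.hasSum_lam.summable
  have h1 := hs.hasSum
  have h2 := (hasSum_nat_add_iff' 1).2 h1
  have := h1.sub h2
  simpa using this

theorem gain_step_nonneg (h : RateData lam E M) (h0 : 0 < s) (h1 : s < 1) (m n : ℕ) :
    0 ≤ gain β s (1 - s) (lam (m + n)) (lam (m + 1 + n)) :=
  gain_nonneg h0 (by linarith) (by ring) (h.lam_nonneg _) (h.antitone (by omega))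

theorem gain_step_le (h : RateData lam E M) (h0 : 0 < s) (h1 : s < 1) (m n : ℕ) :
    gain β s (1 - s) (lam (m + n)) (lam (m + 1 + n)) ≤
      (Real.exp (-(β * (1 - s))) + Real.exp (-(β * s))) * (lam (m + n) - lam (m + 1 + n)) :=
  gain_le_sub h0 (by linarith) (by ring) (h.lam_nonneg _) (h.antitone (by omega))

theorem summable_gain (h : RateData lam E M) (h0 : 0 < s) (h1 : s < 1) (n : ℕ) :
    Summable fun m => gain β s (1 - s) (lam (m + n)) (lam (m + 1 + n)) :=
  ((h.hasSum_sub_succ n).mul_left _).summable.of_nonneg_of_le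
    (fun m => h.gain_step_nonneg h0 h1 m n) fun m => h.gain_step_le h0 h1 m n

theorem potential_nonneg (h : RateData lam E M) (h0 : 0 < s) (h1 : s < 1) (n : ℕ) :
    0 ≤ potential β s lam n := tsum_nonneg fun m => h.gain_step_nonneg h0 h1 m n

theorem potential_le (h : RateData lam E M) (h0 : 0 < s) (h1 : s < 1) (n : ℕ) :
    potential β s lam n ≤ (Real.exp (-(β * (1 - s))) + Real.exp (-(β * s))) * lam n :=
  hasSum_le (fun m => h.gain_step_le h0 h1 m n) (h.summable_gain h0 h1 n).hasSum
    ((h.hasSum_sub_succ n).mul_left _)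

theorem potential_succ (h : RateData lam E M) (h0 : 0 < s) (h1 : s < 1) (n : ℕ) :
    potential β s lam n = gain β s (1 - s) (lam n) (lam (n + 1)) + potential β s lam (n + 1) := by
  rw [potential, (h.summable_gain h0 h1 n).tsum_eq_zero_add, potential]
  congr 1
  · simp [add_comm]
  · refine tsum_congr fun m => ?_
    congr 2 <;> ring

/-- Downhill (`i ≤ j`) the gain is at most the sum of its consecutive steps, which is the potential
difference. Uphill each step is at most minus the downhill one, by `gain_antisymm_le`. -/
theorem gain_le_potential_sub (h : RateData lam E M) (h0 : 0 < s) (h1 : s < 1) (i j : ℕ) :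
    gain β s (1 - s) (lam i) (lam j) ≤ potential β s lam i - potential β s lam j := by
  have hb : 0 < 1 - s := by linarith
  have hab : s + (1 - s) = 1 := by ring
  rcases le_total i j with hij | hij
  · induction j, hij using Nat.le_induction with
    | base => rw [gain_self h0 hb hab (h.lam_nonneg i), sub_self]
    | succ k hk ih =>
      have := gain_le_of_ge (β := β) h0 hb hab (h.lam_nonneg (k + 1))
        (h.antitone k.le_succ) (h.antitone hk)
      have := h.potential_succ (β := β) h0 h1 k
      linarith
  · induction i, hij using Nat.le_induction with
    | base => rw [gain_self h0 hb hab (h.lam_nonneg j), sub_self]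
    | succ k hk ih =>
      have := gain_le_of_le (β := β) h0 hb hab (h.lam_nonneg (k + 1))
        (h.antitone k.le_succ) (h.antitone hk)
      have := gain_antisymm_le (β := β) h0 hb hab (h.lam_nonneg (k + 1)) (h.lam_nonneg k)
      have := h.potential_succ (β := β) h0 h1 k
      linarith

theorem summable_potential (h : RateData lam E M) (h0 : 0 < s) (h1 : s < 1) :
    Summable (potential β s lam) :=
  (h.hasSum_lam.summable.mul_left _).of_nonneg_of_le (h.potential_nonneg h0 h1)
    (h.potential_le h0 h1)

/-- The overlaps are bounded by those of the passive rearrangement. -/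
theorem overlap_le (h : RateData lam E M) (h0 : 0 < s) (h1 : s < 1) :
    Real.exp (-(β * (1 - s))) * overlap lam M s + Real.exp (-(β * s)) * overlap lam M (1 - s) ≤
      (Real.exp (-(β * (1 - s))) + Real.exp (-(β * s))) * meanNumber lam E +
        ∑' n, potential β s lam n := by
  set W := Real.exp (-(β * (1 - s))) + Real.exp (-(β * s)) with hW
  have hW0 : 0 < W := by positivity
  set ψ := potential β s lam with hψ
  have hψ0 : ∀ n, 0 ≤ ψ n := h.potential_nonneg h0 h1
  have hψle : ∀ n, ψ n ≤ W * lam n := h.potential_le h0 h1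
  have hψs : Summable ψ := h.summable_potential h0 h1
  have hS := (h.summable_overlap h0.le h1.le).hasSum
  have hS' := (h.summable_overlap (s := 1 - s) (by linarith) (by linarith)).hasSum
  have hL : Summable fun k : ℕ × ℕ => M k.1 k.2 * ψ k.1 :=
    (h.summable_lam_left.mul_left W).of_nonneg_of_le
      (fun k => mul_nonneg (h.M_nonneg _ _) (hψ0 _)) fun k => by
        nlinarith [mul_le_mul_of_nonneg_left (hψle k.1) (h.M_nonneg k.1 k.2)]
  -- Because `ψ ≤ W * lam`, this coefficient is nonnegative, just as `ψ` is. So the row and column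
  -- bounds, which are only inequalities, may be used on the two pieces separately.
  have hR : Summable fun k : ℕ × ℕ => M k.1 k.2 * (W * lam k.2 - ψ k.2) :=
    (h.summable_lam_right.mul_left W).of_nonneg_of_le
      (fun k => mul_nonneg (h.M_nonneg _ _) (sub_nonneg.2 (hψle _))) fun k => by
        nlinarith [mul_nonneg (h.M_nonneg k.1 k.2) (hψ0 k.2)]
  have hψE : Summable fun i => ψ i * E i :=
    (h.summable_energy.mul_left W).of_nonneg_of_le
      (fun i => mul_nonneg (hψ0 i) (h.E_nonneg i)) fun i => by
        nlinarith [mul_le_mul_of_nonneg_right (hψle i) (h.E_nonneg i)]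
  -- Termwise, the weighted overlaps are `gain + W * lam j`, and the gain is at most `ψ i - ψ j`.
  have e1 : Real.exp (-(β * (1 - s))) * overlap lam M s +
      Real.exp (-(β * s)) * overlap lam M (1 - s) ≤
      ∑' k : ℕ × ℕ, M k.1 k.2 * ψ k.1 + ∑' k : ℕ × ℕ, M k.1 k.2 * (W * lam k.2 - ψ k.2) := by
    refine hasSum_le (fun k => ?_) ((hS.mul_left (Real.exp (-(β * (1 - s))))).add
      (hS'.mul_left (Real.exp (-(β * s))))) (hL.hasSum.add hR.hasSum)
    have := mul_le_mul_of_nonneg_left (h.gain_le_potential_sub (β := β) h0 h1 k.1 k.2)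
      (h.M_nonneg k.1 k.2)
    rw [← hψ] at this
    unfold gain at this
    rw [sub_sub_cancel, hW]
    linarith
  have e2 : ∑' k : ℕ × ℕ, M k.1 k.2 * ψ k.1 ≤ ∑' i, (ψ i * E i + ψ i) := by
    rw [hL.tsum_prod]
    refine hL.prod.tsum_le_tsum (fun i => ?_) (hψE.add hψs)
    have := mul_le_mul_of_nonneg_right (h.row_le i) (hψ0 i)
    change ∑' j, M i j * ψ i ≤ _
    rw [tsum_mul_right]
    linarith
  have e3 : ∑' k : ℕ × ℕ, M k.1 k.2 * (W * lam k.2 - ψ k.2) ≤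
      ∑' j, (W * (lam j * E j) - ψ j * E j) := by
    have hR' : Summable fun k : ℕ × ℕ => M k.2 k.1 * (W * lam k.1 - ψ k.1) :=
      (Equiv.prodComm ℕ ℕ).summable_iff.2 hR
    have hsw : ∑' k : ℕ × ℕ, M k.1 k.2 * (W * lam k.2 - ψ k.2) =
        ∑' k : ℕ × ℕ, M k.2 k.1 * (W * lam k.1 - ψ k.1) :=
      ((Equiv.prodComm ℕ ℕ).tsum_eq (fun k : ℕ × ℕ => M k.1 k.2 * (W * lam k.2 - ψ k.2))).symm
    rw [hsw, hR'.tsum_prod]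
    refine hR'.prod.tsum_le_tsum (fun j => ?_) ((h.summable_energy.mul_left W).sub hψE)
    have := mul_le_mul_of_nonneg_right (h.col_le j) (sub_nonneg.2 (hψle j))
    change ∑' i, M i j * (W * lam j - ψ j) ≤ _
    rw [tsum_mul_right]
    linarith
  -- Adding the two bounds cancels `∑ ψ i * E i`; the surviving `∑ ψ i` comes from the `+ 1` in the
  -- row bound.
  have e4 : ∑' i, (ψ i * E i + ψ i) = ∑' i, ψ i * E i + ∑' i, ψ i := hψE.tsum_add hψs
  have e5 : ∑' j, (W * (lam j * E j) - ψ j * E j) = W * meanNumber lam E - ∑' i, ψ i * E i := by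
    rw [(h.summable_energy.mul_left W).tsum_sub hψE, tsum_mul_left, meanNumber]
  linarith

/-- The tail sums of the eigenvalues. -/
def tail (lam : ℕ → ℝ) (n : ℕ) : ℝ := ∑' m, lam (m + n)

theorem tail_succ (h : RateData lam E M) (n : ℕ) : tail lam n = lam n + tail lam (n + 1) := by
  rw [tail, ((summable_nat_add_iff n).2 h.hasSum_lam.summable).tsum_eq_zero_add, tail, zero_add]
  congr 1
  refine tsum_congr fun m => ?_
  congr 1
  ring

theorem tail_nonneg (h : RateData lam E M) (n : ℕ) : 0 ≤ tail lam n :=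
  tsum_nonneg fun _ => h.lam_nonneg _

/-- Hölder's inequality with exponents `1/b` and `1/a`, for which the `p`-th power sums are exactly
the two tails. -/
theorem tsum_rpow_mul_rpow_le (h : RateData lam E M) {a b : ℝ} (ha : 0 < a) (hb : 0 < b)
    (hab : a + b = 1) (n : ℕ) :
    (Summable fun m => lam (m + n) ^ b * lam (m + 1 + n) ^ a) ∧
    ∑' m, lam (m + n) ^ b * lam (m + 1 + n) ^ a ≤ tail lam n ^ b * tail lam (n + 1) ^ a := by
  have hs1 := (summable_nat_add_iff n).2 h.hasSum_lam.summable
  have hs2 := (summable_nat_add_iff (n + 1)).2 h.hasSum_lam.summable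
  have hpow : ∀ {c : ℝ}, 0 < c → ∀ m, (lam m ^ c) ^ (1 / c) = lam m := fun hc m => by
    rw [← Real.rpow_mul (h.lam_nonneg m), mul_one_div_cancel hc.ne', Real.rpow_one]
  have hconj : (1 / b).HolderConjugate (1 / a) := by
    rw [Real.holderConjugate_iff]
    refine ⟨(one_lt_div hb).2 (by linarith), ?_⟩
    simp only [one_div, inv_inv]
    linarith
  have hidx : ∀ m, lam (m + 1 + n) = lam (m + (n + 1)) := fun m => by
    congr 1
    ring
  simp only [hidx]
  have key := Real.summable_and_inner_le_Lp_mul_Lq_tsum_of_nonneg hconj (f := fun m => lam (m + n) ^ b)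
    (g := fun m => lam (m + (n + 1)) ^ a) (fun m => Real.rpow_nonneg (h.lam_nonneg _) _)
    (fun m => Real.rpow_nonneg (h.lam_nonneg _) _) (by simpa only [hpow hb] using hs1)
    (by simpa only [hpow ha] using hs2)
  simp only [hpow hb, hpow ha, one_div_one_div] at key
  exact key

theorem potential_le_gain_tail (h : RateData lam E M) (h0 : 0 < s) (h1 : s < 1) (n : ℕ) :
    potential β s lam n ≤ gain β s (1 - s) (tail lam n) (tail lam (n + 1)) := by
  have hb : 0 < 1 - s := by linarith
  obtain ⟨s1, l1⟩ := h.tsum_rpow_mul_rpow_le h0 hb (by ring) n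
  obtain ⟨s2, l2⟩ := h.tsum_rpow_mul_rpow_le hb h0 (by ring) n
  have hs : HasSum (fun m => lam (m + 1 + n)) (tail lam (n + 1)) := by
    have := ((summable_nat_add_iff (n + 1)).2 h.hasSum_lam.summable).hasSum
    refine this.congr_fun fun m => ?_
    congr 1
    ring
  have := ((s1.hasSum.sub hs).mul_left (Real.exp (-(β * (1 - s))))).add
    ((s2.hasSum.sub hs).mul_left (Real.exp (-(β * s))))
  rw [potential, gain]
  unfold gain
  rw [this.tsum_eq]
  gcongr

/-- With `T = tail lam n` the splitting entropies of `gain_tail_le` telescope to `∑ negMulLog (lam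
i)`. The boundary terms vanish because the tail runs from `1` to `0`, where `negMulLog` is zero. -/
theorem tsum_potential_le (h : RateData lam E M) (hβ : 0 < β) (h0 : 0 < s) (h1 : s < 1)
    (hent : Summable fun i => Real.negMulLog (lam i)) :
    ∑' n, potential β s lam n ≤ entCoeff β s (1 - s) * ∑' i, Real.negMulLog (lam i) +
      (Real.exp (-β) + entCoeff β s (1 - s) * Real.log (1 - Real.exp (-β))) := by
  have hb : 0 < 1 - s := by linarith
  set μ := entCoeff β s (1 - s)
  set C := Real.exp (-β) + μ * Real.log (1 - Real.exp (-β)) with hC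
  have hstep : ∀ n, potential β s lam n ≤ μ * (Real.negMulLog (lam n) +
      (Real.negMulLog (tail lam (n + 1)) - Real.negMulLog (tail lam n))) + C * lam n := by
    intro n
    have e := h.tail_succ n
    have := (h.potential_le_gain_tail (β := β) h0 h1 n).trans
      (gain_tail_le hβ h0 hb (by ring) (h.tail_nonneg (n + 1)) (by linarith [h.lam_nonneg n]))
    rw [show tail lam n - tail lam (n + 1) = lam n by linarith] at this
    linarith
  have htail : Tendsto (tail lam) atTop (𝓝 0) := tendsto_sum_nat_add lam
  have ht0 : tail lam 0 = 1 := by simpa [tail] using h.hasSum_lam.tsum_eq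
  have hlim : Tendsto (fun N => μ * (∑ n ∈ Finset.range N, Real.negMulLog (lam n) +
      (Real.negMulLog (tail lam N) - Real.negMulLog (tail lam 0))) +
      C * ∑ n ∈ Finset.range N, lam n) atTop
      (𝓝 (μ * (∑' i, Real.negMulLog (lam i) + (0 - 0)) + C * 1)) := by
    have t1 := hent.hasSum.tendsto_sum_nat
    have t2 := h.hasSum_lam.tendsto_sum_nat
    have t3 := (Real.continuous_negMulLog.tendsto 0).comp htail
    rw [Real.negMulLog_zero] at t3
    rw [ht0, Real.negMulLog_one]
    exact ((t1.add (t3.sub tendsto_const_nhds)).const_mul μ).add (t2.const_mul C)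
  have hbound := le_of_tendsto_of_tendsto' (h.summable_potential (β := β) h0 h1).hasSum.tendsto_sum_nat hlim
    fun N => ?_
  · linarith
  · refine (Finset.sum_le_sum fun n _ => hstep n).trans_eq ?_
    rw [Finset.sum_add_distrib, ← Finset.mul_sum, Finset.sum_add_distrib,
      Finset.sum_range_sub (fun n => Real.negMulLog (tail lam n)), ← Finset.mul_sum]

/-- The logarithmic Sobolev inequality in terms of the classical data. -/
theorem logSobolev (h : RateData lam E M) (hβ : 0 < β) (h0 : 0 < s) (h1 : s < 1)
    (hent : Summable fun i => Real.negMulLog (lam i)) :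
    Real.exp (β / 2) / (4 * (s * (1 - s))) * entCoeff β s (1 - s) *
      (β * meanNumber lam E - Real.log (1 - Real.exp (-β)) - ∑' i, Real.negMulLog (lam i)) ≤
    rateForm β s lam E M := by
  have hb : 0 < 1 - s := by linarith
  have k1 := h.overlap_le (β := β) h0 h1
  have k2 := h.tsum_potential_le hβ h0 h1 hent
  -- This equals the coefficient of the mean photon number left in `rateForm` after `overlap_le`, so
  -- energy and entropy assemble into the relative entropy.
  have hμ : entCoeff β s (1 - s) * β =
      1 - Real.exp (-(β * s)) - Real.exp (-(β * (1 - s))) + Real.exp (-β) := by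
    rw [entCoeff, div_mul_cancel₀ _ hβ.ne', exp_split (β := β) (show s + (1 - s) = 1 by ring)]
    ring
  have hμN : entCoeff β s (1 - s) * β * meanNumber lam E =
      (1 - Real.exp (-(β * s)) - Real.exp (-(β * (1 - s))) + Real.exp (-β)) * meanNumber lam E := by
    rw [hμ]
  rw [rateForm, mul_assoc]
  gcongr
  linarith

end RateData

/-! ### Monotonicity of the Dirichlet forms and the limit `p → 1` -/

/-- The contribution of a transition to the Dirichlet form of order `1 / s`. -/
def edge (s u w : ℝ) : ℝ := (u + w - w ^ (1 - s) * u ^ s - w ^ s * u ^ (1 - s)) / (s * (1 - s))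

theorem pow_sub_pow_mul_le {Y y y' : ℝ} (hy : 0 ≤ y) (hyy : y ≤ y') (hY : y' ≤ Y) (n : ℕ) :
    (Y ^ n - y ^ n) * (Y - y') ≤ (Y ^ n - y' ^ n) * (Y - y) := by
  rw [← geom_sum₂_mul Y y n, ← geom_sum₂_mul Y y' n, mul_assoc, mul_assoc, mul_comm (Y - y')]
  have h1 : 0 ≤ Y - y := by linarith
  have h2 : 0 ≤ Y - y' := by linarith
  have h3 : 0 ≤ Y := by linarith
  gcongr

/-- `cosh (t * r)` is a power series in `r²` with nonnegative coefficients, so its chord slopes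
towards `R²` increase with `r²`; each monomial is handled by `pow_sub_pow_mul_le`. -/
theorem cosh_sub_mul_le {r r' R : ℝ} (t : ℝ) (hr : 0 ≤ r) (hrr : r ≤ r') (hR : r' ≤ R) :
    (Real.cosh (t * R) - Real.cosh (t * r)) * (R ^ 2 - r' ^ 2) ≤
      (Real.cosh (t * R) - Real.cosh (t * r')) * (R ^ 2 - r ^ 2) := by
  have hs : ∀ x, HasSum (fun n : ℕ => t ^ (2 * n) / (2 * n).factorial * (x ^ 2) ^ n)
      (Real.cosh (t * x)) := fun x => by
    refine (Real.hasSum_cosh (t * x)).congr_fun fun n => ?_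
    rw [mul_pow, pow_mul x]
    ring
  refine hasSum_le (fun n => ?_) (((hs R).sub (hs r)).mul_right _) (((hs R).sub (hs r')).mul_right _)
  have h := pow_sub_pow_mul_le (sq_nonneg r) (pow_le_pow_left₀ hr hrr 2)
    (pow_le_pow_left₀ (hr.trans hrr) hR 2) n
  have h0 : 0 ≤ t ^ (2 * n) / ((2 * n).factorial : ℝ) := by
    rw [pow_mul]
    positivity
  have := mul_le_mul_of_nonneg_left h h0
  linarith

theorem edge_eq_cosh {s u w : ℝ} (hu : 0 < u) (hw : 0 < w) :
    u + w - w ^ (1 - s) * u ^ s - w ^ s * u ^ (1 - s) =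
      2 * Real.exp ((Real.log u + Real.log w) / 2) *
        (Real.cosh ((Real.log u - Real.log w) * (1 / 2)) -
          Real.cosh ((Real.log u - Real.log w) * (s - 1 / 2))) := by
  rw [Real.rpow_def_of_pos hu, Real.rpow_def_of_pos hu, Real.rpow_def_of_pos hw,
    Real.rpow_def_of_pos hw]
  rw [Real.cosh_eq, Real.cosh_eq, ← Real.exp_add, ← Real.exp_add]
  have e1 : u = Real.exp ((Real.log u + Real.log w) / 2) *
      Real.exp ((Real.log u - Real.log w) * (1 / 2)) := by
    rw [← Real.exp_add, show (Real.log u + Real.log w) / 2 +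
      (Real.log u - Real.log w) * (1 / 2) = Real.log u by ring, Real.exp_log hu]
  have e2 : w = Real.exp ((Real.log u + Real.log w) / 2) *
      Real.exp (-((Real.log u - Real.log w) * (1 / 2))) := by
    rw [← Real.exp_add, show (Real.log u + Real.log w) / 2 +
      -((Real.log u - Real.log w) * (1 / 2)) = Real.log w by ring, Real.exp_log hw]
  have e3 : Real.exp (Real.log w * (1 - s) + Real.log u * s) =
      Real.exp ((Real.log u + Real.log w) / 2) *
        Real.exp ((Real.log u - Real.log w) * (s - 1 / 2)) := by
    rw [← Real.exp_add]; ring_nf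
  have e4 : Real.exp (Real.log w * s + Real.log u * (1 - s)) =
      Real.exp ((Real.log u + Real.log w) / 2) *
        Real.exp (-((Real.log u - Real.log w) * (s - 1 / 2))) := by
    rw [← Real.exp_add]; ring_nf
  linear_combination e1 + e2 - e3 - e4

theorem one_div_mul_mono {s s' : ℝ} (hs : 1 / 2 ≤ s) (hss : s ≤ s') (hs' : s' < 1) :
    1 / (s * (1 - s)) ≤ 1 / (s' * (1 - s')) := by
  refine one_div_le_one_div_of_le (mul_pos (by linarith) (by linarith)) ?_
  nlinarith

/-- As `s * (1 - s) = 1/4 - (s - 1/2)²`, `edge_eq_cosh` exhibits `edge` for positive `u`, `w` as a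
positive multiple of a chord slope from `cosh_sub_mul_le` with `R = 1/2`. If `u` or `w` is zero,
only `(u + w) / (s * (1 - s))` remains. -/
theorem edge_mono {s s' u w : ℝ} (hs : 1 / 2 ≤ s) (hss : s ≤ s') (hs' : s' < 1) (hu : 0 ≤ u)
    (hw : 0 ≤ w) : edge s u w ≤ edge s' u w := by
  have p1 : 0 < s * (1 - s) := mul_pos (by linarith) (by linarith)
  have p2 : 0 < s' * (1 - s') := mul_pos (by linarith) (by linarith)
  have hz : ∀ r : ℝ, 0 < r → (0 : ℝ) ^ r = 0 := fun r hr => Real.zero_rpow hr.ne'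
  unfold edge
  rcases hu.eq_or_lt with rfl | hu
  · rw [hz s (by linarith), hz s' (by linarith), hz (1 - s) (by linarith),
      hz (1 - s') (by linarith)]
    have := mul_le_mul_of_nonneg_left (one_div_mul_mono hs hss hs') hw
    simpa [div_eq_mul_inv] using this
  rcases hw.eq_or_lt with rfl | hw
  · rw [hz s (by linarith), hz s' (by linarith), hz (1 - s) (by linarith),
      hz (1 - s') (by linarith)]
    have := mul_le_mul_of_nonneg_left (one_div_mul_mono hs hss hs') hu.le
    simpa [div_eq_mul_inv] using this
  rw [edge_eq_cosh hu hw, edge_eq_cosh hu hw, div_le_div_iff₀ p1 p2]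
  have := cosh_sub_mul_le (Real.log u - Real.log w) (r := s - 1 / 2) (r' := s' - 1 / 2)
    (R := 1 / 2) (by linarith) (by linarith) (by linarith)
  have hE : 0 ≤ 2 * Real.exp ((Real.log u + Real.log w) / 2) := by positivity
  refine le_of_eq_of_le ?_ ((mul_le_mul_of_nonneg_left this hE).trans_eq ?_) <;> ring

theorem edge_factor {s u w : ℝ} (h0 : 0 < s) (h1 : s < 1) (hu : 0 ≤ u) (hw : 0 ≤ w) :
    u + w - w ^ (1 - s) * u ^ s - w ^ s * u ^ (1 - s) =
      (u ^ s - w ^ s) * (u ^ (1 - s) - w ^ (1 - s)) := by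
  have e1 := rpow_one_sub_mul_rpow hu h0 h1
  have e2 := rpow_one_sub_mul_rpow hw h0 h1
  linear_combination (-1) * e1 - e2

theorem edge_nonneg {s u w : ℝ} (h0 : 0 < s) (h1 : s < 1) (hu : 0 ≤ u) (hw : 0 ≤ w) :
    0 ≤ edge s u w := by
  unfold edge
  rw [edge_factor h0 h1 hu hw]
  refine div_nonneg ?_ (mul_nonneg h0.le (by linarith))
  rcases le_total u w with h | h
  · exact mul_nonneg_of_nonpos_of_nonpos (sub_nonpos.2 (Real.rpow_le_rpow hu h h0.le))
      (sub_nonpos.2 (Real.rpow_le_rpow hu h (by linarith)))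
  · exact mul_nonneg (sub_nonneg.2 (Real.rpow_le_rpow hw h h0.le))
      (sub_nonneg.2 (Real.rpow_le_rpow hw h (by linarith)))

namespace RateData

variable {lam E : ℕ → ℝ} {M : ℕ → ℕ → ℝ} {β s : ℝ}

/-- The part of the Dirichlet form due to transitions into the kernel of the state. -/
def kernelTerm (β : ℝ) (lam E : ℕ → ℝ) (M : ℕ → ℕ → ℝ) : ℝ :=
  Real.exp (-β) * (meanNumber lam E + 1) + meanNumber lam E -
    ∑' k : ℕ × ℕ, (Real.exp (-β) * (M k.1 k.2 * lam k.1) + M k.1 k.2 * lam k.2)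

theorem tsum_lam_left_le (h : RateData lam E M) :
    ∑' k : ℕ × ℕ, M k.1 k.2 * lam k.1 ≤ meanNumber lam E + 1 := by
  have hN := h.summable_energy.hasSum.add h.hasSum_lam
  rw [h.summable_lam_left.tsum_prod]
  refine hasSum_le (fun i => ?_) h.summable_lam_left.prod.hasSum hN
  change ∑' j, M i j * lam i ≤ _
  rw [tsum_mul_right]
  nlinarith [mul_le_mul_of_nonneg_right (h.row_le i) (h.lam_nonneg i)]

theorem tsum_lam_right_le (h : RateData lam E M) :
    ∑' k : ℕ × ℕ, M k.1 k.2 * lam k.2 ≤ meanNumber lam E := by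
  have hR' : Summable fun k : ℕ × ℕ => M k.2 k.1 * lam k.1 :=
    (Equiv.prodComm ℕ ℕ).summable_iff.2 h.summable_lam_right
  have hsw : ∑' k : ℕ × ℕ, M k.1 k.2 * lam k.2 = ∑' k : ℕ × ℕ, M k.2 k.1 * lam k.1 :=
    ((Equiv.prodComm ℕ ℕ).tsum_eq (fun k : ℕ × ℕ => M k.1 k.2 * lam k.2)).symm
  rw [hsw, hR'.tsum_prod]
  refine hasSum_le (fun i => ?_) hR'.prod.hasSum h.summable_energy.hasSum
  change ∑' j, M j i * lam i ≤ _
  rw [tsum_mul_right]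
  nlinarith [mul_le_mul_of_nonneg_right (h.col_le i) (h.lam_nonneg i)]

theorem kernelTerm_nonneg (h : RateData lam E M) : 0 ≤ kernelTerm β lam E M := by
  rw [kernelTerm, (h.summable_lam_left.mul_left _).tsum_add h.summable_lam_right, tsum_mul_left]
  have := mul_le_mul_of_nonneg_left h.tsum_lam_left_le (Real.exp_pos (-β)).le
  linarith [h.tsum_lam_right_le]

theorem hasSum_edge (h : RateData lam E M) (h0 : 0 < s) (h1 : s < 1) :
    HasSum (fun k : ℕ × ℕ => M k.1 k.2 * edge s (lam k.2) (Real.exp (-β) * lam k.1))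
      ((Real.exp (-β) * (meanNumber lam E + 1) + meanNumber lam E -
        Real.exp (-(β * (1 - s))) * overlap lam M s -
        Real.exp (-(β * s)) * overlap lam M (1 - s) - kernelTerm β lam E M) / (s * (1 - s))) := by
  have e1 := ((h.summable_lam_left.mul_left (Real.exp (-β))).add h.summable_lam_right).hasSum
  have e2 := (h.summable_overlap h0.le h1.le).hasSum.mul_left (Real.exp (-(β * (1 - s))))
  have e3 := (h.summable_overlap (s := 1 - s) (by linarith) (by linarith)).hasSum.mul_left
    (Real.exp (-(β * s)))
  have hall := ((e1.sub e2).sub e3).div_const (s * (1 - s))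
  have hval : Real.exp (-β) * (meanNumber lam E + 1) + meanNumber lam E -
        Real.exp (-(β * (1 - s))) * overlap lam M s -
        Real.exp (-(β * s)) * overlap lam M (1 - s) - kernelTerm β lam E M =
      ∑' k : ℕ × ℕ, (Real.exp (-β) * (M k.1 k.2 * lam k.1) + M k.1 k.2 * lam k.2) -
        Real.exp (-(β * (1 - s))) * overlap lam M s -
        Real.exp (-(β * s)) * overlap lam M (1 - s) := by
    rw [kernelTerm]
    ring
  rw [hval]
  refine hall.congr_fun fun k => ?_
  have x1 : (Real.exp (-β)) ^ (1 - s) = Real.exp (-(β * (1 - s))) := by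
    rw [← Real.exp_mul]; ring_nf
  have x2 : (Real.exp (-β)) ^ s = Real.exp (-(β * s)) := by
    rw [← Real.exp_mul]; ring_nf
  rw [edge, Real.mul_rpow (Real.exp_pos _).le (h.lam_nonneg _),
    Real.mul_rpow (Real.exp_pos _).le (h.lam_nonneg _), x1, x2, sub_sub_cancel]
  ring

/-- A sum of nonnegative terms, each monotone in `s ≥ 1/2`. The factor `1 / (s * (1 - s))` of the
kernel term blows up as `s → 1`, which accounts for infinite values of `ℰ_1`. -/
theorem rateForm_eq_edge (h : RateData lam E M) (h0 : 0 < s) (h1 : s < 1) :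
    rateForm β s lam E M = Real.exp (β / 2) / 4 *
      (∑' k : ℕ × ℕ, M k.1 k.2 * edge s (lam k.2) (Real.exp (-β) * lam k.1) +
        kernelTerm β lam E M * (1 / (s * (1 - s)))) := by
  have h1' : 1 - s ≠ 0 := by linarith
  rw [(h.hasSum_edge h0 h1).tsum_eq, rateForm]
  field_simp
  ring

theorem rateForm_mono (h : RateData lam E M) {s' : ℝ} (hs : 1 / 2 ≤ s) (hss : s ≤ s')
    (hs' : s' < 1) : rateForm β s lam E M ≤ rateForm β s' lam E M := by
  have h0 : 0 < s := by linarith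
  have h1 : s < 1 := by linarith
  rw [h.rateForm_eq_edge h0 h1, h.rateForm_eq_edge (h0.trans_le hss) hs']
  have k := h.kernelTerm_nonneg (β := β)
  have e1 : ∑' k : ℕ × ℕ, M k.1 k.2 * edge s (lam k.2) (Real.exp (-β) * lam k.1) ≤
      ∑' k : ℕ × ℕ, M k.1 k.2 * edge s' (lam k.2) (Real.exp (-β) * lam k.1) :=
    (h.hasSum_edge h0 h1).summable.tsum_le_tsum (fun k => mul_le_mul_of_nonneg_left
      (edge_mono hs hss hs' (h.lam_nonneg _) (mul_nonneg (Real.exp_pos _).le (h.lam_nonneg _)))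
      (h.M_nonneg _ _)) (h.hasSum_edge (h0.trans_le hss) hs').summable
  have e2 := one_div_mul_mono hs hss hs'
  gcongr

end RateData

/-- The form is antitone in `p` on `(1, 2)`, so a limit exists in the complete lattice `EReal`, and
`limUnder` selects it. -/
theorem IsState.tendsto_dirichlet {ρ : Fock →L[ℂ] Fock} (hρ : IsState ρ) {β : ℝ} (hβ : 0 < β) :
    Tendsto (fun p => ((dirichletGtOne β p ρ : ℝ) : EReal)) (𝓝[>] (1 : ℝ))
      (𝓝 (dirichlet β 1 ρ)) := by
  obtain ⟨lam, v, h⟩ := hρ.exists_isSpec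
  have hanti : AntitoneOn (fun p => ((dirichletGtOne β p ρ : ℝ) : EReal)) (Set.Ioo 1 2) := by
    intro p hp q hq hpq
    simp only
    have hp0 : 0 < p := by linarith [hp.1]
    have hq0 : 0 < q := by linarith [hq.1]
    rw [h.dirichletGtOne_eq hρ hβ hp.1 hp.2.le, h.dirichletGtOne_eq hρ hβ hq.1 hq.2.le,
      EReal.coe_le_coe_iff]
    exact (h.rateData hρ).rateForm_mono (one_div_le_one_div_of_le hq0 hq.2.le)
      (one_div_le_one_div_of_le hp0 hpq) ((div_lt_one hp0).2 hp.1)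
  have hlim := hanti.tendsto_nhdsWithin_Ioo_right (by simp) (OrderTop.bddAbove _)
  rw [dirichlet, if_pos rfl]
  exact tendsto_nhds_limUnder ⟨_, hlim⟩

/-! ### The entropy production of an injective state -/

/-- Rate data without transitions into the kernel of the state. -/
structure FullRateData (lam E : ℕ → ℝ) (M : ℕ → ℕ → ℝ) : Prop extends RateData lam E M where
  lam_pos : ∀ i, 0 < lam i
  hasSum_row : ∀ i, HasSum (fun j => M i j) (E i + 1)
  hasSum_col : ∀ j, HasSum (fun i => M i j) (E j)

namespace IsSpec

variable {ρ : Fock →L[ℂ] Fock} {lam : ℕ → ℝ} {v : ℕ → Fock}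

/-- If `lam i = 0`, monotonicity leaves at most `i` nonzero vectors. By Parseval these would resolve
`i + 1` Fock vectors, contradicting the count of squared norms. -/
theorem lam_pos (h : IsSpec ρ lam v) (hinj : Function.Injective ρ) (i : ℕ) : 0 < lam i := by
  refine lt_of_le_of_ne (h.nonneg i) fun h0 => ?_
  have hv : ∀ j, j ∉ Finset.range i → v j = 0 := fun j hj => by
    refine h.zero j (le_antisymm ?_ (h.nonneg j))
    rw [h0]
    exact h.antitone (by simpa using hj)
  have hk : ∀ n, ∑ j ∈ Finset.range i, ‖v j n‖ ^ 2 = 1 := fun n => by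
    have := h.parseval hinj (ket n)
    rw [norm_ket, one_pow] at this
    refine HasSum.unique (hasSum_sum_of_ne_finset_zero ?_) (this.congr_fun fun j => ?_)
    · intro j hj
      simp [hv j hj]
    · rw [inner_ket_right, norm_star]
  have hle : ∑ n ∈ Finset.range (i + 1), ∑ j ∈ Finset.range i, ‖v j n‖ ^ 2 ≤ i := by
    rw [Finset.sum_comm]
    calc _ ≤ ∑ j ∈ Finset.range i, (1 : ℝ) := Finset.sum_le_sum fun j _ => by
          have := sum_le_hasSum (Finset.range (i + 1)) (fun n _ => by positivity)
            (hasSum_norm_sq (v j))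
          refine this.trans ?_
          have := h.norm_le_one j
          nlinarith [norm_nonneg (v j)]
      _ = i := by simp
  simp only [hk] at hle
  simp at hle
  linarith

theorem fullRateData (h : IsSpec ρ lam v) (hρ : IsState ρ) (hinj : Function.Injective ρ) :
    FullRateData lam (fun i => energy (v i)) (weight v) where
  toRateData := h.rateData hρ
  lam_pos := h.lam_pos hinj
  hasSum_row i := by
    have := h.parseval hinj (raise (v i))
    rw [(h.hasEnergy hρ i).norm_raise, h.norm_one i (h.lam_pos hinj i).ne', one_pow] at this
    exact this.congr_fun fun j => h.weight_eq hρ i j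
  hasSum_col j := by
    have := h.parseval hinj (lower (v j))
    rwa [(h.hasEnergy hρ j).norm_lower] at this

end IsSpec

/-- The net flux along a transition. -/
def flux (β : ℝ) (lam : ℕ → ℝ) (M : ℕ → ℕ → ℝ) (k : ℕ × ℕ) : ℝ :=
  M k.1 k.2 * (lam k.2 - Real.exp (-β) * lam k.1)

namespace FullRateData

variable {lam E : ℕ → ℝ} {M : ℕ → ℕ → ℝ} {β : ℝ}

theorem lam_le_one (h : FullRateData lam E M) (i : ℕ) : lam i ≤ 1 :=
  le_hasSum h.hasSum_lam i fun j _ => h.lam_nonneg j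

theorem hasSum_left (h : FullRateData lam E M) :
    HasSum (fun k : ℕ × ℕ => M k.1 k.2 * lam k.1) (meanNumber lam E + 1) := by
  have e := h.summable_lam_left.hasSum
  convert e using 1
  refine (HasSum.unique (HasSum.prod_fiberwise e fun i => (h.hasSum_row i).mul_right (lam i)) ?_).symm
  refine (h.summable_energy.hasSum.add h.hasSum_lam).congr_fun fun i => ?_
  ring

theorem hasSum_right (h : FullRateData lam E M) :
    HasSum (fun k : ℕ × ℕ => M k.1 k.2 * lam k.2) (meanNumber lam E) := by
  have e := (Equiv.prodComm ℕ ℕ).hasSum_iff.2 h.summable_lam_right.hasSum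
  have e' := HasSum.prod_fiberwise e fun i => (h.hasSum_col i).mul_right (lam i)
  have := e'.unique (h.summable_energy.hasSum.congr_fun fun i => mul_comm _ _)
  rw [meanNumber, ← this]
  exact h.summable_lam_right.hasSum

theorem kernelTerm_eq_zero (h : FullRateData lam E M) :
    RateData.kernelTerm β lam E M = 0 := by
  rw [RateData.kernelTerm, ((h.hasSum_left.mul_left _).add h.hasSum_right).tsum_eq, sub_self]

theorem hasSum_flux (h : FullRateData lam E M) :
    HasSum (flux β lam M) (meanNumber lam E - Real.exp (-β) * (meanNumber lam E + 1)) := by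
  refine (h.hasSum_right.sub (h.hasSum_left.mul_left _)).congr_fun fun k => ?_
  rw [flux]
  ring

/-- A continuity equation: the generator gives the flux leaving `v i` minus the flux entering it.
Exact row and column sums are needed here. -/
theorem rateTerm_eq (h : FullRateData lam E M) (i : ℕ) :
    rateTerm β 1 lam E M i =
      Real.exp (β / 2) * (∑' j, flux β lam M (j, i) - ∑' j, flux β lam M (i, j)) := by
  have hr : Summable fun j => lam j * M i j := by
    refine (h.summable_lam_right.prod_factor i).congr fun j => mul_comm _ _
  have hc : Summable fun j => lam j * M j i := by
    refine (((Equiv.prodComm ℕ ℕ).summable_iff.2 h.summable_lam_left).prod_factor i).congr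
      fun j => mul_comm _ _
  have e1 : HasSum (fun j => flux β lam M (j, i))
      (E i * lam i - Real.exp (-β) * ∑' j, lam j * M j i) := by
    refine (((h.hasSum_col i).mul_right (lam i)).sub (hc.hasSum.mul_left _)).congr_fun fun j => ?_
    rw [flux]
    ring
  have e2 : HasSum (fun j => flux β lam M (i, j))
      (∑' j, lam j * M i j - (E i + 1) * (Real.exp (-β) * lam i)) := by
    refine (hr.hasSum.sub ((h.hasSum_row i).mul_right (Real.exp (-β) * lam i))).congr_fun
      fun j => ?_
    rw [flux]
    ring
  have x1 : Real.exp (-β / 2) = Real.exp (β / 2) * Real.exp (-β) := by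
    rw [← Real.exp_add]; ring_nf
  have x2 : Real.exp (-β) * Real.exp β = 1 := by rw [← Real.exp_add]; simp
  rw [e1.tsum_eq, e2.tsum_eq, rateTerm]
  simp only [Real.rpow_one, mul_one, x1]
  linear_combination (-Real.exp (β / 2) * ∑' j, lam j * M i j) * x2

/-- Summation by parts, legitimate because `ψ` is bounded and the flux is absolutely summable. -/
theorem hasSum_mul_rateTerm (h : FullRateData lam E M) {ψ : ℕ → ℝ} {L : ℝ} (hψ : ∀ i, |ψ i| ≤ L) :
    HasSum (fun i => ψ i * rateTerm β 1 lam E M i)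
      (Real.exp (β / 2) * ∑' k, flux β lam M k * (ψ k.2 - ψ k.1)) := by
  have hD := (h.hasSum_flux (β := β)).summable.abs
  have hb : ∀ f : ℕ × ℕ → ℕ, Summable fun k => flux β lam M k * ψ (f k) := fun f =>
    (hD.mul_right L).of_norm_bounded fun k => by
      rw [Real.norm_eq_abs, abs_mul]
      exact mul_le_mul_of_nonneg_left (hψ _) (abs_nonneg _)
  have e1 : HasSum (fun i => ψ i * ∑' j, flux β lam M (i, j))
      (∑' k, flux β lam M k * ψ k.1) := by
    refine ((hb Prod.fst).hasSum.prod_fiberwise fun i =>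
      ((hb Prod.fst).prod_factor i).hasSum).congr_fun fun i => ?_
    rw [mul_comm, ← tsum_mul_right]
  have e2 : HasSum (fun i => ψ i * ∑' j, flux β lam M (j, i))
      (∑' k, flux β lam M k * ψ k.2) := by
    have hs := (Equiv.prodComm ℕ ℕ).hasSum_iff.2 (hb Prod.snd).hasSum
    refine (hs.prod_fiberwise fun i => (hs.summable.prod_factor i).hasSum).congr_fun fun i => ?_
    rw [mul_comm, ← tsum_mul_right]
    rfl
  have e : ∑' k, flux β lam M k * (ψ k.2 - ψ k.1) =
      ∑' k, flux β lam M k * ψ k.2 - ∑' k, flux β lam M k * ψ k.1 := by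
    rw [← (hb Prod.snd).tsum_sub (hb Prod.fst)]
    exact tsum_congr fun k => mul_sub _ _ _
  rw [e]
  refine ((e2.sub e1).mul_left (Real.exp (β / 2))).congr_fun fun i => ?_
  rw [h.rateTerm_eq]
  ring

/-- Truncation from below is monotone and 1-Lipschitz, so it preserves the lower bound `-b * |D|` on
the product uniformly in `L`. -/
theorem truncated_nonneg {x y L b D : ℝ} (hb : 0 ≤ b)
    (h : (0 ≤ D ∧ x - b ≤ y) ∨ (D ≤ 0 ∧ y ≤ x - b)) :
    0 ≤ D * (max y (-L) - max x (-L)) + b * |D| := by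
  rcases h with ⟨hD, h⟩ | ⟨hD, h⟩
  · rw [abs_of_nonneg hD]
    have : max x (-L) - b ≤ max y (-L) := by
      rw [sub_le_iff_le_add]
      refine max_le ?_ ?_
      · linarith [le_max_left y (-L)]
      · linarith [le_max_right y (-L)]
    nlinarith
  · have : max y (-L) ≤ max x (-L) := max_le_max_right _ (by linarith)
    nlinarith [abs_nonneg D]

/-- The logarithm is unbounded, so it is cut off at `-L` before summing by parts. The side of the
generator converges by the summability hypothesis; the flux side is summable by a Fatou argument
with the bound `-β * |flux|`, and then converges by domination. -/
theorem hasSum_entropyProduction (h : FullRateData lam E M) (hβ : 0 < β)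
    (hs : Summable fun x : ℝ => ∑' i : ↑(lam ⁻¹' {x}), Real.log (lam i) * rateTerm β 1 lam E M i) :
    HasSum (fun k => flux β lam M k * (Real.log (lam k.2) - Real.log (lam k.1)))
      (Real.exp (-(β / 2)) *
        ∑' x : ℝ, ∑' i : ↑(lam ⁻¹' {x}), Real.log (lam i) * rateTerm β 1 lam E M i) := by
  set S := ∑' x : ℝ, ∑' i : ↑(lam ⁻¹' {x}), Real.log (lam i) * rateTerm β 1 lam E M i with hS
  let ψ : ℕ → ℕ → ℝ := fun L i => max (Real.log (lam i)) (-(L : ℝ))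
  have hlog : ∀ i, Real.log (lam i) ≤ 0 := fun i =>
    Real.log_nonpos (h.lam_nonneg i) (h.lam_le_one i)
  have hψ : ∀ L i, |ψ L i| ≤ L := fun L i => by
    rw [abs_le]
    exact ⟨le_max_right _ _, (max_le (hlog i) (by simp)).trans (Nat.cast_nonneg L)⟩
  have hlim : ∀ t : ℝ, Tendsto (fun L : ℕ => max t (-(L : ℝ))) atTop (𝓝 t) := fun t => by
    refine tendsto_const_nhds.congr' ?_
    filter_upwards [eventually_ge_atTop ⌈-t⌉₊] with L hL
    rw [max_eq_left]
    linarith [Nat.ceil_le.1 hL]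
  have hfib : ∀ g : ℝ → ℝ, ∀ x, ∑' i : ↑(lam ⁻¹' {x}), g (lam i) * rateTerm β 1 lam E M i =
      g x * ∑' i : ↑(lam ⁻¹' {x}), rateTerm β 1 lam E M i := fun g x => by
    rw [← tsum_mul_left]
    refine tsum_congr fun i => ?_
    rw [show lam i = x from i.2]
  have hleft : Tendsto (fun L => ∑' i, ψ L i * rateTerm β 1 lam E M i) atTop (𝓝 S) := by
    have e : ∀ L : ℕ, ∑' i, ψ L i * rateTerm β 1 lam E M i =
        ∑' x : ℝ, ∑' i : ↑(lam ⁻¹' {x}), ψ L i * rateTerm β 1 lam E M i := fun L =>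
      (((h.hasSum_mul_rateTerm (hψ L)).summable.hasSum).tsum_fiberwise lam).tsum_eq.symm
    simp only [e]
    have hs' := hs.norm
    -- Domination is applied eigenvalue by eigenvalue, since the hypothesis gives absolute
    -- convergence only after grouping equal eigenvalues.
    refine tendsto_tsum_of_dominated_convergence hs' (fun x => ?_)
      (Eventually.of_forall fun L x => ?_)
    · rw [hfib Real.log]
      refine ((hlim (Real.log x)).mul_const _).congr fun L => ?_
      exact (hfib (fun t => max (Real.log t) (-(L : ℝ))) x).symm
    · rw [hfib Real.log, hfib (fun t => max (Real.log t) (-(L : ℝ))) x]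
      rw [norm_mul, norm_mul]
      by_cases hx : ∃ i, lam i = x
      · obtain ⟨i, rfl⟩ := hx
        refine mul_le_mul_of_nonneg_right ?_ (norm_nonneg _)
        rw [Real.norm_eq_abs, Real.norm_eq_abs, abs_of_nonpos (hlog i), abs_of_nonpos
          (max_le (hlog i) (by simp))]
        exact neg_le_neg (le_max_left _ _)
      · have : IsEmpty ↑(lam ⁻¹' {x}) := ⟨fun i => hx ⟨i, i.2⟩⟩
        simp
  have hright : ∀ L, ∑' k, flux β lam M k * (ψ L k.2 - ψ L k.1) =
      Real.exp (-(β / 2)) * ∑' i, ψ L i * rateTerm β 1 lam E M i := fun L => by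
    rw [(h.hasSum_mul_rateTerm (hψ L)).tsum_eq, ← mul_assoc, ← Real.exp_add]
    simp
  have hD := (h.hasSum_flux (β := β)).summable.abs
  have hsumL : ∀ L, Summable fun k => flux β lam M k * (ψ L k.2 - ψ L k.1) := fun L =>
    (hD.mul_right (2 * L : ℝ)).of_norm_bounded fun k => by
      rw [Real.norm_eq_abs, abs_mul]
      refine mul_le_mul_of_nonneg_left ?_ (abs_nonneg _)
      refine (abs_sub _ _).trans ?_
      linarith [hψ L k.1, hψ L k.2]
  -- The flux has the sign of `lam j - e^{-β} * lam i`, hence of `log (lam j) - log (lam i) + β`.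
  have hsign : ∀ k : ℕ × ℕ, (0 ≤ flux β lam M k ∧ Real.log (lam k.1) - β ≤ Real.log (lam k.2)) ∨
      (flux β lam M k ≤ 0 ∧ Real.log (lam k.2) ≤ Real.log (lam k.1) - β) := fun k => by
    have hw : Real.log (Real.exp (-β) * lam k.1) = Real.log (lam k.1) - β := by
      rw [Real.log_mul (Real.exp_ne_zero _) (h.lam_pos _).ne', Real.log_exp]
      ring
    have hwp : 0 < Real.exp (-β) * lam k.1 := mul_pos (Real.exp_pos _) (h.lam_pos _)
    rcases le_total (Real.exp (-β) * lam k.1) (lam k.2) with hle | hle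
    · exact Or.inl ⟨mul_nonneg (h.M_nonneg _ _) (by linarith), hw ▸ Real.log_le_log hwp hle⟩
    · exact Or.inr ⟨mul_nonpos_of_nonneg_of_nonpos (h.M_nonneg _ _) (by linarith),
        hw ▸ Real.log_le_log (h.lam_pos _) hle⟩
  have hpt : ∀ k : ℕ × ℕ, Tendsto (fun L => flux β lam M k * (ψ L k.2 - ψ L k.1)) atTop
      (𝓝 (flux β lam M k * (Real.log (lam k.2) - Real.log (lam k.1)))) := fun k =>
    ((hlim _).sub (hlim _)).const_mul _
  have hnn : ∀ L k, 0 ≤ flux β lam M k * (ψ L k.2 - ψ L k.1) + β * |flux β lam M k| :=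
    fun L k => truncated_nonneg hβ.le (hsign k)
  have hlimsum : Tendsto (fun L => ∑' k, (flux β lam M k * (ψ L k.2 - ψ L k.1) +
      β * |flux β lam M k|)) atTop
      (𝓝 (Real.exp (-(β / 2)) * S + ∑' k, β * |flux β lam M k|)) := by
    have : ∀ L, ∑' k, (flux β lam M k * (ψ L k.2 - ψ L k.1) + β * |flux β lam M k|) =
        Real.exp (-(β / 2)) * ∑' i, ψ L i * rateTerm β 1 lam E M i +
          ∑' k, β * |flux β lam M k| := fun L => by
      rw [(hsumL L).tsum_add (hD.mul_left β), hright]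
    simp only [this]
    exact (hleft.const_mul _).add_const _
  have hsum1 : Summable fun k => flux β lam M k * (Real.log (lam k.2) - Real.log (lam k.1)) +
      β * |flux β lam M k| := by
    refine summable_of_sum_le (fun k => ge_of_tendsto' ((hpt k).add_const _) fun L => hnn L k)
      (c := Real.exp (-(β / 2)) * S + ∑' k, β * |flux β lam M k|) fun F => ?_
    refine le_of_tendsto_of_tendsto' (tendsto_finsetSum F fun k _ => (hpt k).add_const _) hlimsum
      fun L => ?_
    exact ((hsumL L).add (hD.mul_left β)).sum_le_tsum F fun k _ => hnn L k
  have hsum : Summable fun k => flux β lam M k * (Real.log (lam k.2) - Real.log (lam k.1)) :=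
    (hsum1.sub (hD.mul_left β)).congr fun k => add_sub_cancel_right _ _
  have hdom := tendsto_tsum_of_dominated_convergence hsum.norm hpt
    (Eventually.of_forall fun L k => by
      rw [norm_mul, norm_mul]
      refine mul_le_mul_of_nonneg_left ?_ (norm_nonneg _)
      exact abs_max_sub_max_le_abs _ _ _)
  simp only [hright] at hdom
  have := tendsto_nhds_unique hdom (hleft.const_mul _)
  rw [← this]
  exact hsum.hasSum

end FullRateData

/-- After `edge_factor`, one factor is `(u^s - w^s)/s → u - w`; the other is the difference quotient
of `u^t - w^t` at `t = 0`. -/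
theorem tendsto_edge {u w : ℝ} (hu : 0 < u) (hw : 0 < w) :
    Tendsto (fun s => edge s u w) (𝓝[<] 1) (𝓝 ((u - w) * (Real.log u - Real.log w))) := by
  have hd : HasDerivAt (fun t : ℝ => u ^ t - w ^ t) (Real.log u - Real.log w) 0 := by
    have := (Real.hasStrictDerivAt_const_rpow hu 0).hasDerivAt.sub
      (Real.hasStrictDerivAt_const_rpow hw 0).hasDerivAt
    rw [Real.rpow_zero, Real.rpow_zero, one_mul, one_mul] at this
    exact this
  have h1 : Tendsto (fun s : ℝ => 1 - s) (𝓝[<] 1) (𝓝[≠] 0) := by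
    refine tendsto_nhdsWithin_iff.2 ⟨?_, ?_⟩
    · have : Tendsto (fun s : ℝ => 1 - s) (𝓝 1) (𝓝 (1 - 1)) :=
        (continuous_const.sub continuous_id).tendsto 1
      rw [sub_self] at this
      exact this.mono_left nhdsWithin_le_nhds
    · filter_upwards [self_mem_nhdsWithin] with s hs
      exact (sub_pos.2 hs).ne'
  have h2 := (hasDerivAt_iff_tendsto_slope_zero.1 hd).comp h1
  have h3 : Tendsto (fun s : ℝ => (u ^ s - w ^ s) / s) (𝓝[<] 1) (𝓝 ((u ^ (1 : ℝ) - w ^ (1 : ℝ)) / 1)) := by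
    have : ContinuousAt (fun s : ℝ => (u ^ s - w ^ s) / s) 1 :=
      ((Real.continuousAt_const_rpow hu.ne').sub (Real.continuousAt_const_rpow hw.ne')).div
        continuousAt_id one_ne_zero
    exact this.tendsto.mono_left nhdsWithin_le_nhds
  rw [Real.rpow_one, Real.rpow_one, div_one] at h3
  refine (h3.mul h2).congr' ?_
  filter_upwards [Ioo_mem_nhdsLT (show (0 : ℝ) < 1 by norm_num)] with s hs
  have h1' : 1 - s ≠ 0 := by linarith [hs.2]
  have h0' : s ≠ 0 := by linarith [hs.1]
  rw [edge, edge_factor hs.1 hs.2 hu.le hw.le]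
  simp only [Function.comp, zero_add, Real.rpow_zero, sub_self, sub_zero, smul_eq_mul]
  field_simp

theorem edge_le {s u w : ℝ} (hs : 1 / 2 ≤ s) (hs' : s < 1) (hu : 0 < u) (hw : 0 < w) :
    edge s u w ≤ (u - w) * (Real.log u - Real.log w) := by
  refine ge_of_tendsto (tendsto_edge hu hw) ?_
  filter_upwards [Ioo_mem_nhdsLT hs'] with t ht
  exact edge_mono hs ht.1.le ht.2 hu.le hw.le

namespace FullRateData

variable {lam E : ℕ → ℝ} {M : ℕ → ℕ → ℝ} {β : ℝ}

/-- `edge_le` supplies the dominating series. The `β` term arises from `log (e^{-β} * lam i) = log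
(lam i) - β`. -/
theorem tendsto_rateForm (h : FullRateData lam E M) {S : ℝ}
    (hS : HasSum (fun k => flux β lam M k * (Real.log (lam k.2) - Real.log (lam k.1))) S) :
    Tendsto (fun s => rateForm β s lam E M) (𝓝[<] 1) (𝓝 (Real.exp (β / 2) / 4 *
      (S + β * (meanNumber lam E - Real.exp (-β) * (meanNumber lam E + 1))))) := by
  have hw : ∀ i, 0 < Real.exp (-β) * lam i := fun i => mul_pos (Real.exp_pos _) (h.lam_pos _)
  have hlim : HasSum (fun k : ℕ × ℕ => M k.1 k.2 * ((lam k.2 - Real.exp (-β) * lam k.1) *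
      (Real.log (lam k.2) - Real.log (Real.exp (-β) * lam k.1))))
      (S + β * (meanNumber lam E - Real.exp (-β) * (meanNumber lam E + 1))) := by
    refine (hS.add (h.hasSum_flux.mul_left β)).congr_fun fun k => ?_
    rw [flux, Real.log_mul (Real.exp_ne_zero _) (h.lam_pos _).ne', Real.log_exp]
    ring
  rw [← hlim.tsum_eq]
  have hev : ∀ᶠ s : ℝ in 𝓝[<] 1, s ∈ Set.Ioo (1 / 2 : ℝ) 1 := Ioo_mem_nhdsLT (by norm_num)
  refine Tendsto.congr' (f₁ := fun s => Real.exp (β / 2) / 4 *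
    ∑' k : ℕ × ℕ, M k.1 k.2 * edge s (lam k.2) (Real.exp (-β) * lam k.1)) ?_
    (Tendsto.const_mul _ (tendsto_tsum_of_dominated_convergence hlim.summable
      (fun k => (tendsto_edge (h.lam_pos _) (hw _)).const_mul _) ?_))
  · filter_upwards [hev] with s hs
    rw [h.toRateData.rateForm_eq_edge (by linarith [hs.1]) hs.2, h.kernelTerm_eq_zero, zero_mul,
      add_zero]
  · filter_upwards [hev] with s hs k
    rw [Real.norm_eq_abs, abs_of_nonneg (mul_nonneg (h.M_nonneg _ _) (edge_nonneg
      (by linarith [hs.1]) hs.2 (h.lam_nonneg _) (hw _).le))]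
    exact mul_le_mul_of_nonneg_left (edge_le hs.1.le hs.2 (h.lam_pos _) (hw _)) (h.M_nonneg _ _)

end FullRateData

/-! ### The pairing with `log σ` -/

/-- A nonzero limit would make `f n` comparable to `1/n`, contradicting summability. -/
theorem eq_zero_of_tendsto_affine_mul {f : ℕ → ℝ} (hf : Summable f) {a b c : ℝ} (hb : b ≠ 0)
    (h : Tendsto (fun n : ℕ => (a - b * n) * f n) atTop (𝓝 c)) : c = 0 := by
  by_contra hc
  have h1 : Tendsto (fun n : ℕ => (n : ℝ) * f n) atTop (𝓝 (-c / b)) := by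
    have := ((hf.tendsto_atTop_zero.const_mul a).sub h).div_const b
    rw [mul_zero, zero_sub] at this
    refine this.congr fun n => ?_
    field_simp
    ring
  have hd : 0 < |(-c / b)| / 2 := by
    have : -c / b ≠ 0 := div_ne_zero (neg_ne_zero.2 hc) hb
    positivity
  refine Real.not_summable_natCast_inv (summable_of_isBigO_nat hf ?_)
  refine Asymptotics.IsBigO.of_bound (|(-c / b)| / 2)⁻¹ ?_
  filter_upwards [h1.abs.eventually (lt_mem_nhds (half_lt_self (by linarith : 0 < |(-c / b)|))),
    eventually_gt_atTop 0] with n hn hn0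
  have hn' : (0 : ℝ) < n := by exact_mod_cast hn0
  rw [Real.norm_eq_abs, Real.norm_eq_abs, abs_of_pos (inv_pos.2 hn'), inv_mul_eq_div,
    le_div_iff₀ hd, inv_mul_le_iff₀ hn']
  rw [abs_mul, abs_of_pos hn'] at hn
  exact hn.le

/-- Abel summation; the boundary term converges because everything else does, so it tends to zero by
the preceding lemma. -/
theorem tsum_affine_mul_diff {f g : ℕ → ℝ} (hf : Summable f) {a b : ℝ} (hb : b ≠ 0)
    (h0 : g 0 = f 0) (hg : ∀ n, g (n + 1) = f (n + 1) - f n)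
    (hs : Summable fun n : ℕ => (a - b * n) * g n) :
    ∑' n : ℕ, (a - b * n) * g n = b * ∑' n, f n := by
  have habel : ∀ K : ℕ, ∑ n ∈ Finset.range (K + 1), (a - b * n) * g n =
      (a - b * K) * f K + b * ∑ n ∈ Finset.range K, f n := by
    intro K
    induction K with
    | zero => simp [h0]
    | succ K ih =>
      rw [Finset.sum_range_succ, ih, hg, Finset.sum_range_succ]
      push_cast
      ring
  have h1 := (tendsto_add_atTop_iff_nat 1).2 hs.hasSum.tendsto_sum_nat
  have h2 := hf.hasSum.tendsto_sum_nat.const_mul b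
  have h3 : Tendsto (fun K : ℕ => (a - b * K) * f K) atTop
      (𝓝 (∑' n : ℕ, (a - b * n) * g n - b * ∑' n, f n)) := by
    refine (h1.sub h2).congr fun K => ?_
    rw [habel, add_sub_cancel_right]
  linarith [eq_zero_of_tendsto_affine_mul hf hb h3]

/-- On the diagonal the generator is a discrete divergence `f n - f (n - 1)`, and `log σ` is affine
in `n`. Abel summation therefore replaces the pairing by `β * ∑ f`, which requires only finite
energy. -/
theorem re_wInner_logThermal {ρ : Fock →L[ℂ] Fock} (hρ : IsState ρ) {β : ℝ} (hβ : 0 < β)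
    (hs : Summable (wTerm β (logThermal β) (Lstar β (Gam β (-1) (toMatrix ρ))))) :
    (wInner β (logThermal β) (Lstar β (Gam β (-1) (toMatrix ρ)))).re =
      β * (Real.exp (-β / 2) * (∑' n : ℕ, (n : ℝ) * (toMatrix ρ n n).re + 1) -
        Real.exp (β / 2) * ∑' n : ℕ, (n : ℝ) * (toMatrix ρ n n).re) := by
  obtain ⟨r, hr⟩ : ∃ r : ℕ → ℝ, ∀ n, (toMatrix ρ n n).re = r n := ⟨_, fun n => rfl⟩
  simp only [hr]
  have hr1 : HasSum r 1 := by simpa only [hr] using hρ.trace_eq_one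
  have hrE : Summable fun n : ℕ => (n : ℝ) * r n := by simpa only [hr] using hρ.finite_energy
  have hterm : ∀ k, wTerm β (logThermal β) (Lstar β (Gam β (-1) (toMatrix ρ))) k =
      star (logThermal β k.1 k.2) * conjGen β 1 (toMatrix ρ) k.1 k.2 := fun k => by
    have := wTerm_Gam hβ 1 1 (logThermal β) (toMatrix ρ) k
    have hG : Gam β (-(1 - 1)) (((1 : ℝ) : ℂ) • logThermal β) = logThermal β := by
      funext m n
      simp [Gam]
    rwa [hG, Complex.ofReal_one, one_mul] at this
  have hinj : Function.Injective fun n : ℕ => (n, n) := fun m n h => (Prod.mk.inj h).1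
  have hsupp : ∀ k ∉ Set.range fun n : ℕ => (n, n),
      wTerm β (logThermal β) (Lstar β (Gam β (-1) (toMatrix ρ))) k = 0 := fun k hk => by
    have : k.1 ≠ k.2 := fun h => hk ⟨k.1, Prod.ext rfl h⟩
    rw [hterm, logThermal, if_neg this]
    simp
  have h1 := Complex.hasSum_re ((hinj.hasSum_iff hsupp).2 hs.hasSum)
  have hg : ∀ n : ℕ, (conjGen β 1 (toMatrix ρ) n n).re =
      (Real.exp (-β / 2) * ((n + 1) * r n) - Real.exp (β / 2) * ((n + 1) * r (n + 1))) -
      (Real.exp (-β / 2) * (n * r (n - 1)) - Real.exp (β / 2) * (n * r n)) := by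
    intro n
    have q : ∀ (t : ℝ) (z : ℂ), 0 ≤ t →
        ((Real.sqrt t : ℂ) * z * (Real.sqrt t : ℂ)).re = t * z.re := fun t z ht => by
      rw [mul_right_comm, ofReal_sqrt_mul_self ht, Complex.re_ofReal_mul]
    have x1 : Real.exp (β * 1) * Real.exp (-β / 2) = Real.exp (β / 2) := by
      rw [← Real.exp_add]; ring_nf
    have x2 : Real.exp (-(β * 1)) * Real.exp (β / 2) = Real.exp (-β / 2) := by
      rw [← Real.exp_add]; ring_nf
    have y1 : ∀ z : ℂ, (((n : ℂ) + 1 + (n + 1)) / 2 * z).re = (n + 1) * z.re := fun z => by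
      rw [show ((n : ℂ) + 1 + (n + 1)) / 2 = (((n : ℝ) + 1 : ℝ) : ℂ) by push_cast; ring,
        Complex.re_ofReal_mul]
    have y2 : ∀ z : ℂ, (((n : ℂ) + n) / 2 * z).re = n * z.re := fun z => by
      rw [show ((n : ℂ) + n) / 2 = ((n : ℝ) : ℂ) by push_cast; ring, Complex.re_ofReal_mul]
    have hq1 := q ((n : ℝ) + 1) (toMatrix ρ (n + 1) (n + 1)) (by positivity)
    have hq2 := q (n : ℝ) (toMatrix ρ (n - 1) (n - 1)) (by positivity)
    rw [conjGen, Complex.add_re, Complex.re_ofReal_mul, Complex.re_ofReal_mul, Complex.sub_re,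
      Complex.sub_re, Complex.re_ofReal_mul, Complex.re_ofReal_mul, y1, y2, hq1, hq2, hr, hr, hr]
    linear_combination (-((n : ℝ) + 1) * r (n + 1)) * x1 - (n * r (n - 1)) * x2
  have h2 : HasSum (fun n : ℕ => (Real.log (1 - Real.exp (-β)) - β * n) *
      (conjGen β 1 (toMatrix ρ) n n).re)
      (wInner β (logThermal β) (Lstar β (Gam β (-1) (toMatrix ρ)))).re := by
    refine h1.congr_fun fun n => ?_
    rw [Function.comp, hterm, logThermal, if_pos rfl, log_thermal hβ, Complex.star_def,
      Complex.conj_ofReal, Complex.re_ofReal_mul]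
  have hf : HasSum (fun n : ℕ => Real.exp (-β / 2) * (((n : ℝ) + 1) * r n) -
      Real.exp (β / 2) * (((n : ℝ) + 1) * r (n + 1)))
      (Real.exp (-β / 2) * (∑' n : ℕ, (n : ℝ) * r n + 1) -
        Real.exp (β / 2) * ∑' n : ℕ, (n : ℝ) * r n) := by
    have e1 := (hrE.hasSum.add hr1).congr_fun (g := fun n : ℕ => ((n : ℝ) + 1) * r n)
      fun n => by ring
    have e2 := (hasSum_nat_add_iff' 1).2 hrE.hasSum
    simp only [Finset.range_one, Finset.sum_singleton, Nat.cast_zero, zero_mul, sub_zero,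
      Nat.cast_add, Nat.cast_one] at e2
    exact (e1.mul_left _).sub (e2.mul_left _)
  rw [← h2.tsum_eq, ← hf.tsum_eq]
  refine tsum_affine_mul_diff hf.summable hβ.ne' ?_ (fun n => ?_) h2.summable
  · rw [hg]
    simp
  · rw [hg, add_tsub_cancel_right]
    push_cast
    ring

theorem tendsto_one_div_nhdsGT_one : Tendsto (fun p : ℝ => 1 / p) (𝓝[>] 1) (𝓝[<] 1) := by
  refine tendsto_nhdsWithin_iff.2 ⟨?_, ?_⟩
  · have : ContinuousAt (fun p : ℝ => 1 / p) 1 := continuousAt_const.div continuousAt_id one_ne_zero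
    simpa using this.tendsto.mono_left nhdsWithin_le_nhds
  · filter_upwards [self_mem_nhdsWithin] with p hp
    have hp' : (1 : ℝ) < p := hp
    exact (div_lt_one (zero_lt_one.trans hp')).2 hp'

/-- The limit of `rateForm` has two parts: the entropy production is the `log ρ` pairing, and the
`β` part is minus the `log σ` pairing. -/
theorem dirichlet_one_eq {ρ : Fock →L[ℂ] Fock} (hρ : IsState ρ) (hinj : Function.Injective ρ)
    {β : ℝ} (hβ : 0 < β) (hlog : Summable (logTerm β ρ))
    (hs : Summable (wTerm β (logThermal β) (Lstar β (Gam β (-1) (toMatrix ρ))))) :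
    dirichlet β 1 ρ = ((1 / 4 * ((∑' x : ℝ, logTerm β ρ x) -
      (wInner β (logThermal β) (Lstar β (Gam β (-1) (toMatrix ρ)))).re) : ℝ) : EReal) := by
  obtain ⟨lam, v, h⟩ := hρ.exists_isSpec
  have hF := h.fullRateData hρ hinj
  have hlim := hF.tendsto_rateForm (hF.hasSum_entropyProduction hβ (hlog.congr fun x =>
    h.logTerm_eq hρ hβ x))
  have hN : meanNumber lam (fun i => energy (v i)) = ∑' n : ℕ, (n : ℝ) * (toMatrix ρ n n).re :=
    (h.hasSum_energy hρ).tsum_eq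
  refine tendsto_nhds_unique (hρ.tendsto_dirichlet hβ) ?_
  refine (EReal.tendsto_coe.2 ((hlim.comp tendsto_one_div_nhdsGT_one).congr' ?_)).trans (le_of_eq ?_)
  · filter_upwards [Ioo_mem_nhdsGT (show (1 : ℝ) < 2 by norm_num)] with p hp
    exact (h.dirichletGtOne_eq hρ hβ hp.1 hp.2.le).symm
  · rw [re_wInner_logThermal hρ hβ hs, hN]
    simp only [h.logTerm_eq hρ hβ]
    have x1 : Real.exp (β / 2) * Real.exp (-(β / 2)) = 1 := by rw [← Real.exp_add]; simp
    have x2 : Real.exp (β / 2) * Real.exp (-β) = Real.exp (-β / 2) := by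
      rw [← Real.exp_add]; ring_nf
    congr 2
    linear_combination (1 / 4 * ∑' x : ℝ, ∑' i : ↑(lam ⁻¹' {x}), Real.log (lam i) *
      rateTerm β 1 lam (fun i => energy (v i)) (weight v) i) * x1 -
      (β / 4 * (∑' n : ℕ, (n : ℝ) * (toMatrix ρ n n).re + 1)) * x2

/-! ### Thermal states -/

theorem exists_diagonal {t : ℕ → ℝ} (h0 : ∀ n, 0 ≤ t n) (h1 : ∀ n, t n ≤ 1) :
    ∃ T : Fock →L[ℂ] Fock, ∀ x n, T x n = (t n : ℂ) * x n := by
  have hle : ∀ (x : Fock) n, ‖(t n : ℂ) * x n‖ ^ 2 ≤ ‖x n‖ ^ 2 := fun x n => by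
    rw [norm_mul, Complex.norm_real, Real.norm_eq_abs, abs_of_nonneg (h0 n)]
    exact pow_le_pow_left₀ (mul_nonneg (h0 n) (norm_nonneg _))
      (mul_le_of_le_one_left (norm_nonneg _) (h1 n)) 2
  have hm : ∀ x : Fock, Memℓp (E := fun _ : ℕ => ℂ) (fun n => (t n : ℂ) * x n) 2 := fun x =>
    memlp_two_iff.2 ((hasSum_norm_sq x).summable.of_nonneg_of_le (fun n => by positivity) (hle x))
  let T : Fock →ₗ[ℂ] Fock :=
    { toFun := fun x => ⟨_, hm x⟩
      map_add' := fun x y => by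
        ext n
        exact mul_add _ _ _
      map_smul' := fun c x => by
        ext n
        exact mul_left_comm _ _ _ }
  refine ⟨T.mkContinuous 1 fun x => ?_, fun x n => rfl⟩
  rw [one_mul]
  refine le_of_sq_le_sq ?_ (norm_nonneg _)
  exact hasSum_le (hle x) (hasSum_norm_sq (T x)) (hasSum_norm_sq x)

theorem ket_apply (m n : ℕ) : ket m n = if n = m then 1 else 0 := by
  rw [ket, lp.coeFn_single, Pi.single_apply]

theorem energy_ket (n : ℕ) : energy (ket n) = n := by
  rw [energy, tsum_eq_single n]
  · simp [ket_apply]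
  · intro m hm
    simp [ket_apply, hm]

theorem hasEnergy_ket (n : ℕ) : HasEnergy (ket n) := by
  refine summable_of_ne_finset_zero (s := {n}) fun m hm => ?_
  have : m ≠ n := by simpa using hm
  simp [ket_apply, this]

theorem weight_ket (i j : ℕ) : weight ket i j = if j = i + 1 then (i : ℝ) + 1 else 0 := by
  rw [weight, inner_ket, (hasEnergy_ket j).lower_apply, norm_sq_sqrt_mul (by positivity), ket_apply]
  by_cases h : i + 1 = j
  · simp [h]
  · simp [h, Ne.symm h]

theorem hasSum_thermal_mul {θ : ℝ} (hθ : 0 < θ) :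
    HasSum (fun n : ℕ => thermal θ n * n) (Real.exp (-θ) / (1 - Real.exp (-θ))) := by
  have h1 := one_sub_exp_neg_pos hθ
  have := (hasSum_coe_mul_geometric_of_norm_lt_one (r := Real.exp (-θ)) (by
    rw [Real.norm_eq_abs, abs_of_pos (Real.exp_pos _)]; linarith)).mul_left (1 - Real.exp (-θ))
  have e : (1 - Real.exp (-θ)) * (Real.exp (-θ) / (1 - Real.exp (-θ)) ^ 2) =
      Real.exp (-θ) / (1 - Real.exp (-θ)) := by
    field_simp
  rw [e] at this
  refine this.congr_fun fun n => ?_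
  rw [thermal, ← Real.exp_nat_mul, mul_comm (n : ℝ) (-θ)]
  ring

theorem exists_thermalState {θ : ℝ} (hθ : 0 < θ) :
    ∃ ρ : Fock →L[ℂ] Fock, IsState ρ ∧ IsSpec ρ (thermal θ) ket := by
  obtain ⟨ρ, hρ⟩ := exists_diagonal (fun n => (thermal_pos hθ n).le) fun n =>
    le_hasSum (hasSum_thermal hθ) n fun j _ => (thermal_pos hθ j).le
  have hdiag : ∀ n, (toMatrix ρ n n).re = thermal θ n := fun n => by
    rw [toMatrix, inner_ket, hρ, ket_apply]
    simp
  refine ⟨ρ, ⟨?_, ?_, ?_⟩, ⟨fun n => (thermal_pos hθ n).le, ?_, ?_, fun n _ => norm_ket n, ?_, ?_,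
    ?_⟩⟩
  · rw [ContinuousLinearMap.isPositive_iff_complex]
    intro x
    have h := lp.hasSum_inner (𝕜 := ℂ) (ρ x) x
    have ht : ∀ n, ⟪ρ x n, x n⟫_ℂ = ((thermal θ n * ‖x n‖ ^ 2 : ℝ) : ℂ) := fun n => by
      rw [hρ, ← smul_eq_mul, inner_smul_left, inner_self_eq_norm_sq_to_K]
      simp
    simp only [ht] at h
    have hre := Complex.hasSum_re h
    refine ⟨?_, ?_⟩
    · exact (Complex.hasSum_ofReal.2 hre).unique h
    · exact hre.nonneg fun n => mul_nonneg (thermal_pos hθ n).le (by positivity)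
  · simpa only [hdiag] using hasSum_thermal hθ
  · simp only [hdiag]
    exact (hasSum_thermal_mul hθ).summable.congr fun n => mul_comm _ _
  · refine antitone_nat_of_succ_le fun n => ?_
    have := thermal_succ_rpow hθ 1 n
    rw [Real.rpow_one, Real.rpow_one] at this
    rw [this]
    refine mul_le_of_le_one_left (thermal_pos hθ n).le ?_
    rw [Real.exp_le_one_iff]
    linarith
  · intro i j hij
    rw [inner_ket, ket_apply, if_neg hij]
  · intro i hi
    exact absurd hi (thermal_pos hθ i).ne'
  · intro i
    ext n
    rw [hρ, lp.coeFn_smul, Pi.smul_apply, smul_eq_mul, ket_apply]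
    by_cases h : n = i
    · simp [h]
    · simp [h]
  · intro w hw
    have : w = 0 := by
      ext n
      rw [← inner_ket, hw]
      rfl
    rw [this, map_zero]

variable {θ β : ℝ}

theorem meanNumber_thermal (hθ : 0 < θ) :
    meanNumber (thermal θ) (fun n => energy (ket n)) = Real.exp (-θ) / (1 - Real.exp (-θ)) := by
  simp only [meanNumber, energy_ket]
  exact (hasSum_thermal_mul hθ).tsum_eq

/-- In the Fock basis only `n + 1 → n` has weight, so the double series lives on one diagonal. -/
theorem overlap_thermal (hθ : 0 < θ) (s : ℝ) :
    overlap (thermal θ) (weight ket) s =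
      Real.exp (-θ) ^ s / (1 - Real.exp (-θ)) := by
  have hinj : Function.Injective fun n : ℕ => (n, n + 1) := fun m n h => (Prod.mk.inj h).1
  have h1 := one_sub_exp_neg_pos hθ
  rw [overlap, ← hinj.tsum_eq]
  · have : HasSum (fun n : ℕ => Real.exp (-θ) ^ s * (thermal θ n * n + thermal θ n))
        (Real.exp (-θ) ^ s * (Real.exp (-θ) / (1 - Real.exp (-θ)) + 1)) :=
      ((hasSum_thermal_mul hθ).add (hasSum_thermal hθ)).mul_left _
    have e : Real.exp (-θ) ^ s * (Real.exp (-θ) / (1 - Real.exp (-θ)) + 1) =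
        Real.exp (-θ) ^ s / (1 - Real.exp (-θ)) := by
      field_simp
      ring
    rw [← e, ← this.tsum_eq]
    refine tsum_congr fun n => ?_
    have hp : thermal θ n ^ (1 - s) * thermal θ n ^ s = thermal θ n := by
      rw [← Real.rpow_add (thermal_pos hθ n)]
      simp
    rw [weight_ket, if_pos rfl, thermal_succ_rpow hθ, ← Real.exp_mul, ← neg_mul]
    linear_combination (((n : ℝ) + 1) * Real.exp (-θ * s)) * hp
  · intro k hk
    by_contra hr
    refine hk ?_
    have : k.2 ≠ k.1 + 1 := fun h => hr ⟨k.1, Prod.ext rfl h.symm⟩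
    simp only [weight_ket, if_neg this, zero_mul]

theorem rateForm_thermal (hθ : 0 < θ) {s : ℝ} (h0 : 0 < s) (h1 : s < 1) :
    rateForm β s (thermal θ) (fun n => energy (ket n)) (weight ket) =
      Real.exp (β / 2) / 4 * edge s (Real.exp (-θ)) (Real.exp (-β)) / (1 - Real.exp (-θ)) := by
  have hy := one_sub_exp_neg_pos hθ
  have h1' : 1 - s ≠ 0 := by linarith
  rw [rateForm, meanNumber_thermal hθ, overlap_thermal hθ, overlap_thermal hθ, edge,
    ← Real.exp_mul (-β), ← Real.exp_mul (-β), neg_mul, neg_mul]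
  field_simp
  ring

theorem relEntropy_thermal (hθ : 0 < θ) (hβ : 0 < β) {ρ : Fock →L[ℂ] Fock} (hρ : IsState ρ)
    (h : IsSpec ρ (thermal θ) ket) :
    relEntropy β ρ = ((β - θ) * Real.exp (-θ) + (1 - Real.exp (-θ)) *
      (Real.log (1 - Real.exp (-θ)) - Real.log (1 - Real.exp (-β)))) / (1 - Real.exp (-θ)) := by
  have hy := one_sub_exp_neg_pos hθ
  have hent : HasSum (fun n => Real.negMulLog (thermal θ n))
      (θ * (Real.exp (-θ) / (1 - Real.exp (-θ))) - Real.log (1 - Real.exp (-θ))) := by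
    have := ((hasSum_thermal_mul hθ).mul_left θ).sub
      ((hasSum_thermal hθ).mul_left (Real.log (1 - Real.exp (-θ))))
    rw [mul_one] at this
    refine this.congr_fun fun n => ?_
    rw [Real.negMulLog, log_thermal hθ]
    ring
  rw [h.relEntropy_eq hρ hβ, meanNumber_thermal hθ, hent.tsum_eq]
  field_simp
  ring

/-! ### The optimal constants -/

/-- Multiplied by `1 - e^{-θ}`, the relative entropy of a thermal state stays finite as `θ → 0`,
because `x log x → 0`. -/
theorem tendsto_scaled_relEntropy (β : ℝ) :
    Tendsto (fun θ : ℝ => (β - θ) * Real.exp (-θ) + (1 - Real.exp (-θ)) *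
      (Real.log (1 - Real.exp (-θ)) - Real.log (1 - Real.exp (-β)))) (𝓝 0) (𝓝 β) := by
  have : Continuous fun θ : ℝ => (β - θ) * Real.exp (-θ) +
      ((1 - Real.exp (-θ)) * Real.log (1 - Real.exp (-θ)) -
        (1 - Real.exp (-θ)) * Real.log (1 - Real.exp (-β))) := by
    have h := Real.continuous_mul_log.comp
      (show Continuous fun θ : ℝ => 1 - Real.exp (-θ) by fun_prop)
    exact (by fun_prop : Continuous fun θ : ℝ => (β - θ) * Real.exp (-θ)).add
      (h.sub (by fun_prop))
  have h0 := this.tendsto 0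
  simpa [mul_sub] using h0

/-- A log-Sobolev inequality that is saturated asymptotically by thermal states is optimal. -/
theorem optimal_of_tendsto (hβ : 0 < β) {p c : ℝ} (hc : 0 ≤ c) (hls : LogSobolev β p c)
    {e : ℝ → ℝ} (he : ∀ θ ρ, 0 < θ → IsState ρ → IsSpec ρ (thermal θ) ket →
      dirichlet β p ρ = ((e θ / (1 - Real.exp (-θ)) : ℝ) : EReal))
    (hlim : Tendsto e (𝓝[>] 0) (𝓝 (c * β))) :
    logSobolevConst β p = (c : EReal) ∧ IsGreatest {c : ℝ | 0 ≤ c ∧ LogSobolev β p c} c := by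
  obtain ⟨d, hd⟩ : ∃ d : ℝ → ℝ, ∀ θ, (β - θ) * Real.exp (-θ) + (1 - Real.exp (-θ)) *
      (Real.log (1 - Real.exp (-θ)) - Real.log (1 - Real.exp (-β))) = d θ := ⟨_, fun θ => rfl⟩
  have hdlim : Tendsto d (𝓝[>] 0) (𝓝 β) :=
    ((tendsto_scaled_relEntropy β).congr hd).mono_left nhdsWithin_le_nhds
  -- The common denominator `1 - e^{-θ}` of form and entropy cancels in the quotient.
  have hratio : Tendsto (fun θ => e θ / d θ) (𝓝[>] 0) (𝓝 c) := by
    have := hlim.div hdlim hβ.ne'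
    rwa [mul_div_cancel_right₀ _ hβ.ne'] at this
  have hev : ∀ᶠ θ in 𝓝[>] (0 : ℝ), 0 < θ ∧ 0 < d θ :=
    (eventually_mem_nhdsWithin).and (hdlim.eventually (lt_mem_nhds hβ))
  refine ⟨le_antisymm ?_ ?_, ⟨hc, hls⟩, fun c' hc' => ?_⟩
  · refine ge_of_tendsto (EReal.tendsto_coe.2 hratio) ?_
    filter_upwards [hev] with θ hθ
    obtain ⟨ρ, hρ, h⟩ := exists_thermalState hθ.1
    have hy := one_sub_exp_neg_pos hθ.1
    have hD := relEntropy_thermal hθ.1 hβ hρ h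
    rw [hd] at hD
    refine (iInf₂_le ρ ⟨hρ, hD ▸ (div_pos hθ.2 hy).ne'⟩).trans (le_of_eq ?_)
    rw [he θ ρ hθ.1 hρ h, hD, ← EReal.coe_div, div_div_div_cancel_right₀ hy.ne']
  · refine le_iInf₂ fun ρ hρ => ?_
    obtain ⟨lam, v, h⟩ := hρ.1.exists_isSpec
    have hD : 0 < relEntropy β ρ := lt_of_le_of_ne (h.relEntropy_nonneg hρ.1 hβ) hρ.2.symm
    rw [EReal.le_div_iff_mul_le (EReal.coe_pos.2 hD) (EReal.coe_ne_top _), ← EReal.coe_mul]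
    exact hls ρ hρ.1
  · refine ge_of_tendsto hratio ?_
    filter_upwards [hev] with θ hθ
    obtain ⟨ρ, hρ, h⟩ := exists_thermalState hθ.1
    have hy := one_sub_exp_neg_pos hθ.1
    have := hc'.2 ρ hρ
    rw [he θ ρ hθ.1 hρ h, relEntropy_thermal hθ.1 hβ hρ h, hd, EReal.coe_le_coe_iff, ← mul_div_assoc,
      div_le_div_iff_of_pos_right hy] at this
    exact (le_div_iff₀ hθ.2).2 this

/-- The constant is the `edge` of a thermal state at `θ = 0`, where `u = e^{-θ} = 1`, divided by the
limit `β` of the scaled entropy. -/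
theorem alphaValue_eq_edge {p : ℝ} (hp : 1 < p) :
    alphaValue β p = Real.exp (β / 2) / (4 * β) * edge (1 / p) 1 (Real.exp (-β)) := by
  have h0 : 0 < 1 / p := by positivity
  have h1 : 1 / p < 1 := (div_lt_one (zero_lt_one.trans hp)).2 hp
  have e := mul_conjExponent_div hp
  have e' : p * p.conjExponent = 1 / (1 / p * (1 - 1 / p)) := by
    have : p * p.conjExponent = 4 * (p * p.conjExponent / 4) := by ring
    rw [this, e]
    field_simp
  rw [edge, edge_factor h0 h1 zero_le_one (Real.exp_pos _).le, alphaValue, e',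
    div_eq_mul_one_div (-β) p, div_eq_mul_one_div (-β) p.conjExponent, conjExponent_inv hp,
    Real.one_rpow, Real.one_rpow, Real.exp_mul, Real.exp_mul]
  ring

theorem logSobolev_alphaValue (hβ : 0 < β) {p : ℝ} (hp : 1 < p) (hp2 : p ≤ 2) :
    LogSobolev β p (alphaValue β p) := by
  intro ρ hρ
  obtain ⟨lam, v, h⟩ := hρ.exists_isSpec
  have h0 : 0 < 1 / p := by positivity
  have h1 : 1 / p < 1 := (div_lt_one (zero_lt_one.trans hp)).2 hp
  rw [dirichlet, if_neg hp.ne', EReal.coe_le_coe_iff, h.dirichletGtOne_eq hρ hβ hp hp2,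
    h.relEntropy_eq hρ hβ]
  refine le_of_eq_of_le ?_ ((h.rateData hρ).logSobolev hβ h0 h1 (h.summable_negMulLog hρ))
  congr 1
  rw [alphaValue_eq_edge hp, edge, edge_factor h0 h1 zero_le_one (Real.exp_pos _).le, entCoeff,
    Real.one_rpow, Real.one_rpow, ← Real.exp_mul, ← Real.exp_mul, neg_mul, neg_mul]
  field_simp

theorem alphaValue_nonneg (hβ : 0 < β) {p : ℝ} (hp : 1 < p) : 0 ≤ alphaValue β p := by
  rw [alphaValue_eq_edge hp]
  exact mul_nonneg (by positivity) (edge_nonneg (by positivity)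
    ((div_lt_one (zero_lt_one.trans hp)).2 hp) zero_le_one (Real.exp_pos _).le)

theorem optimal_gt_one (hβ : 0 < β) {p : ℝ} (hp : 1 < p) (hp2 : p ≤ 2) :
    logSobolevConst β p = (alphaValue β p : EReal) ∧
      IsGreatest {c : ℝ | 0 ≤ c ∧ LogSobolev β p c} (alphaValue β p) := by
  have h0 : 0 < 1 / p := by positivity
  have h1 : 1 / p < 1 := (div_lt_one (zero_lt_one.trans hp)).2 hp
  refine optimal_of_tendsto hβ (alphaValue_nonneg hβ hp) (logSobolev_alphaValue hβ hp hp2)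
    (e := fun θ => Real.exp (β / 2) / 4 * edge (1 / p) (Real.exp (-θ)) (Real.exp (-β)))
    (fun θ ρ hθ hρ h => ?_) ?_
  · rw [dirichlet, if_neg hp.ne', h.dirichletGtOne_eq hρ hβ hp hp2, rateForm_thermal hθ h0 h1]
  · have hc : Continuous fun θ : ℝ =>
        Real.exp (β / 2) / 4 * edge (1 / p) (Real.exp (-θ)) (Real.exp (-β)) := by
      unfold edge
      simp only [← Real.exp_mul]
      fun_prop
    have := (hc.tendsto 0).mono_left (nhdsWithin_le_nhds (s := Set.Ioi 0))
    rw [neg_zero, Real.exp_zero] at this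
    convert this using 2
    rw [alphaValue_eq_edge hp]
    field_simp

theorem half_sinh_eq (β : ℝ) :
    1 / 2 * Real.sinh (β / 2) = Real.exp (β / 2) / 4 * (1 - Real.exp (-β)) := by
  have : Real.exp (β / 2) * Real.exp (-β) = Real.exp (-(β / 2)) := by
    rw [← Real.exp_add]; ring_nf
  rw [Real.sinh_eq]
  linear_combination (1 / 4) * this

theorem tendsto_alphaValue (hβ : 0 < β) :
    Tendsto (alphaValue β) (𝓝[>] 1) (𝓝 (1 / 2 * Real.sinh (β / 2))) := by
  have h := ((tendsto_edge one_pos (Real.exp_pos (-β))).comp tendsto_one_div_nhdsGT_one).const_mul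
    (Real.exp (β / 2) / (4 * β))
  have e : Real.exp (β / 2) / (4 * β) * ((1 - Real.exp (-β)) * (Real.log 1 -
      Real.log (Real.exp (-β)))) = 1 / 2 * Real.sinh (β / 2) := by
    rw [half_sinh_eq, Real.log_one, Real.log_exp]
    field_simp
    ring
  rw [e] at h
  refine h.congr' ?_
  filter_upwards [self_mem_nhdsWithin] with p hp
  exact (alphaValue_eq_edge hp).symm

theorem logSobolev_one (hβ : 0 < β) : LogSobolev β 1 (1 / 2 * Real.sinh (β / 2)) := by
  intro ρ hρ
  refine le_of_tendsto_of_tendsto (EReal.tendsto_coe.2 ((tendsto_alphaValue hβ).mul_const _))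
    (hρ.tendsto_dirichlet hβ) ?_
  filter_upwards [Ioo_mem_nhdsGT (show (1 : ℝ) < 2 by norm_num)] with p hp
  have := logSobolev_alphaValue hβ hp.1 hp.2.le ρ hρ
  rwa [dirichlet, if_neg hp.1.ne'] at this

theorem optimal_one (hβ : 0 < β) :
    logSobolevConst β 1 = ((1 / 2 * Real.sinh (β / 2) : ℝ) : EReal) ∧
      IsGreatest {c : ℝ | 0 ≤ c ∧ LogSobolev β 1 c} (1 / 2 * Real.sinh (β / 2)) := by
  refine optimal_of_tendsto hβ (mul_nonneg (by norm_num) (Real.sinh_nonneg_iff.2 (by positivity)))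
    (logSobolev_one hβ)
    (e := fun θ => Real.exp (β / 2) / 4 * ((Real.exp (-θ) - Real.exp (-β)) * (β - θ)))
    (fun θ ρ hθ hρ h => ?_) ?_
  · refine tendsto_nhds_unique (hρ.tendsto_dirichlet hβ) (EReal.tendsto_coe.2 ?_)
    have hl := (((tendsto_edge (Real.exp_pos (-θ)) (Real.exp_pos (-β))).comp
      tendsto_one_div_nhdsGT_one).const_mul (Real.exp (β / 2) / 4)).div_const (1 - Real.exp (-θ))
    rw [Real.log_exp, Real.log_exp, neg_sub_neg] at hl
    refine hl.congr' ?_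
    filter_upwards [Ioo_mem_nhdsGT (show (1 : ℝ) < 2 by norm_num)] with p hp
    have hp0 : 0 < p := by linarith [hp.1]
    rw [h.dirichletGtOne_eq hρ hβ hp.1 hp.2.le, rateForm_thermal hθ (by positivity)
      ((div_lt_one hp0).2 hp.1)]
    rfl
  · have hc : Continuous fun θ : ℝ =>
        Real.exp (β / 2) / 4 * ((Real.exp (-θ) - Real.exp (-β)) * (β - θ)) := by fun_prop
    have := (hc.tendsto 0).mono_left (nhdsWithin_le_nhds (s := Set.Ioi 0))
    rw [neg_zero, Real.exp_zero, sub_zero] at this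
    convert this using 2
    rw [half_sinh_eq]
    ring

theorem tendsto_logSobolevConst (hβ : 0 < β) :
    Tendsto (fun p => logSobolevConst β p) (𝓝[>] (1 : ℝ)) (𝓝 (logSobolevConst β 1)) := by
  rw [(optimal_one hβ).1]
  refine (EReal.tendsto_coe.2 (tendsto_alphaValue hβ)).congr' ?_
  filter_upwards [Ioo_mem_nhdsGT (show (1 : ℝ) < 2 by norm_num)] with p hp
  exact (optimal_gt_one hβ hp.1 hp.2.le).1.symm

end

end QOU

theorem theorem2 (β : ℝ) (hβ : 0 < β) :
    -- the optimal constant for `1 < p ≤ 2`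
    (∀ p : ℝ, 1 < p → p ≤ 2 →
      QOU.logSobolevConst β p = ((QOU.alphaValue β p : ℝ) : EReal) ∧
      IsGreatest {c : ℝ | 0 ≤ c ∧ QOU.LogSobolev β p c} (QOU.alphaValue β p)) ∧
    -- `ℰ_1` is well defined as a limit, and it is `¼ ⟨log ρ - log σ, ℒ* Γ_σ⁻¹(ρ)⟩_σ` whenever
    -- `log ρ` is defined and the series in that expression converge absolutely
    (∀ ρ : QOU.Fock →L[ℂ] QOU.Fock, QOU.IsState ρ →
      Tendsto (fun p => ((QOU.dirichletGtOne β p ρ : ℝ) : EReal)) (𝓝[>] (1 : ℝ))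
        (𝓝 (QOU.dirichlet β 1 ρ)) ∧
      (Function.Injective ρ → Summable (QOU.logTerm β ρ) →
        Summable (QOU.wTerm β (QOU.logThermal β)
          (QOU.Lstar β (QOU.Gam β (-1) (QOU.toMatrix ρ)))) →
        QOU.dirichlet β 1 ρ =
          ((1 / 4 * ((∑' x : ℝ, QOU.logTerm β ρ x) -
            (QOU.wInner β (QOU.logThermal β)
              (QOU.Lstar β (QOU.Gam β (-1) (QOU.toMatrix ρ)))).re) : ℝ) : EReal))) ∧
    -- the optimal constant for `p = 1`
    QOU.logSobolevConst β 1 = ((1 / 2 * Real.sinh (β / 2) : ℝ) : EReal) ∧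
    IsGreatest {c : ℝ | 0 ≤ c ∧ QOU.LogSobolev β 1 c} (1 / 2 * Real.sinh (β / 2)) ∧
    Tendsto (fun p => QOU.logSobolevConst β p) (𝓝[>] (1 : ℝ)) (𝓝 (QOU.logSobolevConst β 1)) := by
  refine ⟨fun p hp hp2 => QOU.optimal_gt_one hβ hp hp2, fun ρ hρ =>
    ⟨hρ.tendsto_dirichlet hβ, fun hinj hlog hs => QOU.dirichlet_one_eq hρ hinj hβ hlog hs⟩,
    (QOU.optimal_one hβ).1, (QOU.optimal_one hβ).2, QOU.tendsto_logSobolevConst hβ⟩
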